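/- Let $B$ be a connected smooth manifold of dimension $n$, let $\mathcal G$ be a connected abelian Lie group of dimension $N \ge 1$, and let $\pi : M \to B$ be a twisted principal $\mathcal G$-bundle, i.e. a smooth fiber bundle with fiber $\mathcal G$ and structure group $\mathcal G \rtimes \operatorname{Aut}(\mathcal G)_\delta$, where $\operatorname{Aut}(\mathcal G)_\delta$ is the automorphism group with the discrete topology. Thus the transition maps are locally of the form $(b,x) \mapsto f(b)\,\gamma(x)$, with $f$ smooth and $\gamma$ an automorphism of $\mathcal G$ that is locally independent of $b$. The differentials of the automorphisms $\gamma$ define a flat vector bundle $e$ on $B$ whose fiber is the Lie algebra of $\mathcal G$; suppose that its holonomy lies in $\det^{-1}(\pm 1)$. Let $\overline g$ be a Riemannian metric on $M$ for which the local $\mathcal G$-actions, given by translations of the fibers in the local trivializations, are isometric. In local coordinates $b^\alpha$ on $B$ and linear coordinates $x^I$ on the fibers, write $$\overline g = \sum_{I,J=1}^N G_{IJ}\,(dx^I + A^I)(dx^J + A^J) + \sum_{\alpha,\beta=1}^n g_{\alpha\beta}\, db^\alpha db^\beta ,$$ where $g_B = (g_{\alpha\beta})$ is the metric on $B$ that makes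 $\pi$ a Riemannian submersion, $G = (G_{IJ})$ is a Euclidean inner product on $e$, and $A^I = A^I_\alpha\, db^\alpha$. Put $F^I_{\alpha\beta} = \partial_\alpha A^I_\beta - \partial_\beta A^I_\alpha$ and $|F|^2 = g^{\alpha\gamma} g^{\beta\delta} G_{IJ} F^I_{\alpha\beta} F^J_{\gamma\delta}$. Let $\det G : B \to (0,\infty)$ be the determinant of $G$ in a parallel frame of $e$; by the holonomy assumption it is globally defined, up to a constant positive factor. Commas denote partial derivatives on $B$, and semicolons denote covariant derivatives with respect to $g_B$, so that $G_{IJ;\alpha\beta} = \partial_\alpha\partial_\beta G_{IJ} - \Gamma^\sigma_{\alpha\beta}\, \partial_\sigma G_{IJ}$. Suppose that $\operatorname{Ric}(\overline g) = \lambda \overline g$ for some $\lambda \in \mathbb R$. Then $$\triangle \sqrt{\det G} = \left( \tfrac14 |F|^2 - \lambda N \right) \sqrt{\det G} \quad \text{on } B .$$ If, moreover, $(B, g_B)$ is parabolic (every nonnegative $C^2$ function $f$ on $B$ that is bounded above and satisfies $\triangle f \ge 0$ is constant), $\lambda \le 0$, and $\det G$ is bounded above, then 1. $\det G$ is constant,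 2. $F = 0$, 3. $\lambda = 0$, and 4. $g^{\alpha\beta} G_{IJ;\alpha\beta} - g^{\alpha\beta} G^{KL} G_{IK,\alpha} G_{LJ,\beta} = 0$ for all $I, J$. (After normalizing $\det G = 1$, the last equation is the local equation for a harmonic map from $B$ to $\operatorname{SL}(N,\mathbb R)/\operatorname{SO}(N)$.) -/

import Mathlib

open Set Filter Topology Bundle
open scoped Manifold ContDiff

noncomputable section

namespace TwistedBundle

/-- The model space with coordinates indexed by `ι`. -/
abbrev Coord (ι : Type) [Fintype ι] : Type := EuclideanSpace ℝ ι

section Coordinates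

variable {ι : Type} [Fintype ι] [DecidableEq ι]

/-- The partial derivative `∂_i u` of a function on the model space. -/
def pd (i : ι) (u : Coord ι → ℝ) (y : Coord ι) : ℝ :=
  fderiv ℝ u y (EuclideanSpace.single i (1 : ℝ))

/-- The Christoffel symbols `Γ^k_{ij}` of a metric given by its matrix of coefficients. -/
def christoffel (g : Coord ι → Matrix ι ι ℝ) (k i j : ι) (y : Coord ι) : ℝ :=
  (1 / 2) * ∑ l, (g y)⁻¹ k l *
    (pd i (fun z => g z j l) y + pd j (fun z => g z i l) y - pd l (fun z => g z i j) y)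

/-- The Ricci tensor `R_{ij}`, with the sign for which round spheres are positive. -/
def ricci (g : Coord ι → Matrix ι ι ℝ) (i j : ι) (y : Coord ι) : ℝ :=
  (∑ k, pd k (christoffel g k i j) y) - (∑ k, pd j (christoffel g k i k) y)
    + (∑ k, ∑ l, christoffel g k k l y * christoffel g l i j y)
    - ∑ k, ∑ l, christoffel g k j l y * christoffel g l i k y

/-- The second covariant derivative
`u_{;ij} = ∂_i ∂_j u - Γ^k_{ij} ∂_k u` of a function. -/
def hess (g : Coord ι → Matrix ι ι ℝ) (u : Coord ι → ℝ) (i j : ι) (y : Coord ι) : ℝ :=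
  pd i (pd j u) y - ∑ k, christoffel g k i j y * pd k u y

/-- The Laplace-Beltrami operator `g^{ij} u_{;ij}`. -/
def coordLaplacian (g : Coord ι → Matrix ι ι ℝ) (u : Coord ι → ℝ) (y : Coord ι) : ℝ :=
  ∑ i, ∑ j, (g y)⁻¹ i j * hess g u i j y

end Coordinates

section Manifolds

variable {ι : Type} [Fintype ι] [DecidableEq ι]
variable {X : Type*} [TopologicalSpace X] [ChartedSpace (Coord ι) X]

/-- The smooth charts of a manifold. -/
abbrev charts (ι : Type) [Fintype ι] (X : Type*) [TopologicalSpace X]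
    [ChartedSpace (Coord ι) X] : Set (OpenPartialHomeomorph X (Coord ι)) :=
  IsManifold.maximalAtlas 𝓘(ℝ, Coord ι) ∞ X

/-- The coordinate vector field `∂_i` of the chart `φ`, at the point with coordinates `y`. -/
def coordVec (φ : OpenPartialHomeomorph X (Coord ι)) (y : Coord ι) (i : ι) :
    TangentSpace 𝓘(ℝ, Coord ι) (φ.symm y) :=
  mfderiv 𝓘(ℝ, Coord ι) 𝓘(ℝ, Coord ι) φ.symm y (EuclideanSpace.single i (1 : ℝ) : Coord ι)

variable [IsManifold 𝓘(ℝ, Coord ι) ∞ X]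

/-- Smooth Riemannian metrics on a manifold. -/
abbrev Metric (ι : Type) [Fintype ι] (X : Type*) [TopologicalSpace X]
    [ChartedSpace (Coord ι) X] [IsManifold 𝓘(ℝ, Coord ι) ∞ X] :=
  ContMDiffRiemannianMetric 𝓘(ℝ, Coord ι) ∞ (Coord ι)
    (fun x : X => TangentSpace 𝓘(ℝ, Coord ι) x)

/-- The coefficients `g_{ij}` of a Riemannian metric in the chart `φ`. -/
def metricCoeff (g : Metric ι X) (φ : OpenPartialHomeomorph X (Coord ι)) (y : Coord ι) :
    Matrix ι ι ℝ :=
  fun i j => g.inner (φ.symm y) (coordVec φ y i) (coordVec φ y j)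

/-- The Einstein equation `Ric(g) = lam g`. -/
def IsEinstein (g : Metric ι X) (lam : ℝ) : Prop :=
  ∀ φ ∈ charts ι X, ∀ y ∈ φ.target, ∀ i j,
    ricci (metricCoeff g φ) i j y = lam * metricCoeff g φ y i j

/-- `Δ f ≥ 0` for the metric `g`. -/
def IsSubharmonic (g : Metric ι X) (f : X → ℝ) : Prop :=
  ∀ φ ∈ charts ι X, ∀ y ∈ φ.target,
    0 ≤ coordLaplacian (metricCoeff g φ) (fun z => f (φ.symm z)) y

/-- Parabolicity of a connected Riemannian manifold: nonnegative bounded `C²` functions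
with `Δ f ≥ 0` are constant. -/
def IsParabolic (g : Metric ι X) : Prop :=
  ∀ f : X → ℝ, ContMDiff 𝓘(ℝ, Coord ι) 𝓘(ℝ, ℝ) 2 f → (∀ x, 0 ≤ f x) →
    BddAbove (range f) → IsSubharmonic g f → ∃ c, ∀ x, f x = c

end Manifolds

section Bundles

variable {n N : ℕ}
variable {B : Type*} [TopologicalSpace B] [ChartedSpace (Coord (Fin n)) B]
variable {M : Type*} [TopologicalSpace M] [ChartedSpace (Coord (Fin n ⊕ Fin N)) M]
variable {𝒢 : Type*} [CommGroup 𝒢] [TopologicalSpace 𝒢] [ChartedSpace (Coord (Fin N)) 𝒢]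
variable {proj : M → B}

/-- The transition map between two local trivializations, on the fiber over `b`. -/
def transition (e e' : Trivialization 𝒢 proj) (b : B) (x : 𝒢) : 𝒢 :=
  (e' (e.toOpenPartialHomeomorph.symm (b, x))).2

variable (𝒢) (proj) in
/-- A twisted principal `𝒢`-bundle `proj : M → B`, i.e. a smooth fiber bundle with fiber `𝒢` and
structure group `𝒢 ⋊ Aut(𝒢)_δ`: it has smooth local trivializations whose transition maps are,
locally in the base, of the form `(b, x) ↦ f b * γ x` with `γ` an automorphism of `𝒢` that does
not depend on `b`. (The maps `f` and `γ` are then automatically smooth.) -/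
structure TwistedPrincipalBundle where
  /-- the local trivializations of the bundle -/
  atlas : Set (Trivialization 𝒢 proj)
  exists_mem_baseSet : ∀ b : B, ∃ e ∈ atlas, b ∈ e.baseSet
  contMDiffOn : ∀ e ∈ atlas, ContMDiffOn 𝓘(ℝ, Coord (Fin n ⊕ Fin N))
    (𝓘(ℝ, Coord (Fin n)).prod 𝓘(ℝ, Coord (Fin N))) ∞ e e.source
  contMDiffOn_symm : ∀ e ∈ atlas, ContMDiffOn
    (𝓘(ℝ, Coord (Fin n)).prod 𝓘(ℝ, Coord (Fin N))) 𝓘(ℝ, Coord (Fin n ⊕ Fin N)) ∞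
    e.toOpenPartialHomeomorph.symm e.target
  exists_transition : ∀ e ∈ atlas, ∀ e' ∈ atlas, ∀ b₀ ∈ e.baseSet ∩ e'.baseSet,
    ∃ (f : B → 𝒢) (γ : 𝒢 ≃ₜ* 𝒢), ∀ᶠ b in 𝓝 b₀, ∀ x, transition e e' b x = f b * γ x

/-- The differential at the identity of the automorphism `γ` of `𝒢` in the transition map
`x ↦ f b * γ x` between two trivializations. These are the (locally constant) transition functions
of the flat vector bundle with fiber the Lie algebra of `𝒢`. The Lie algebra, being the tangent
space at the identity, is identified with the model space of `𝒢`. -/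
def transitionDeriv (e e' : Trivialization 𝒢 proj) (b : B) :
    Coord (Fin N) →L[ℝ] Coord (Fin N) :=
  mfderiv 𝓘(ℝ, Coord (Fin N)) 𝓘(ℝ, Coord (Fin N))
    (fun x : 𝒢 => (transition e e' b 1)⁻¹ * transition e e' b x) (1 : 𝒢)

/-- The local action of `h ∈ 𝒢` on `M` defined by the local trivialization `e`. -/
def localAct (e : Trivialization 𝒢 proj) (h : 𝒢) (p : M) : M :=
  e.toOpenPartialHomeomorph.symm (proj p, h * (e p).2)

/-- The local section of `M` defined by the local trivialization `e`. -/
def localSection (e : Trivialization 𝒢 proj) (b : B) : M :=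
  e.toOpenPartialHomeomorph.symm (b, 1)

/-- The vertical vector, at the point `localSection e b`, which the local action induces from the
element `w` of the Lie algebra of `𝒢`. -/
def vertVec (e : Trivialization 𝒢 proj) (b : B) (w : Coord (Fin N)) :
    TangentSpace 𝓘(ℝ, Coord (Fin n ⊕ Fin N)) (localSection e b) :=
  mfderiv 𝓘(ℝ, Coord (Fin N)) 𝓘(ℝ, Coord (Fin n ⊕ Fin N))
    (fun h : 𝒢 => e.toOpenPartialHomeomorph.symm (b, h)) (1 : 𝒢) w

namespace TwistedPrincipalBundle

variable (P : TwistedPrincipalBundle (n := n) (N := N) 𝒢 proj)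

/-- Parallel transport for the flat vector bundle with fiber the Lie algebra of `𝒢`. The statement
`P.Transport e b e' b' L` says that along some path from `b` to `b'` the parallel transport, when
written in the trivializations `e` at `b` and `e'` at `b'`, is `L`. -/
inductive Transport (e : Trivialization 𝒢 proj) (b : B) :
    Trivialization 𝒢 proj → B → (Coord (Fin N) →L[ℝ] Coord (Fin N)) → Prop
  | refl (he : e ∈ P.atlas) (hb : b ∈ e.baseSet) :
      Transport e b e b (ContinuousLinearMap.id ℝ _)
  | move {e' : Trivialization 𝒢 proj} {b' b'' : B} {L : Coord (Fin N) →L[ℝ] Coord (Fin N)}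
      (h : Transport e b e' b' L) (hb : JoinedIn e'.baseSet b' b'') : Transport e b e' b'' L
  | change {e' e'' : Trivialization 𝒢 proj} {b' : B} {L : Coord (Fin N) →L[ℝ] Coord (Fin N)}
      (h : Transport e b e' b' L) (he : e'' ∈ P.atlas) (hb : b' ∈ e''.baseSet) :
      Transport e b e'' b' ((transitionDeriv e' e'' b').comp L)

/-- The holonomy of the flat vector bundle lies in `det⁻¹(±1)`. -/
def HolonomyDetPmOne : Prop :=
  ∀ (e : Trivialization 𝒢 proj) (b : B) (L : Coord (Fin N) →L[ℝ] Coord (Fin N)),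
    P.Transport e b e b L → |LinearMap.det (L : Coord (Fin N) →ₗ[ℝ] Coord (Fin N))| = 1

variable [IsManifold 𝓘(ℝ, Coord (Fin n)) ∞ B] [IsManifold 𝓘(ℝ, Coord (Fin n ⊕ Fin N)) ∞ M]

/-- The local `𝒢`-actions are isometric. -/
def IsInvariantMetric (gM : Metric (Fin n ⊕ Fin N) M) : Prop :=
  ∀ e ∈ P.atlas, ∀ (h : 𝒢), ∀ p ∈ e.source,
    ∀ u w : TangentSpace 𝓘(ℝ, Coord (Fin n ⊕ Fin N)) p,
      gM.inner (localAct e h p)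
        (mfderiv 𝓘(ℝ, Coord (Fin n ⊕ Fin N)) 𝓘(ℝ, Coord (Fin n ⊕ Fin N)) (localAct e h) p u)
        (mfderiv 𝓘(ℝ, Coord (Fin n ⊕ Fin N)) 𝓘(ℝ, Coord (Fin n ⊕ Fin N)) (localAct e h) p w)
      = gM.inner p u w

end TwistedPrincipalBundle

variable [IsManifold 𝓘(ℝ, Coord (Fin n)) ∞ B] [IsManifold 𝓘(ℝ, Coord (Fin n ⊕ Fin N)) ∞ M]

/-- `proj` is a Riemannian submersion: on vectors that are orthogonal to the fibers, the metric of `M`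
is the pullback of the metric of `B`. -/
def IsRiemannianSubmersion (proj : M → B) (gM : Metric (Fin n ⊕ Fin N) M)
    (gB : Metric (Fin n) B) : Prop :=
  ∀ (p : M) (u w : TangentSpace 𝓘(ℝ, Coord (Fin n ⊕ Fin N)) p),
    (∀ z : TangentSpace 𝓘(ℝ, Coord (Fin n ⊕ Fin N)) p,
      mfderiv 𝓘(ℝ, Coord (Fin n ⊕ Fin N)) 𝓘(ℝ, Coord (Fin n)) proj p z = 0 →
        gM.inner p u z = 0 ∧ gM.inner p w z = 0) →
    gM.inner p u w = gB.inner (proj p)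
      (mfderiv 𝓘(ℝ, Coord (Fin n ⊕ Fin N)) 𝓘(ℝ, Coord (Fin n)) proj p u)
      (mfderiv 𝓘(ℝ, Coord (Fin n ⊕ Fin N)) 𝓘(ℝ, Coord (Fin n)) proj p w)

/-- The fiberwise inner product `G` on the Lie algebra of `𝒢`, in the trivialization `e`. -/
def fiberInner (gM : Metric (Fin n ⊕ Fin N) M) (e : Trivialization 𝒢 proj) (b : B)
    (w w' : Coord (Fin N)) : ℝ :=
  gM.inner (localSection e b) (vertVec e b w) (vertVec e b w')

/-- The matrix `G_{IJ}` in the chart `φ` of `B`, the trivialization `e` and the basis `v` of the Lie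
algebra of `𝒢`. -/
def matG (gM : Metric (Fin n ⊕ Fin N) M) (e : Trivialization 𝒢 proj)
    (v : Module.Basis (Fin N) ℝ (Coord (Fin N))) (φ : OpenPartialHomeomorph B (Coord (Fin n)))
    (y : Coord (Fin n)) : Matrix (Fin N) (Fin N) ℝ :=
  fun I J => fiberInner gM e (φ.symm y) (v I) (v J)

/-- The components `A^I_α` of the connection whose horizontal spaces are the orthogonal complements
of the fibers, so that `gM = G_{IJ} (dx^I + A^I) (dx^J + A^J) + g_{αβ} db^α db^β`
and thus `gM (∂_α, ∂_J) = G_{IJ} A^I_α`. -/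
def connA (gM : Metric (Fin n ⊕ Fin N) M) (e : Trivialization 𝒢 proj)
    (v : Module.Basis (Fin N) ℝ (Coord (Fin N))) (φ : OpenPartialHomeomorph B (Coord (Fin n)))
    (I : Fin N) (α : Fin n) (y : Coord (Fin n)) : ℝ :=
  ∑ J, (matG gM e v φ y)⁻¹ I J *
    gM.inner (localSection e (φ.symm y))
      (mfderiv 𝓘(ℝ, Coord (Fin n)) 𝓘(ℝ, Coord (Fin n ⊕ Fin N)) (localSection e) (φ.symm y)
        (coordVec φ y α))
      (vertVec e (φ.symm y) (v J))

/-- The curvature `F^I_{αβ} = ∂_α A^I_β - ∂_β A^I_α`. -/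
def curvF (gM : Metric (Fin n ⊕ Fin N) M) (e : Trivialization 𝒢 proj)
    (v : Module.Basis (Fin N) ℝ (Coord (Fin N))) (φ : OpenPartialHomeomorph B (Coord (Fin n)))
    (I : Fin N) (α β : Fin n) (y : Coord (Fin n)) : ℝ :=
  pd α (connA gM e v φ I β) y - pd β (connA gM e v φ I α) y

/-- `|F|² = g^{αγ} g^{βδ} G_{IJ} F^I_{αβ} F^J_{γδ}`. -/
def normSqF (gM : Metric (Fin n ⊕ Fin N) M) (gB : Metric (Fin n) B) (e : Trivialization 𝒢 proj)
    (v : Module.Basis (Fin N) ℝ (Coord (Fin N))) (φ : OpenPartialHomeomorph B (Coord (Fin n)))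
    (y : Coord (Fin n)) : ℝ :=
  ∑ α, ∑ β, ∑ γ, ∑ δ, ∑ I, ∑ J,
    (metricCoeff gB φ y)⁻¹ α γ * (metricCoeff gB φ y)⁻¹ β δ * matG gM e v φ y I J *
      curvF gM e v φ I α β y * curvF gM e v φ J γ δ y

/-- The left-hand side `g^{αβ} G_{IJ;αβ} - g^{αβ} G^{KL} G_{IK,α} G_{LJ,β}` of the local equation
for a harmonic map to `SL(N,ℝ)/SO(N)`. -/
def harmonicG (gM : Metric (Fin n ⊕ Fin N) M) (gB : Metric (Fin n) B) (e : Trivialization 𝒢 proj)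
    (v : Module.Basis (Fin N) ℝ (Coord (Fin N))) (φ : OpenPartialHomeomorph B (Coord (Fin n)))
    (I J : Fin N) (y : Coord (Fin n)) : ℝ :=
  (∑ α, ∑ β, (metricCoeff gB φ y)⁻¹ α β *
      hess (metricCoeff gB φ) (fun z => matG gM e v φ z I J) α β y)
    - ∑ α, ∑ β, ∑ K, ∑ L, (metricCoeff gB φ y)⁻¹ α β * (matG gM e v φ y)⁻¹ K L *
        pd α (fun z => matG gM e v φ z I K) y * pd β (fun z => matG gM e v φ z L J) y

/-- The function `det G` on `B`: the determinant of the matrix of `G` in the frame of the flat vector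
bundle that is obtained from the basis `v` of the fiber over `b₀` (written in the trivialization
`e₀`) by parallel transport to `b`. When the holonomy is in `det⁻¹(±1)`, it does not depend on the
choice of the path and of the trivialization at `b`. -/
def TwistedPrincipalBundle.detG (P : TwistedPrincipalBundle (n := n) (N := N) 𝒢 proj)
    (gM : Metric (Fin n ⊕ Fin N) M) (v : Module.Basis (Fin N) ℝ (Coord (Fin N)))
    (e₀ : Trivialization 𝒢 proj) (b₀ b : B) : ℝ :=
  Classical.epsilon fun d : ℝ =>
    ∃ (e : Trivialization 𝒢 proj) (L : Coord (Fin N) →L[ℝ] Coord (Fin N)),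
      P.Transport e₀ b₀ e b L ∧
        d = Matrix.det (Matrix.of fun I J => fiberInner gM e b (L (v I)) (L (v J)))

end Bundles

end TwistedBundle

end

open TwistedBundle

/-
Since `𝒢` is abelian it has a logarithm chart, and together with a local trivialization and a chart
of `B` this gives coordinates on `M` in which translations of the fibers are translations of the
coordinates. There the invariant metric is `G (dx + A)² + g` with coefficients that depend on the
point of `B` only. A linear shear of the coordinates makes `A` vanish at a given point, where the
vertical part of the Ricci tensor can then be computed from block matrices. Tracing its Einstein
equation with `G⁻¹` gives the formula for `Δ √(det G)`. If `λ ≤ 0`, then `√(det G)` is subharmonic,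
hence constant on a parabolic base; so `|F|² = 4 λ N`, which forces `F = 0` and `λ = 0`, and the
vertical Einstein equation turns into the harmonic map equation.
-/

noncomputable section

namespace TwistedBundle

section SmoothMatrix

variable {E : Type*} [NormedAddCommGroup E] [NormedSpace ℝ E] {a b c : Type*} {y : E}

/-- Entrywise smoothness of a matrix valued function. -/
def SmoothMatAt (A : E → Matrix a b ℝ) (y : E) : Prop :=
  ∀ i j, ContDiffAt ℝ ∞ (fun z => A z i j) y

lemma SmoothMatAt.differentiableAt {A : E → Matrix a b ℝ} (hA : SmoothMatAt A y) (i : a)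
    (j : b) : DifferentiableAt ℝ (fun z => A z i j) y :=
  (hA i j).differentiableAt (by simp)

lemma SmoothMatAt.congr {A A' : E → Matrix a b ℝ} (hA : SmoothMatAt A y)
    (h : A' =ᶠ[𝓝 y] A) : SmoothMatAt A' y :=
  fun i j => (hA i j).congr_of_eventuallyEq (h.mono fun z hz => by simp only [hz])

lemma SmoothMatAt.mul [Fintype b] {A : E → Matrix a b ℝ} {A' : E → Matrix b c ℝ}
    (hA : SmoothMatAt A y) (hA' : SmoothMatAt A' y) : SmoothMatAt (fun z => A z * A' z) y :=
  fun i j => by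
    simp only [Matrix.mul_apply]
    exact ContDiffAt.sum fun k _ => (hA i k).mul (hA' k j)

lemma SmoothMatAt.transpose {A : E → Matrix a b ℝ} (hA : SmoothMatAt A y) :
    SmoothMatAt (fun z => (A z).transpose) y :=
  fun i j => hA j i

lemma SmoothMatAt.det [Fintype a] [DecidableEq a] {A : E → Matrix a a ℝ}
    (hA : SmoothMatAt A y) : ContDiffAt ℝ ∞ (fun z => (A z).det) y := by
  simp only [Matrix.det_apply]
  exact ContDiffAt.sum fun σ _ => (contDiffAt_prod fun i _ => hA _ _).const_smul _

lemma SmoothMatAt.eventually_det_ne_zero [Fintype a] [DecidableEq a] {A : E → Matrix a a ℝ}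
    (hA : SmoothMatAt A y) (h : (A y).det ≠ 0) : ∀ᶠ z in 𝓝 y, (A z).det ≠ 0 :=
  hA.det.continuousAt.eventually_ne h

lemma SmoothMatAt.inv [Fintype a] [DecidableEq a] {A : E → Matrix a a ℝ}
    (hA : SmoothMatAt A y) (h : (A y).det ≠ 0) : SmoothMatAt (fun z => (A z)⁻¹) y := fun i j => by
  simp only [Matrix.inv_def, Ring.inverse_eq_inv', Matrix.smul_apply, smul_eq_mul,
    Matrix.adjugate_apply]
  refine ContDiffAt.mul (hA.det.inv h) (SmoothMatAt.det fun k l => ?_)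
  by_cases hk : k = j
  · subst hk
    simpa using contDiffAt_const
  · simpa [Matrix.updateRow_ne hk] using hA k l

end SmoothMatrix

section PartialDerivatives

variable {ι : Type} [Fintype ι] [DecidableEq ι] {i : ι} {y : Coord ι}

lemma pd_congr {u v : Coord ι → ℝ} (h : u =ᶠ[𝓝 y] v) : pd i u y = pd i v y := by
  rw [pd, pd, h.fderiv_eq]

@[simp] lemma pd_const (c : ℝ) : pd i (fun _ => c) y = 0 := by
  simp [pd]

lemma pd_add {u v : Coord ι → ℝ} (hu : DifferentiableAt ℝ u y) (hv : DifferentiableAt ℝ v y) :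
    pd i (fun z => u z + v z) y = pd i u y + pd i v y := by
  simp [pd, fderiv_fun_add hu hv]

lemma pd_mul {u v : Coord ι → ℝ} (hu : DifferentiableAt ℝ u y) (hv : DifferentiableAt ℝ v y) :
    pd i (fun z => u z * v z) y = pd i u y * v y + u y * pd i v y := by
  simp only [pd, fderiv_fun_mul hu hv, add_apply, smul_apply, smul_eq_mul]
  ring

lemma pd_const_mul (c : ℝ) (u : Coord ι → ℝ) : pd i (fun z => c * u z) y = c * pd i u y := by
  have h : (fun z => c * u z) = c • u := rfl
  rw [pd, h, fderiv_const_smul_field]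
  rfl

lemma pd_sum {κ : Type*} {s : Finset κ} {u : κ → Coord ι → ℝ}
    (hu : ∀ k ∈ s, DifferentiableAt ℝ (u k) y) :
    pd i (fun z => ∑ k ∈ s, u k z) y = ∑ k ∈ s, pd i (u k) y := by
  simp [pd, fderiv_fun_sum hu]

lemma pd_sqrt {u : Coord ι → ℝ} (hu : DifferentiableAt ℝ u y) (h : u y ≠ 0) :
    pd i (fun z => √(u z)) y = pd i u y / (2 * √(u y)) := by
  rw [pd, fderiv_sqrt hu h, smul_apply, smul_eq_mul, pd]
  ring

lemma contDiffAt_pd {u : Coord ι → ℝ} (hu : ContDiffAt ℝ ∞ u y) : ContDiffAt ℝ ∞ (pd i u) y :=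
  (hu.fderiv_right (m := ∞) le_rfl).clm_apply contDiffAt_const

/-- The entrywise partial derivative of a matrix valued function. -/
def pdMat {a b : Type*} (k : ι) (A : Coord ι → Matrix a b ℝ) (y : Coord ι) : Matrix a b ℝ :=
  Matrix.of fun i j => pd k (fun z => A z i j) y

variable {a b c : Type*}

lemma SmoothMatAt.pdMat {A : Coord ι → Matrix a b ℝ} (k : ι) (hA : SmoothMatAt A y) :
    SmoothMatAt (pdMat k A) y :=
  fun i j => contDiffAt_pd (hA i j)

lemma pdMat_congr {A A' : Coord ι → Matrix a b ℝ} (h : A =ᶠ[𝓝 y] A') :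
    pdMat i A y = pdMat i A' y := by
  ext p q
  exact pd_congr (h.mono fun z hz => by simp only [hz])

lemma pdMat_const (C : Matrix a b ℝ) : pdMat i (fun _ => C) y = 0 := by
  ext p q
  exact pd_const _

lemma pdMat_transpose (A : Coord ι → Matrix a b ℝ) :
    pdMat i (fun z => (A z).transpose) y = (pdMat i A y).transpose :=
  rfl

lemma pdMat_add {A A' : Coord ι → Matrix a b ℝ} (hA : SmoothMatAt A y) (hA' : SmoothMatAt A' y) :
    pdMat i (fun z => A z + A' z) y = pdMat i A y + pdMat i A' y := by
  ext p q
  exact pd_add (hA.differentiableAt p q) (hA'.differentiableAt p q)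

lemma pdMat_mul [Fintype b] {A : Coord ι → Matrix a b ℝ} {A' : Coord ι → Matrix b c ℝ}
    (hA : SmoothMatAt A y) (hA' : SmoothMatAt A' y) :
    pdMat i (fun z => A z * A' z) y = pdMat i A y * A' y + A y * pdMat i A' y := by
  ext p q
  have hd := fun l => hA.differentiableAt p l
  have hd' := fun l => hA'.differentiableAt l q
  simp only [pdMat, Matrix.mul_apply, Matrix.of_apply, Matrix.add_apply]
  rw [pd_sum fun l _ => (hd l).fun_mul (hd' l), ← Finset.sum_add_distrib]
  exact Finset.sum_congr rfl fun l _ => pd_mul (hd l) (hd' l)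

lemma pdMat_inv [Fintype a] [DecidableEq a] {A : Coord ι → Matrix a a ℝ} (hA : SmoothMatAt A y)
    (h : (A y).det ≠ 0) :
    pdMat i (fun z => (A z)⁻¹) y = -((A y)⁻¹ * pdMat i A y * (A y)⁻¹) := by
  have hone : (fun z => A z * (A z)⁻¹) =ᶠ[𝓝 y] fun _ => 1 :=
    (hA.eventually_det_ne_zero h).mono fun z hz =>
      Matrix.mul_nonsing_inv _ (isUnit_iff_ne_zero.2 hz)
  have hprod : pdMat i A y * (A y)⁻¹ + A y * pdMat i (fun z => (A z)⁻¹) y = 0 := by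
    rw [← pdMat_mul hA (hA.inv h), pdMat_congr hone, pdMat_const]
  rw [Matrix.mul_assoc, eq_neg_of_add_eq_zero_left hprod, Matrix.mul_neg, neg_neg,
    Matrix.nonsing_inv_mul_cancel_left _ _ (isUnit_iff_ne_zero.2 h)]

lemma pd_trace [Fintype a] {A : Coord ι → Matrix a a ℝ} (hA : SmoothMatAt A y) :
    pd i (fun z => (A z).trace) y = (pdMat i A y).trace :=
  pd_sum fun l _ => hA.differentiableAt l l

/-- The determinant as a continuous multilinear map of the rows. -/
def detRowCLM (a : Type*) [Fintype a] [DecidableEq a] :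
    ContinuousMultilinearMap ℝ (fun _ : a => a → ℝ) ℝ where
  toMultilinearMap := (Matrix.detRowAlternating : (a → ℝ) [⋀^a]→ₗ[ℝ] ℝ).toMultilinearMap
  cont := Continuous.matrix_det continuous_id

lemma pd_det_eq_trace_adjugate_mul [Fintype a] [DecidableEq a] {A : Coord ι → Matrix a a ℝ}
    (hA : SmoothMatAt A y) :
    pd i (fun z => (A z).det) y = ((A y).adjugate * pdMat i A y).trace := by
  have hrow : ∀ r, HasFDerivAt (fun z => A z r) (fderiv ℝ (fun z => A z r) y) y := fun r =>
    (differentiableAt_pi.2 fun j => hA.differentiableAt r j).hasFDerivAt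
  have hpd : ∀ r, fderiv ℝ (fun z => A z r) y (EuclideanSpace.single i 1) = pdMat i A y r := by
    intro r
    ext j
    exact congrArg (fun l => l (EuclideanSpace.single i (1 : ℝ)))
      (hasFDerivAt_pi'.1 (hrow r) j).fderiv.symm
  calc pd i (fun z => (A z).det) y
      = ∑ r, ((A y).updateRow r (pdMat i A y r)).det := by
        have h := (HasFDerivAt.multilinear_comp (detRowCLM a) hrow).fderiv
        refine (congrArg (fun l => l (EuclideanSpace.single i (1 : ℝ))) h).trans ?_
        rw [sum_apply]
        refine Finset.sum_congr rfl fun r _ => ?_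
        rw [← hpd]
        rfl
    _ = (pdMat i A y * (A y).adjugate).trace := by
        refine Finset.sum_congr rfl fun r _ => ?_
        rw [← Matrix.cramer_transpose_apply, Matrix.cramer_eq_adjugate_mulVec,
          ← Matrix.adjugate_transpose, Matrix.mulVec_transpose]
        rfl
    _ = ((A y).adjugate * pdMat i A y).trace := Matrix.trace_mul_comm _ _

lemma pd_det [Fintype a] [DecidableEq a] {A : Coord ι → Matrix a a ℝ} (hA : SmoothMatAt A y)
    (h : (A y).det ≠ 0) :
    pd i (fun z => (A z).det) y = (A y).det * ((A y)⁻¹ * pdMat i A y).trace := by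
  rw [pd_det_eq_trace_adjugate_mul hA, Matrix.inv_def, Ring.inverse_eq_inv', Matrix.smul_mul,
    Matrix.trace_smul, smul_eq_mul, mul_inv_cancel_left₀ h]

end PartialDerivatives

section Laplacian

variable {ι : Type} [Fintype ι] [DecidableEq ι] (g : Coord ι → Matrix ι ι ℝ) {y : Coord ι}

lemma hess_congr {u v : Coord ι → ℝ} (h : u =ᶠ[𝓝 y] v) (i j : ι) :
    hess g u i j y = hess g v i j y := by
  have hpd : pd j u =ᶠ[𝓝 y] pd j v := h.eventually_nhds.mono fun z hz => pd_congr hz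
  simp only [hess, pd_congr hpd, pd_congr h]

lemma coordLaplacian_congr {u v : Coord ι → ℝ} (h : u =ᶠ[𝓝 y] v) :
    coordLaplacian g u y = coordLaplacian g v y := by
  simp only [coordLaplacian, hess_congr g h]

lemma hess_const_mul (c : ℝ) (u : Coord ι → ℝ) (i j : ι) :
    hess g (fun z => c * u z) i j y = c * hess g u i j y := by
  have hpd : pd j (fun z => c * u z) = fun z => c * pd j u z :=
    funext fun z => pd_const_mul c u
  simp only [hess, hpd, pd_const_mul, mul_sub, Finset.mul_sum, mul_left_comm c]

lemma coordLaplacian_const_mul (c : ℝ) (u : Coord ι → ℝ) :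
    coordLaplacian g (fun z => c * u z) y = c * coordLaplacian g u y := by
  simp only [coordLaplacian, hess_const_mul, Finset.mul_sum, mul_left_comm c]

lemma coordLaplacian_const (c : ℝ) : coordLaplacian g (fun _ => c) y = 0 := by
  have hpd : ∀ j, pd j (fun _ : Coord ι => c) = fun _ => 0 := fun j => funext fun z => pd_const c
  simp [coordLaplacian, hess, hpd]

variable {κ : Type}

/-- The second covariant derivatives of the entries of a matrix valued function. -/
def hessMat (A : Coord ι → Matrix κ κ ℝ) (i j : ι) (y : Coord ι) : Matrix κ κ ℝ :=
  pdMat i (pdMat j A) y - ∑ k, christoffel g k i j y • pdMat k A y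

lemma hessMat_apply (A : Coord ι → Matrix κ κ ℝ) (i j : ι) (I J : κ) :
    hessMat g A i j y I J = hess g (fun z => A z I J) i j y := by
  simp only [hessMat, hess, Matrix.sub_apply, Matrix.sum_apply, Matrix.smul_apply, smul_eq_mul]
  rfl

variable [Fintype κ] [DecidableEq κ] {G : Coord ι → Matrix κ κ ℝ}

lemma pd_sqrt_det (hG : SmoothMatAt G y) (hdet : 0 < (G y).det) (i : ι) :
    pd i (fun z => √(G z).det) y = 1 / 2 * (√(G y).det * ((G y)⁻¹ * pdMat i G y).trace) := by
  rw [pd_sqrt (hG.det.differentiableAt (by simp)) hdet.ne', pd_det hG hdet.ne',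
    div_eq_iff (by positivity)]
  linear_combination -((G y)⁻¹ * pdMat i G y).trace * Real.mul_self_sqrt hdet.le

lemma pd_trace_inv_mul_pdMat (hG : SmoothMatAt G y) (hdet : (G y).det ≠ 0) (i j : ι) :
    pd i (fun z => ((G z)⁻¹ * pdMat j G z).trace) y =
      ((G y)⁻¹ * pdMat i (pdMat j G) y).trace
        - ((G y)⁻¹ * (pdMat i G y * (G y)⁻¹ * pdMat j G y)).trace := by
  have hinv := hG.inv hdet
  rw [pd_trace (hinv.mul (hG.pdMat j)), pdMat_mul hinv (hG.pdMat j), pdMat_inv hG hdet,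
    Matrix.trace_add, Matrix.neg_mul, Matrix.trace_neg]
  simp only [Matrix.mul_assoc]
  ring

lemma hess_sqrt_det (hG : ∀ᶠ z in 𝓝 y, SmoothMatAt G z) (hdet : 0 < (G y).det) (i j : ι) :
    hess g (fun z => √(G z).det) i j y = √(G y).det *
      (1 / 4 * (((G y)⁻¹ * pdMat i G y).trace * ((G y)⁻¹ * pdMat j G y).trace)
        - 1 / 2 * ((G y)⁻¹ * (pdMat i G y * (G y)⁻¹ * pdMat j G y)).trace
        + 1 / 2 * ((G y)⁻¹ * hessMat g G i j y).trace) := by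
  have hGy := hG.self_of_nhds
  have hpd : pd j (fun z => √(G z).det) =ᶠ[𝓝 y]
      fun z => 1 / 2 * (√(G z).det * ((G z)⁻¹ * pdMat j G z).trace) := by
    filter_upwards [hG, hGy.det.continuousAt.eventually_const_lt hdet] with z hz hz'
    exact pd_sqrt_det hz hz' j
  have hsqrt : DifferentiableAt ℝ (fun z => √(G z).det) y :=
    (hGy.det.differentiableAt (by simp)).sqrt hdet.ne'
  have htr : DifferentiableAt ℝ (fun z => ((G z)⁻¹ * pdMat j G z).trace) y :=
    DifferentiableAt.fun_sum fun l _ => ((hGy.inv hdet.ne').mul (hGy.pdMat j)).differentiableAt l l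
  have hΓ : ∑ k, christoffel g k i j y * pd k (fun z => √(G z).det) y = 1 / 2 * √(G y).det *
      ∑ k, christoffel g k i j y * ((G y)⁻¹ * pdMat k G y).trace := by
    simp only [pd_sqrt_det hGy hdet, Finset.mul_sum]
    exact Finset.sum_congr rfl fun k _ => by ring
  rw [hess, pd_congr hpd, pd_const_mul, pd_mul hsqrt htr, pd_sqrt_det hGy hdet,
    pd_trace_inv_mul_pdMat hGy hdet.ne', hΓ]
  simp only [hessMat, Matrix.mul_sub, Matrix.mul_sum, Matrix.mul_smul, Matrix.trace_sub,
    Matrix.trace_sum, Matrix.trace_smul, smul_eq_mul]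
  ring

lemma coordLaplacian_sqrt_det (hG : ∀ᶠ z in 𝓝 y, SmoothMatAt G z) (hdet : 0 < (G y).det) :
    coordLaplacian g (fun z => √(G z).det) y = √(G y).det *
      (1 / 4 * (∑ i, ∑ j, (g y)⁻¹ i j *
          (((G y)⁻¹ * pdMat i G y).trace * ((G y)⁻¹ * pdMat j G y).trace))
        - 1 / 2 * (∑ i, ∑ j, (g y)⁻¹ i j *
          ((G y)⁻¹ * (pdMat i G y * (G y)⁻¹ * pdMat j G y)).trace)
        + 1 / 2 * ∑ i, ∑ j, (g y)⁻¹ i j * ((G y)⁻¹ * hessMat g G i j y).trace) := by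
  simp only [coordLaplacian, hess_sqrt_det g hG hdet, Finset.mul_sum, ← Finset.sum_add_distrib,
    ← Finset.sum_sub_distrib]
  exact Finset.sum_congr rfl fun i _ => Finset.sum_congr rfl fun j _ => by ring

end Laplacian

section BaseProjection

variable (ι κ : Type) [Fintype ι] [Fintype κ]

/-- The projection of `Coord (ι ⊕ κ)` to the coordinates of the base. -/
def baseProj : Coord (ι ⊕ κ) →L[ℝ] Coord ι :=
  LinearMap.toContinuousLinearMap
    { toFun := fun z => WithLp.toLp 2 fun α => z (Sum.inl α)
      map_add' := fun _ _ => rfl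
      map_smul' := fun _ _ => rfl }

/-- The inclusion of the coordinates of the base as the slice where all fiber coordinates vanish. -/
def baseIncl : Coord ι →L[ℝ] Coord (ι ⊕ κ) :=
  LinearMap.toContinuousLinearMap
    { toFun := fun y => WithLp.toLp 2 (Sum.elim (fun α => y α) fun _ => 0)
      map_add' := fun _ _ => by ext k; cases k <;> simp
      map_smul' := fun _ _ => by ext k; cases k <;> simp }

variable {ι κ}

@[simp] lemma baseProj_apply (z : Coord (ι ⊕ κ)) (α : ι) : baseProj ι κ z α = z (Sum.inl α) := rfl

@[simp] lemma baseProj_baseIncl (y : Coord ι) : baseProj ι κ (baseIncl ι κ y) = y := rfl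

lemma differentiableAt_comp_baseProj_iff {U : Coord ι → ℝ} {z : Coord (ι ⊕ κ)} :
    DifferentiableAt ℝ (fun z => U (baseProj ι κ z)) z ↔ DifferentiableAt ℝ U (baseProj ι κ z) := by
  refine ⟨fun h => ?_, fun h => h.comp z (baseProj ι κ).differentiableAt⟩
  let slice : Coord ι → Coord (ι ⊕ κ) := fun y => z + baseIncl ι κ (y - baseProj ι κ z)
  have hslice : DifferentiableAt ℝ slice (baseProj ι κ z) :=
    ((baseIncl ι κ).differentiableAt.comp _ (differentiableAt_id.sub_const _)).const_add _
  have hz : slice (baseProj ι κ z) = z := by simp [slice]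
  have hU : (fun z => U (baseProj ι κ z)) ∘ slice = U := by
    funext y
    simp [slice]
  rw [← hz] at h
  exact hU ▸ h.comp (baseProj ι κ z) hslice

variable [DecidableEq ι] [DecidableEq κ]

lemma baseProj_single_inl (α : ι) :
    baseProj ι κ (EuclideanSpace.single (Sum.inl α) (1 : ℝ)) = EuclideanSpace.single α 1 := by
  ext β; simp

lemma baseProj_single_inr (I : κ) :
    baseProj ι κ (EuclideanSpace.single (Sum.inr I) (1 : ℝ)) = 0 := by
  ext β; simp

/-- The partial derivatives of a function of the base coordinates with respect to all coordinates,
hence `0` in the fiber directions. -/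
def pdBase (k : ι ⊕ κ) (U : Coord ι → ℝ) (y : Coord ι) : ℝ :=
  Sum.elim (fun α => pd α U y) (fun _ => 0) k

lemma pd_comp_baseProj (k : ι ⊕ κ) (U : Coord ι → ℝ) (z : Coord (ι ⊕ κ)) :
    pd k (fun z => U (baseProj ι κ z)) z = pdBase k U (baseProj ι κ z) := by
  have hfderiv : fderiv ℝ (fun z => U (baseProj ι κ z)) z =
      (fderiv ℝ U (baseProj ι κ z)).comp (baseProj ι κ) := by
    by_cases hU : DifferentiableAt ℝ U (baseProj ι κ z)
    · exact (hU.hasFDerivAt.comp z (baseProj ι κ).hasFDerivAt).fderiv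
    · rw [fderiv_zero_of_not_differentiableAt (mt differentiableAt_comp_baseProj_iff.1 hU),
        fderiv_zero_of_not_differentiableAt hU, ContinuousLinearMap.zero_comp]
  rw [pd, hfderiv, ContinuousLinearMap.comp_apply]
  cases k with
  | inl α => rw [baseProj_single_inl]; rfl
  | inr I => rw [baseProj_single_inr, map_zero]; rfl

/-- The Christoffel symbols of a metric whose coefficients depend on the base coordinates only. -/
def christoffelBase (H : Coord ι → Matrix (ι ⊕ κ) (ι ⊕ κ) ℝ) (k i j : ι ⊕ κ) (y : Coord ι) : ℝ :=
  (1 / 2) * ∑ l, (H y)⁻¹ k l *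
    (pdBase i (fun z => H z j l) y + pdBase j (fun z => H z i l) y - pdBase l (fun z => H z i j) y)

lemma christoffel_eventuallyEq_christoffelBase {h : Coord (ι ⊕ κ) → Matrix (ι ⊕ κ) (ι ⊕ κ) ℝ}
    {H : Coord ι → Matrix (ι ⊕ κ) (ι ⊕ κ) ℝ} {z₀ : Coord (ι ⊕ κ)}
    (hh : ∀ᶠ z in 𝓝 z₀, h z = H (baseProj ι κ z)) (k i j : ι ⊕ κ) :
    christoffel h k i j =ᶠ[𝓝 z₀] fun z => christoffelBase H k i j (baseProj ι κ z) := by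
  filter_upwards [hh.eventually_nhds] with z hz
  have hpd : ∀ l a b, pd l (fun z => h z a b) z = pdBase l (fun y => H y a b) (baseProj ι κ z) := by
    intro l a b
    rw [← pd_comp_baseProj]
    exact pd_congr (hz.mono fun w hw => by simp only [hw])
  simp only [christoffel, christoffelBase, hpd, hz.self_of_nhds]

lemma ricci_eq_of_eventuallyEq_comp_baseProj {h : Coord (ι ⊕ κ) → Matrix (ι ⊕ κ) (ι ⊕ κ) ℝ}
    {H : Coord ι → Matrix (ι ⊕ κ) (ι ⊕ κ) ℝ} {z₀ : Coord (ι ⊕ κ)}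
    (hh : ∀ᶠ z in 𝓝 z₀, h z = H (baseProj ι κ z)) (i j : ι ⊕ κ) :
    ricci h i j z₀ = (∑ k, pdBase k (christoffelBase H k i j) (baseProj ι κ z₀))
      - (∑ k, pdBase j (christoffelBase H k i k) (baseProj ι κ z₀))
      + (∑ k, ∑ l, christoffelBase H k k l (baseProj ι κ z₀) *
          christoffelBase H l i j (baseProj ι κ z₀))
      - ∑ k, ∑ l, christoffelBase H k j l (baseProj ι κ z₀) *
          christoffelBase H l i k (baseProj ι κ z₀) := by
  have hΓ := christoffel_eventuallyEq_christoffelBase hh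
  have hpdΓ : ∀ l k i j, pd l (christoffel h k i j) z₀ =
      pdBase l (christoffelBase H k i j) (baseProj ι κ z₀) :=
    fun l k i j => by rw [pd_congr (hΓ k i j), pd_comp_baseProj]
  simp only [ricci, (hΓ _ _ _).self_of_nhds, hpdΓ]

end BaseProjection

section LaplacianInDivergenceForm

variable {ι : Type} [Fintype ι] [DecidableEq ι] {g : Coord ι → Matrix ι ι ℝ} {y : Coord ι}

lemma isSymm_pdMat {a : Type*} {A : Coord ι → Matrix a a ℝ} (hA : ∀ᶠ z in 𝓝 y, (A z).IsSymm)
    (i : ι) : (pdMat i A y).IsSymm := by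
  rw [Matrix.IsSymm, ← pdMat_transpose]
  exact pdMat_congr (hA.mono fun z hz => hz.eq)

lemma christoffel_eq_sum_pdMat (k i j : ι) :
    christoffel g k i j y =
      1 / 2 * ∑ l, (g y)⁻¹ k l * (pdMat i g y j l + pdMat j g y i l - pdMat l g y i j) :=
  rfl

omit [DecidableEq ι] in
lemma trace_mul_of_isSymm (A : Matrix ι ι ℝ) {D : Matrix ι ι ℝ} (hD : D.IsSymm) :
    (A * D).trace = ∑ i, ∑ j, A i j * D i j := by
  rw [← hD.eq, ← Matrix.sum_hadamard_eq]
  simp only [Matrix.hadamard_apply, hD.eq]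

lemma sum_inv_mul_pdMat_comm (hsymm : ∀ᶠ z in 𝓝 y, (g z).IsSymm) (k : ι) :
    ∑ i, ∑ j, (g y)⁻¹ i j * pdMat j g y i k = ∑ i, ∑ j, (g y)⁻¹ i j * pdMat i g y j k := by
  rw [Finset.sum_comm]
  refine Finset.sum_congr rfl fun i _ => Finset.sum_congr rfl fun j _ => ?_
  rw [hsymm.self_of_nhds.inv.apply]

lemma sum_christoffel_self (hsymm : ∀ᶠ z in 𝓝 y, (g z).IsSymm) (j : ι) :
    ∑ i, christoffel g i i j y = 1 / 2 * ((g y)⁻¹ * pdMat j g y).trace := by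
  have hcomm : ∑ i, ∑ l, (g y)⁻¹ i l * pdMat i g y j l =
      ∑ i, ∑ l, (g y)⁻¹ i l * pdMat l g y i j := by
    rw [sum_inv_mul_pdMat_comm hsymm]
    simp only [(isSymm_pdMat hsymm _).apply j]
  simp only [christoffel_eq_sum_pdMat, ← Finset.mul_sum, mul_sub, mul_add, Finset.sum_add_distrib,
    Finset.sum_sub_distrib, hcomm, trace_mul_of_isSymm _ (isSymm_pdMat hsymm j)]
  ring

lemma sum_pdMat_inv (hg : SmoothMatAt g y) (hsymm : ∀ᶠ z in 𝓝 y, (g z).IsSymm)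
    (hdet : (g y).det ≠ 0) (k : ι) :
    ∑ i, pdMat i (fun z => (g z)⁻¹) y i k =
      -∑ l, (g y)⁻¹ k l * ∑ i, ∑ j, (g y)⁻¹ i j * pdMat i g y j l := by
  simp only [pdMat_inv hg hdet, Matrix.neg_apply, Finset.sum_neg_distrib, Matrix.mul_apply,
    Finset.mul_sum, Finset.sum_mul]
  rw [Finset.sum_comm]
  refine congrArg _ (Finset.sum_congr rfl fun l _ => Finset.sum_congr rfl fun i _ =>
    Finset.sum_congr rfl fun j _ => ?_)
  rw [hsymm.self_of_nhds.inv.apply k l]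
  ring

lemma sum_inv_mul_christoffel (hg : SmoothMatAt g y) (hsymm : ∀ᶠ z in 𝓝 y, (g z).IsSymm)
    (hdet : (g y).det ≠ 0) (k : ι) :
    ∑ i, ∑ j, (g y)⁻¹ i j * christoffel g k i j y =
      -(∑ i, pdMat i (fun z => (g z)⁻¹) y i k)
        - ∑ j, (∑ i, christoffel g i i j y) * (g y)⁻¹ j k := by
  have hcontract : ∀ l, ∑ i, ∑ j, (g y)⁻¹ i j *
      (pdMat i g y j l + pdMat j g y i l - pdMat l g y i j) =
        2 * ∑ i, ∑ j, (g y)⁻¹ i j * pdMat i g y j l - ((g y)⁻¹ * pdMat l g y).trace := fun l => by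
    simp only [mul_sub, mul_add, Finset.sum_add_distrib, Finset.sum_sub_distrib,
      sum_inv_mul_pdMat_comm hsymm, trace_mul_of_isSymm _ (isSymm_pdMat hsymm l)]
    ring
  calc ∑ i, ∑ j, (g y)⁻¹ i j * christoffel g k i j y
      = ∑ l, 1 / 2 * (g y)⁻¹ k l * ∑ i, ∑ j, (g y)⁻¹ i j *
          (pdMat i g y j l + pdMat j g y i l - pdMat l g y i j) := by
        simp only [christoffel_eq_sum_pdMat, Finset.mul_sum]
        rw [Finset.sum_comm_cycle]
        refine Finset.sum_congr rfl fun l _ => Finset.sum_congr rfl fun i _ =>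
          Finset.sum_congr rfl fun j _ => ?_
        ring
    _ = _ := by
        rw [sum_pdMat_inv hg hsymm hdet, neg_neg, ← Finset.sum_sub_distrib]
        refine Finset.sum_congr rfl fun l _ => ?_
        rw [hcontract, sum_christoffel_self hsymm, hsymm.self_of_nhds.inv.apply k l]
        ring

lemma coordLaplacian_eq_divergence (hg : SmoothMatAt g y) (hsymm : ∀ᶠ z in 𝓝 y, (g z).IsSymm)
    (hdet : (g y).det ≠ 0) {u : Coord ι → ℝ} (hu : ContDiffAt ℝ ∞ u y) :
    coordLaplacian g u y = (∑ i, pd i (fun z => ∑ j, (g z)⁻¹ i j * pd j u z) y)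
      + ∑ j, (∑ i, christoffel g i i j y) * ∑ k, (g y)⁻¹ j k * pd k u y := by
  have hinv := fun i j => (hg.inv hdet).differentiableAt i j
  have hpd : ∀ j, DifferentiableAt ℝ (pd j u) y := fun j =>
    (contDiffAt_pd hu).differentiableAt (by simp)
  have hdiv : ∑ i, pd i (fun z => ∑ j, (g z)⁻¹ i j * pd j u z) y =
      (∑ i, ∑ j, (g y)⁻¹ i j * pd i (pd j u) y)
        + ∑ k, (∑ i, pdMat i (fun z => (g z)⁻¹) y i k) * pd k u y := by
    simp only [Finset.sum_mul]
    rw [Finset.sum_comm (γ := ι) (f := fun k i => pdMat i (fun z => (g z)⁻¹) y i k * pd k u y),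
      ← Finset.sum_add_distrib]
    refine Finset.sum_congr rfl fun i _ => ?_
    rw [pd_sum fun j _ => (hinv i j).fun_mul (hpd j), ← Finset.sum_add_distrib]
    refine Finset.sum_congr rfl fun j _ => ?_
    rw [pd_mul (hinv i j) (hpd j), add_comm]
    rfl
  have hΓ : ∑ i, ∑ j, (g y)⁻¹ i j * ∑ k, christoffel g k i j y * pd k u y =
      ∑ k, (∑ i, ∑ j, (g y)⁻¹ i j * christoffel g k i j y) * pd k u y := by
    simp only [Finset.mul_sum, Finset.sum_mul, mul_assoc]
    rw [Finset.sum_comm_cycle]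
  have htr : ∑ j, (∑ i, christoffel g i i j y) * ∑ k, (g y)⁻¹ j k * pd k u y =
      ∑ k, (∑ j, (∑ i, christoffel g i i j y) * (g y)⁻¹ j k) * pd k u y := by
    simp only [Finset.mul_sum, Finset.sum_mul, mul_assoc]
    rw [Finset.sum_comm]
  simp only [coordLaplacian, hess, mul_sub, Finset.sum_sub_distrib]
  rw [hΓ, hdiv, htr]
  simp only [sum_inv_mul_christoffel hg hsymm hdet, sub_mul, neg_mul, Finset.sum_sub_distrib,
    Finset.sum_neg_distrib]
  ring

end LaplacianInDivergenceForm

section QuadraticTerms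

lemma mul_sum_mul_mul_sum {α β : Type*} [Fintype α] [Fintype β] (a b : ℝ) (u : α → ℝ)
    (v : β → ℝ) : (a * ∑ i, u i) * (b * ∑ j, v j) = a * b * ∑ i, ∑ j, u i * v j := by
  rw [mul_mul_mul_comm, Finset.sum_mul_sum]

variable {ι κ : Type*} [Fintype ι] [Fintype κ]

lemma sum_mul_sum_of_antisymm {s : Matrix ι ι ℝ} (hs : s.IsSymm) {Φ : ι → ι → ℝ}
    (hΦ : ∀ α β, Φ α β = -Φ β α) (Ψ : ι → ι → ℝ) :
    ∑ γ, ∑ δ, (1 / 2 * ∑ ε, s γ ε * Φ δ ε) * (1 / 2 * ∑ ζ, s δ ζ * Ψ γ ζ) =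
      -(1 / 4) * ∑ α, ∑ β, ∑ γ, ∑ δ, s α γ * s β δ * (Ψ α β * Φ γ δ) := by
  simp only [mul_sum_mul_mul_sum]
  simp only [Finset.mul_sum]
  refine Finset.sum_congr rfl fun γ _ => ?_
  rw [Finset.sum_comm_cycle]
  refine Finset.sum_congr rfl fun ζ _ => ?_
  rw [Finset.sum_comm]
  refine Finset.sum_congr rfl fun ε _ => Finset.sum_congr rfl fun δ _ => ?_
  rw [hΦ δ, hs.apply δ ζ]
  ring

variable {s : Matrix ι ι ℝ} {S : Matrix κ κ ℝ} {D : ι → Matrix κ κ ℝ}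

lemma sum_mul_sum_mul_of_isSymm (hS : S.IsSymm) (hD : ∀ α, (D α).IsSymm) (I J : κ) :
    ∑ γ, ∑ L, (-(1 / 2) * ∑ ε, s γ ε * D ε J L) * (1 / 2 * ∑ M, S L M * D γ I M) =
      -(1 / 4) * ∑ α, ∑ β, s α β * (D α * S * D β) I J := by
  simp only [mul_sum_mul_mul_sum]
  simp only [Matrix.mul_apply, Finset.mul_sum, Finset.sum_mul]
  refine Finset.sum_congr rfl fun γ _ => ?_
  rw [Finset.sum_comm]
  refine Finset.sum_congr rfl fun ε _ => Finset.sum_congr rfl fun L _ =>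
    Finset.sum_congr rfl fun M _ => ?_
  rw [(hD ε).apply, hS.apply]
  ring

lemma sum_mul_sum_mul_of_isSymm' (hs : s.IsSymm) (hS : S.IsSymm) (hD : ∀ α, (D α).IsSymm)
    (I J : κ) :
    ∑ K, ∑ δ, (1 / 2 * ∑ L, S K L * D δ J L) * (-(1 / 2) * ∑ ε, s δ ε * D ε I K) =
      -(1 / 4) * ∑ α, ∑ β, s α β * (D α * S * D β) I J := by
  have hswap (α β : ι) : (D α * S * D β) J I = (D β * S * D α) I J := by
    rw [← Matrix.transpose_apply (D α * S * D β), Matrix.transpose_mul, Matrix.transpose_mul,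
      (hD α).eq, hS.eq, (hD β).eq, Matrix.mul_assoc]
  simp only [mul_comm (1 / 2 * ∑ L, S _ L * D _ J L)]
  rw [Finset.sum_comm, sum_mul_sum_mul_of_isSymm hS hD J I, Finset.sum_comm]
  simp only [hswap, hs.apply]

end QuadraticTerms

section BlockMetric

variable {ι : Type} [Fintype ι] [DecidableEq ι]
variable {κ : Type} [Fintype κ] [DecidableEq κ]

/-- The matrix of the metric `G_{IJ} (dx^I + A^I) (dx^J + A^J) + g_{αβ} db^α db^β`. -/
def blockMetric (g : Matrix ι ι ℝ) (G : Matrix κ κ ℝ) (A : Matrix κ ι ℝ) :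
    Matrix (ι ⊕ κ) (ι ⊕ κ) ℝ :=
  Matrix.fromBlocks (g + A.transpose * G * A) (A.transpose * G) (G * A) G

lemma inv_blockMetric {g : Matrix ι ι ℝ} {G : Matrix κ κ ℝ} (A : Matrix κ ι ℝ)
    (hg : g.det ≠ 0) (hG : G.det ≠ 0) :
    (blockMetric g G A)⁻¹ = Matrix.fromBlocks g⁻¹ (-(g⁻¹ * A.transpose)) (-(A * g⁻¹))
      (G⁻¹ + A * g⁻¹ * A.transpose) := by
  have hg' := isUnit_iff_ne_zero.2 hg
  have hG' := isUnit_iff_ne_zero.2 hG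
  refine Matrix.inv_eq_right_inv ?_
  rw [blockMetric, Matrix.fromBlocks_multiply, ← Matrix.fromBlocks_one]
  congr 1
  · rw [Matrix.add_mul, Matrix.mul_nonsing_inv _ hg']
    simp only [Matrix.mul_neg, Matrix.mul_assoc]
    abel
  · rw [Matrix.mul_add, Matrix.mul_neg, Matrix.add_mul, ← Matrix.mul_assoc g,
      Matrix.mul_nonsing_inv _ hg', Matrix.mul_assoc _ G G⁻¹, Matrix.mul_nonsing_inv _ hG']
    simp only [Matrix.mul_assoc, Matrix.mul_one, Matrix.one_mul]
    abel
  · simp [Matrix.mul_assoc]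
  · rw [Matrix.mul_add, Matrix.mul_nonsing_inv _ hG']
    simp only [Matrix.mul_neg, Matrix.mul_assoc]
    abel

omit [Fintype ι] [DecidableEq ι] [DecidableEq κ] in
lemma isSymm_blockMetric {g : Matrix ι ι ℝ} {G : Matrix κ κ ℝ} (A : Matrix κ ι ℝ)
    (hg : g.IsSymm) (hG : G.IsSymm) : (blockMetric g G A).IsSymm := by
  refine Matrix.IsSymm.fromBlocks (hg.add ?_) ?_ hG
  · rw [Matrix.IsSymm, Matrix.transpose_mul, Matrix.transpose_mul, Matrix.transpose_transpose,
      hG.eq, Matrix.mul_assoc]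
  · rw [Matrix.transpose_mul, Matrix.transpose_transpose, hG.eq]

/-- The curvature `F_{αβ} = ∂_α A_β - ∂_β A_α` of the connection `dx + A`. -/
def curvature (A : Coord ι → Matrix κ ι ℝ) (α β : ι) (y : Coord ι) : κ → ℝ :=
  fun K => pdMat α A y K β - pdMat β A y K α

omit [Fintype κ] [DecidableEq κ] in
lemma curvature_swap (A : Coord ι → Matrix κ ι ℝ) (α β : ι) (y : Coord ι) :
    curvature A α β y = -curvature A β α y := by
  funext K
  simp [curvature]

variable {g : Coord ι → Matrix ι ι ℝ} {G : Coord ι → Matrix κ κ ℝ} {A : Coord ι → Matrix κ ι ℝ}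
  {y : Coord ι}

/-- The metric `G (dx + A) (dx + A) + g db db` is smooth and nondegenerate at `y`, and its
horizontal space there is spanned by the coordinate vectors of the base. -/
structure IsAdaptedAt (g : Coord ι → Matrix ι ι ℝ) (G : Coord ι → Matrix κ κ ℝ)
    (A : Coord ι → Matrix κ ι ℝ) (y : Coord ι) : Prop where
  smooth_base : SmoothMatAt g y
  smooth_fiber : SmoothMatAt G y
  smooth_conn : SmoothMatAt A y
  symm_base : ∀ᶠ z in 𝓝 y, (g z).IsSymm
  symm_fiber : ∀ᶠ z in 𝓝 y, (G z).IsSymm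
  det_base_ne_zero : (g y).det ≠ 0
  det_fiber_ne_zero : (G y).det ≠ 0
  conn_eq_zero : A y = 0

namespace IsAdaptedAt

lemma inv_blockMetric (h : IsAdaptedAt g G A y) :
    (blockMetric (g y) (G y) (A y))⁻¹ = Matrix.fromBlocks (g y)⁻¹ 0 0 (G y)⁻¹ := by
  rw [TwistedBundle.inv_blockMetric _ h.det_base_ne_zero h.det_fiber_ne_zero, h.conn_eq_zero]
  simp

lemma pdMat_blockMetric (h : IsAdaptedAt g G A y) (γ : ι) :
    pdMat γ (fun z => blockMetric (g z) (G z) (A z)) y =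
      Matrix.fromBlocks (pdMat γ g y) (G y * pdMat γ A y).transpose (G y * pdMat γ A y)
        (pdMat γ G y) := by
  have hGA := h.smooth_fiber.mul h.smooth_conn
  have hmixed : pdMat γ (fun z => G z * A z) y = G y * pdMat γ A y := by
    rw [pdMat_mul h.smooth_fiber h.smooth_conn, h.conn_eq_zero, Matrix.mul_zero, zero_add]
  have hquad : pdMat γ (fun z => (A z).transpose * (G z * A z)) y = 0 := by
    rw [pdMat_mul h.smooth_conn.transpose hGA, h.conn_eq_zero, Matrix.mul_zero, Matrix.mul_zero,
      Matrix.transpose_zero, Matrix.zero_mul, add_zero]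
  have hsymm : ∀ᶠ z in 𝓝 y, (blockMetric (g z) (G z) (A z)).IsSymm := by
    filter_upwards [h.symm_base, h.symm_fiber] with z hg hG using isSymm_blockMetric _ hg hG
  ext i j
  rcases i with α | I <;> rcases j with β | J
  · have hentry : pdMat γ (fun z => blockMetric (g z) (G z) (A z)) y (Sum.inl α) (Sum.inl β) =
        pdMat γ (fun z => g z + (A z).transpose * (G z * A z)) y α β := by
      simp only [← Matrix.mul_assoc]
      rfl
    rw [hentry, pdMat_add h.smooth_base (h.smooth_conn.transpose.mul hGA), hquad, add_zero]
    rfl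
  · rw [(isSymm_pdMat hsymm γ).apply, Matrix.fromBlocks_apply₁₂, Matrix.transpose_apply, ← hmixed]
    rfl
  · rw [Matrix.fromBlocks_apply₂₁, ← hmixed]
    rfl
  · rfl

lemma pd_blockMetric (h : IsAdaptedAt g G A y) (γ : ι) (i j : ι ⊕ κ) :
    pd γ (fun z => blockMetric (g z) (G z) (A z) i j) y =
      Matrix.fromBlocks (pdMat γ g y) (G y * pdMat γ A y).transpose (G y * pdMat γ A y)
        (pdMat γ G y) i j :=
  congrFun (congrFun (h.pdMat_blockMetric γ) i) j

lemma christoffelBase_inl_inr_inr_eventuallyEq (h : IsAdaptedAt g G A y) (γ : ι) (I J : κ) :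
    christoffelBase (fun z => blockMetric (g z) (G z) (A z)) (.inl γ) (.inr I) (.inr J) =ᶠ[𝓝 y]
      fun z => -(1 / 2) * ∑ δ, (g z)⁻¹ γ δ * pdMat δ G z I J := by
  filter_upwards [h.smooth_base.eventually_det_ne_zero h.det_base_ne_zero,
    h.smooth_fiber.eventually_det_ne_zero h.det_fiber_ne_zero] with z hg hG
  simp only [christoffelBase, Fintype.sum_sum_type, TwistedBundle.inv_blockMetric _ hg hG,
    Matrix.fromBlocks_apply₁₁, pdBase, Sum.elim_inl, Sum.elim_inr, add_zero, zero_sub, mul_zero,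
    Finset.sum_const_zero, mul_neg, Finset.sum_neg_distrib, neg_mul]
  rfl

lemma christoffelBase_inl_inr_inl (h : IsAdaptedAt g G A y) (γ δ : ι) (I : κ) :
    christoffelBase (fun z => blockMetric (g z) (G z) (A z)) (.inl γ) (.inr I) (.inl δ) y =
      1 / 2 * ∑ ε, (g y)⁻¹ γ ε * (G y).mulVec (curvature A δ ε y) I := by
  simp only [christoffelBase, Fintype.sum_sum_type, h.inv_blockMetric, Matrix.fromBlocks_apply₁₁,
    Matrix.fromBlocks_apply₁₂, Matrix.fromBlocks_apply₂₁, pdBase, Sum.elim_inl, Sum.elim_inr,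
    zero_add, Matrix.zero_apply, zero_mul, Finset.sum_const_zero, add_zero, h.pd_blockMetric,
    Matrix.mul_apply, Matrix.mulVec, dotProduct, curvature, mul_sub, Finset.sum_sub_distrib]

lemma christoffelBase_inr_inr_inl (h : IsAdaptedAt g G A y) (δ : ι) (I J : κ) :
    christoffelBase (fun z => blockMetric (g z) (G z) (A z)) (.inr I) (.inr J) (.inl δ) y =
      1 / 2 * ∑ K, (G y)⁻¹ I K * pdMat δ G y J K := by
  simp only [christoffelBase, Fintype.sum_sum_type, h.inv_blockMetric, Matrix.fromBlocks_apply₂₁,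
    Matrix.fromBlocks_apply₂₂, pdBase, Sum.elim_inl, Sum.elim_inr, zero_add, Matrix.zero_apply,
    zero_mul, Finset.sum_const_zero, sub_zero, h.pd_blockMetric]

lemma christoffelBase_inr_inr_inr (h : IsAdaptedAt g G A y) (I J K : κ) :
    christoffelBase (fun z => blockMetric (g z) (G z) (A z)) (.inr I) (.inr J) (.inr K) y = 0 := by
  simp [christoffelBase, Fintype.sum_sum_type, h.inv_blockMetric, pdBase]

lemma christoffelBase_inl_inl_inl (h : IsAdaptedAt g G A y) (γ α β : ι) :
    christoffelBase (fun z => blockMetric (g z) (G z) (A z)) (.inl γ) (.inl α) (.inl β) y =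
      christoffel g γ α β y := by
  simp only [christoffelBase, Fintype.sum_sum_type, h.inv_blockMetric, Matrix.fromBlocks_apply₁₁,
    Matrix.fromBlocks_apply₁₂, pdBase, Sum.elim_inl, Matrix.zero_apply, zero_mul,
    Finset.sum_const_zero, add_zero, h.pd_blockMetric, christoffel_eq_sum_pdMat]

lemma sum_pdBase_christoffelBase (h : IsAdaptedAt g G A y) (I J : κ) :
    ∑ k, pdBase k (christoffelBase (fun z => blockMetric (g z) (G z) (A z)) k (.inr I) (.inr J)) y =
      -(1 / 2) * ∑ γ, pd γ (fun z => ∑ δ, (g z)⁻¹ γ δ * pd δ (fun z => G z I J) z) y := by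
  simp only [Fintype.sum_sum_type, pdBase, Sum.elim_inl, Sum.elim_inr, Finset.sum_const_zero,
    add_zero, pd_congr (h.christoffelBase_inl_inr_inr_eventuallyEq _ I J), pd_const_mul,
    ← Finset.mul_sum]
  rfl

lemma sum_christoffelBase_self_mul (h : IsAdaptedAt g G A y) (I J : κ) :
    ∑ k, ∑ l, christoffelBase (fun z => blockMetric (g z) (G z) (A z)) k k l y *
        christoffelBase (fun z => blockMetric (g z) (G z) (A z)) l (.inr I) (.inr J) y =
      -(1 / 2) * (∑ δ, (∑ γ, christoffel g γ γ δ y) * ∑ ε, (g y)⁻¹ δ ε * pdMat ε G y I J)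
        - 1 / 4 * ∑ α, ∑ β, (g y)⁻¹ α β * ((G y)⁻¹ * pdMat α G y).trace * pdMat β G y I J := by
  have htrace : ∀ δ, ∑ K, 1 / 2 * ∑ L, (G y)⁻¹ K L * pdMat δ G y K L =
      1 / 2 * ((G y)⁻¹ * pdMat δ G y).trace := fun δ => by
    rw [trace_mul_of_isSymm _ (isSymm_pdMat h.symm_fiber δ), Finset.mul_sum]
  rw [Finset.sum_comm]
  simp only [Fintype.sum_sum_type, h.christoffelBase_inr_inr_inr, h.christoffelBase_inl_inl_inl,
    h.christoffelBase_inr_inr_inl, (h.christoffelBase_inl_inr_inr_eventuallyEq _ I J).self_of_nhds,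
    mul_zero, Finset.sum_const_zero, add_zero, ← Finset.sum_mul, htrace]
  simp only [Finset.mul_sum (a := -(1 / 2 : ℝ)), Finset.mul_sum (a := (1 / 4 : ℝ)),
    ← Finset.sum_sub_distrib]
  refine Finset.sum_congr rfl fun δ _ => ?_
  simp only [Finset.mul_sum, ← Finset.sum_sub_distrib]
  exact Finset.sum_congr rfl fun ε _ => by ring

lemma sum_christoffelBase_mul_christoffelBase (h : IsAdaptedAt g G A y) (I J : κ) :
    ∑ k, ∑ l, christoffelBase (fun z => blockMetric (g z) (G z) (A z)) k (.inr J) l y *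
        christoffelBase (fun z => blockMetric (g z) (G z) (A z)) l (.inr I) k y =
      -(1 / 4) * (∑ α, ∑ β, ∑ γ, ∑ δ, (g y)⁻¹ α γ * (g y)⁻¹ β δ *
          ((G y).mulVec (curvature A α β y) I * (G y).mulVec (curvature A γ δ y) J))
        - 1 / 2 * ∑ α, ∑ β, (g y)⁻¹ α β * (pdMat α G y * (G y)⁻¹ * pdMat β G y) I J := by
  have hg := h.symm_base.self_of_nhds.inv
  have hG := h.symm_fiber.self_of_nhds.inv
  have hD := fun α => isSymm_pdMat h.symm_fiber α
  have hcurv := sum_mul_sum_of_antisymm hg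
    (Φ := fun γ δ => (G y).mulVec (curvature A γ δ y) J)
    (fun α β => by rw [curvature_swap, Matrix.mulVec_neg, Pi.neg_apply])
    (fun α β => (G y).mulVec (curvature A α β y) I)
  have hdG := sum_mul_sum_mul_of_isSymm (s := (g y)⁻¹) hG hD I J
  have hdG' := sum_mul_sum_mul_of_isSymm' hg hG hD I J
  simp only [Fintype.sum_sum_type, Finset.sum_add_distrib, h.christoffelBase_inr_inr_inr,
    h.christoffelBase_inl_inr_inl, h.christoffelBase_inr_inr_inl,
    (h.christoffelBase_inl_inr_inr_eventuallyEq _ _ _).self_of_nhds, mul_zero,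
    Finset.sum_const_zero, add_zero]
  linear_combination hcurv + hdG + hdG'

end IsAdaptedAt

variable (g G) in
/-- The Ricci tensor of the metric `G (dx + A) (dx + A) + g db db` on the fiber directions, in terms
of the curvature `F` of `A`. -/
def fiberRicci (F : ι → ι → κ → ℝ) (y : Coord ι) : Matrix κ κ ℝ :=
  -((1 / 2 : ℝ) • ∑ α, ∑ β, (g y)⁻¹ α β • hessMat g G α β y)
    - (1 / 4 : ℝ) • (∑ α, ∑ β, ((g y)⁻¹ α β * ((G y)⁻¹ * pdMat α G y).trace) • pdMat β G y)
    + (1 / 2 : ℝ) • (∑ α, ∑ β, (g y)⁻¹ α β • (pdMat α G y * (G y)⁻¹ * pdMat β G y))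
    + (1 / 4 : ℝ) • ∑ α, ∑ β, ∑ γ, ∑ δ, ((g y)⁻¹ α γ * (g y)⁻¹ β δ) •
        Matrix.vecMulVec ((G y).mulVec (F α β)) ((G y).mulVec (F γ δ))

theorem IsAdaptedAt.ricci_inr_inr (h : IsAdaptedAt g G A y)
    {metric : Coord (ι ⊕ κ) → Matrix (ι ⊕ κ) (ι ⊕ κ) ℝ} {z₀ : Coord (ι ⊕ κ)}
    (hy : baseProj ι κ z₀ = y)
    (hmetric : ∀ᶠ z in 𝓝 z₀, metric z =
      blockMetric (g (baseProj ι κ z)) (G (baseProj ι κ z)) (A (baseProj ι κ z))) (I J : κ) :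
    ricci metric (.inr I) (.inr J) z₀ = fiberRicci g G (fun α β => curvature A α β y) y I J := by
  subst hy
  have hlap : ∑ α, ∑ β, (g (baseProj ι κ z₀))⁻¹ α β * hessMat g G α β (baseProj ι κ z₀) I J =
      coordLaplacian g (fun z => G z I J) (baseProj ι κ z₀) := by
    simp only [coordLaplacian, hessMat_apply]
  have hvert : ∑ k, pdBase (Sum.inr J) (christoffelBase (fun z => blockMetric (g z) (G z) (A z)) k
      (Sum.inr I) k) (baseProj ι κ z₀) = 0 := by
    simp [pdBase]
  rw [ricci_eq_of_eventuallyEq_comp_baseProj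
    (H := fun z => blockMetric (g z) (G z) (A z)) hmetric, hvert,
    h.sum_pdBase_christoffelBase, h.sum_christoffelBase_self_mul,
    h.sum_christoffelBase_mul_christoffelBase]
  simp only [fiberRicci, Matrix.sub_apply, Matrix.add_apply, Matrix.neg_apply, Matrix.smul_apply,
    Matrix.sum_apply, smul_eq_mul, Matrix.vecMulVec_apply]
  rw [hlap, coordLaplacian_eq_divergence h.smooth_base h.symm_base h.det_base_ne_zero
    (h.smooth_fiber I J)]
  simp only [pdMat, Matrix.of_apply]
  ring

end BlockMetric

section FiberRicci

variable {ι : Type} [Fintype ι] [DecidableEq ι]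
variable {κ : Type} [Fintype κ]

/-- The squared norm `g^{αγ} g^{βδ} G_{IJ} F^I_{αβ} F^J_{γδ}` of a `2`-form `F` on the base with
values in the fiber directions. -/
def formNormSq (g : Matrix ι ι ℝ) (G : Matrix κ κ ℝ) (F : ι → ι → κ → ℝ) : ℝ :=
  ∑ α, ∑ β, ∑ γ, ∑ δ, (g⁻¹ α γ * g⁻¹ β δ) * (F α β ⬝ᵥ G.mulVec (F γ δ))

section Norm

variable {g : Matrix ι ι ℝ} {G : Matrix κ κ ℝ}

lemma formNormSq_eq_dotProduct (F : ι → ι → κ → ℝ) :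
    formNormSq g G F = (fun p : ι × ι × κ => F p.1 p.2.1 p.2.2) ⬝ᵥ
      (Matrix.kroneckerMap (· * ·) g⁻¹ (Matrix.kroneckerMap (· * ·) g⁻¹ G)).mulVec
        fun p => F p.1 p.2.1 p.2.2 := by
  simp only [formNormSq, dotProduct, Matrix.mulVec, Fintype.sum_prod_type, Finset.mul_sum,
    Matrix.kroneckerMap_apply]
  refine Finset.sum_congr rfl fun α _ => Finset.sum_congr rfl fun β _ => ?_
  rw [Finset.sum_comm_cycle]
  refine Finset.sum_congr rfl fun I _ => Finset.sum_congr rfl fun γ _ =>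
    Finset.sum_congr rfl fun δ _ => Finset.sum_congr rfl fun J _ => ?_
  ring

variable (hg : g.PosDef) (hG : G.PosDef)
include hg hG

lemma formNormSq_nonneg (F : ι → ι → κ → ℝ) : 0 ≤ formNormSq g G F := by
  rw [formNormSq_eq_dotProduct]
  exact (hg.inv.kronecker (hg.inv.kronecker hG)).posSemidef.dotProduct_mulVec_nonneg _

lemma eq_zero_of_formNormSq_eq_zero {F : ι → ι → κ → ℝ} (hF : formNormSq g G F = 0) :
    F = 0 := by
  rw [formNormSq_eq_dotProduct] at hF
  by_contra hne
  refine ((hg.inv.kronecker (hg.inv.kronecker hG)).dotProduct_mulVec_pos fun h0 => hne ?_).ne' hF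
  funext α β I
  exact congrFun h0 (α, β, I)

end Norm

variable [DecidableEq κ] (g : Coord ι → Matrix ι ι ℝ) {G : Coord ι → Matrix κ κ ℝ} {y : Coord ι}

lemma trace_inv_mul_fiberRicci (F : ι → ι → κ → ℝ) (hG : (G y).det ≠ 0) :
    ((G y)⁻¹ * fiberRicci g G F y).trace =
      -(1 / 2) * (∑ α, ∑ β, (g y)⁻¹ α β * ((G y)⁻¹ * hessMat g G α β y).trace)
        - 1 / 4 * (∑ α, ∑ β, (g y)⁻¹ α β *
            (((G y)⁻¹ * pdMat α G y).trace * ((G y)⁻¹ * pdMat β G y).trace))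
        + 1 / 2 * (∑ α, ∑ β, (g y)⁻¹ α β *
            ((G y)⁻¹ * (pdMat α G y * (G y)⁻¹ * pdMat β G y)).trace)
        + 1 / 4 * formNormSq (g y) (G y) F := by
  have hcurv (a b : κ → ℝ) :
      ((G y)⁻¹ * Matrix.vecMulVec ((G y).mulVec a) ((G y).mulVec b)).trace =
        a ⬝ᵥ (G y).mulVec b := by
    rw [Matrix.mul_vecMulVec, Matrix.trace_vecMulVec, Matrix.mulVec_mulVec,
      Matrix.nonsing_inv_mul _ (isUnit_iff_ne_zero.2 hG), Matrix.one_mulVec]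
  simp only [fiberRicci, Matrix.mul_add, Matrix.mul_sub, Matrix.mul_neg, Matrix.mul_smul,
    Matrix.mul_sum, Matrix.trace_add, Matrix.trace_sub, Matrix.trace_neg, Matrix.trace_smul,
    Matrix.trace_sum, hcurv, smul_eq_mul, formNormSq, mul_assoc]
  ring

lemma coordLaplacian_sqrt_det_of_fiberRicci_eq_smul {F : ι → ι → κ → ℝ} {lam : ℝ}
    (hG : ∀ᶠ z in 𝓝 y, SmoothMatAt G z) (hdet : 0 < (G y).det)
    (hRic : fiberRicci g G F y = lam • G y) :
    coordLaplacian g (fun z => √(G z).det) y =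
      (1 / 4 * formNormSq (g y) (G y) F - lam * Fintype.card κ) * √(G y).det := by
  have htrace := trace_inv_mul_fiberRicci g F hdet.ne'
  rw [hRic, Matrix.mul_smul, Matrix.nonsing_inv_mul _ (isUnit_iff_ne_zero.2 hdet.ne'),
    Matrix.trace_smul, Matrix.trace_one, smul_eq_mul] at htrace
  rw [coordLaplacian_sqrt_det g hG hdet]
  linear_combination √(G y).det * htrace

lemma sum_hessMat_eq_of_fiberRicci_eq_zero (hRic : fiberRicci g G 0 y = 0)
    (htrace : ∀ α, ((G y)⁻¹ * pdMat α G y).trace = 0) :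
    ∑ α, ∑ β, (g y)⁻¹ α β • hessMat g G α β y =
      ∑ α, ∑ β, (g y)⁻¹ α β • (pdMat α G y * (G y)⁻¹ * pdMat β G y) := by
  simp only [fiberRicci, htrace, mul_zero, zero_smul, Finset.sum_const_zero, smul_zero, sub_zero,
    Pi.zero_apply, Matrix.mulVec_zero, Matrix.vecMulVec_zero, add_zero, neg_add_eq_zero] at hRic
  exact smul_right_injective _ (by norm_num) hRic

lemma harmonic_of_fiberRicci_eq_zero (hRic : fiberRicci g G 0 y = 0)
    (htrace : ∀ α, ((G y)⁻¹ * pdMat α G y).trace = 0) (I J : κ) :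
    (∑ α, ∑ β, (g y)⁻¹ α β * hess g (fun z => G z I J) α β y)
      - (∑ α, ∑ β, ∑ K, ∑ L, (g y)⁻¹ α β * (G y)⁻¹ K L *
        pd α (fun z => G z I K) y * pd β (fun z => G z L J) y) = 0 := by
  have hmat := congrFun (congrFun (sum_hessMat_eq_of_fiberRicci_eq_zero g hRic htrace) I) J
  simp only [Matrix.sum_apply, Matrix.smul_apply, smul_eq_mul, hessMat_apply] at hmat
  rw [hmat, sub_eq_zero]
  refine Finset.sum_congr rfl fun α _ => Finset.sum_congr rfl fun β _ => ?_
  rw [Finset.sum_comm]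
  simp only [Matrix.mul_apply, Finset.mul_sum, Finset.sum_mul, pdMat, Matrix.of_apply, mul_assoc]
  exact Finset.sum_congr rfl fun L _ => Finset.sum_congr rfl fun K _ => by ring

end FiberRicci

section MixedSecondDerivative

variable {E F : Type*} [NormedAddCommGroup E] [NormedSpace ℝ E]
  [NormedAddCommGroup F] [NormedSpace ℝ F]

lemma hasFDerivAt_fderiv_snd {f : E × E → F} {x y : E} (hf : ContDiffAt ℝ 2 f (x, y)) :
    HasFDerivAt (fun w => fderiv ℝ (fun w' => f (w, w')) y)
      (((ContinuousLinearMap.compL ℝ E (E × E) F).flip (.inr ℝ E E)).comp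
        ((fderiv ℝ (fderiv ℝ f) (x, y)).comp (.inl ℝ E E))) x := by
  have hdiff : ∀ᶠ p in 𝓝 (x, y), DifferentiableAt ℝ f p :=
    ((hf.of_le one_le_two).eventually (by simp)).mono fun p hp => hp.differentiableAt (by simp)
  have hsnd : (fun w => fderiv ℝ (fun w' => f (w, w')) y) =ᶠ[𝓝 x]
      fun w => (fderiv ℝ f (w, y)).comp (.inr ℝ E E) := by
    filter_upwards [(Continuous.prodMk_left y).continuousAt.eventually hdiff] with w hw
    exact (hw.hasFDerivAt.comp y (hasFDerivAt_prodMk_right w y)).fderiv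
  have hdf : HasFDerivAt (fderiv ℝ f) (fderiv ℝ (fderiv ℝ f) (x, y)) (x, y) :=
    ((hf.fderiv_right (m := 1) le_rfl).differentiableAt (by simp)).hasFDerivAt
  have hfst : HasFDerivAt (fun w => fderiv ℝ f (w, y))
      ((fderiv ℝ (fderiv ℝ f) (x, y)).comp (.inl ℝ E E)) x :=
    hdf.comp x (hasFDerivAt_prodMk_left x y)
  exact (((ContinuousLinearMap.compL ℝ E (E × E) F).flip
    (.inr ℝ E E)).hasFDerivAt.comp x hfst).congr_of_eventuallyEq hsnd

lemma fderiv_fderiv_swap {f : E × E → F} {x : E} (hf : ContDiffAt ℝ 2 f (x, x))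
    (hsymm : f ∘ Prod.swap =ᶠ[𝓝 (x, x)] f) (p q : E × E) :
    fderiv ℝ (fderiv ℝ f) (x, x) p q = fderiv ℝ (fderiv ℝ f) (x, x) p.swap q.swap := by
  set S : (E × E) ≃L[ℝ] E × E := ContinuousLinearEquiv.prodComm ℝ E E
  have hdf : DifferentiableAt ℝ (fderiv ℝ f) (x, x) :=
    (hf.fderiv_right (m := 1) le_rfl).differentiableAt (by simp)
  have hswap : fderiv ℝ f =ᶠ[𝓝 (x, x)]
      fun p => (fderiv ℝ f (S p)).comp (S : E × E →L[ℝ] E × E) := by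
    filter_upwards [hsymm.eventually_nhds] with p hp
    rw [← Filter.EventuallyEq.fderiv_eq hp]
    exact S.comp_right_fderiv
  have hcomp := (((ContinuousLinearMap.compL ℝ (E × E) (E × E) F).flip
    (S : E × E →L[ℝ] E × E)).hasFDerivAt.comp (x, x)
      (HasFDerivAt.comp (x, x) (f := S) hdf.hasFDerivAt S.hasFDerivAt)).fderiv
  exact congrArg (fun L => L p q) (hswap.fderiv_eq.trans hcomp)

lemma fderiv_fderiv_comm_of_symm {K : E → E → F} {x : E}
    (hK : ContDiffAt ℝ 2 (Function.uncurry K) (x, x))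
    (hsymm : ∀ᶠ p in 𝓝 (x, x), K p.2 p.1 = K p.1 p.2) (u v : E) :
    fderiv ℝ (fun w => fderiv ℝ (K w) x) x u v = fderiv ℝ (fun w => fderiv ℝ (K w) x) x v u := by
  have hmixed (a b : E) : fderiv ℝ (fun w => fderiv ℝ (K w) x) x a b =
      fderiv ℝ (fderiv ℝ (Function.uncurry K)) (x, x) (a, 0) (0, b) :=
    congrArg (fun L => L a b) (hasFDerivAt_fderiv_snd hK).fderiv
  rw [hmixed, hmixed, fderiv_fderiv_swap hK hsymm, (hK.isSymmSndFDerivAt (by simp)).eq]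
  rfl

end MixedSecondDerivative

section InvariantFrame

variable {E 𝒢 : Type*} [NormedAddCommGroup E] [CommGroup 𝒢] [TopologicalSpace 𝒢]

/-- The left multiplication by `g`, read in the chart `e` of the abelian Lie group `𝒢`. -/
def chartMul (e : OpenPartialHomeomorph 𝒢 E) (g : 𝒢) (z : E) : E := e (g * e.symm z)

variable {e : OpenPartialHomeomorph 𝒢 E}

lemma symm_mul_symm_one_mem_source (h1 : (1 : 𝒢) ∈ e.source) {z : E} (hz : z ∈ e.target) :
    e.symm z * e.symm (e 1) ∈ e.source := by
  rw [e.left_inv h1, mul_one]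
  exact e.map_target hz

lemma chartMul_symm_one (h1 : (1 : 𝒢) ∈ e.source) {z : E} (hz : z ∈ e.target) :
    chartMul e (e.symm z) (e 1) = z := by
  rw [chartMul, e.left_inv h1, mul_one, e.right_inv hz]

variable [NormedSpace ℝ E]

/-- The frame of translation invariant vector fields on the abelian Lie group `𝒢`, read in the
chart `e` and normalized at the identity: the value at `e.symm z` of the invariant vector field that
extends `v` is `invFrame e z v`. -/
def invFrame (e : OpenPartialHomeomorph 𝒢 E) (z : E) : E →L[ℝ] E :=
  fderiv ℝ (chartMul e (e.symm z)) (e 1)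

lemma invFrame_one (h1 : (1 : 𝒢) ∈ e.source) : invFrame e (e 1) = ContinuousLinearMap.id ℝ E := by
  have hone : chartMul e (e.symm (e 1)) =ᶠ[𝓝 (e 1)] id := by
    filter_upwards [e.open_target.mem_nhds (e.map_source h1)] with w hw
    simp [chartMul, e.left_inv h1, e.right_inv hw]
  rw [invFrame, hone.fderiv_eq, fderiv_id]

variable [ChartedSpace E 𝒢] [LieGroup 𝓘(ℝ, E) ∞ 𝒢]
  (he : e ∈ IsManifold.maximalAtlas 𝓘(ℝ, E) ∞ 𝒢)
include he

lemma contDiffAt_chartMul_symm {p : E × E} (h1 : p.1 ∈ e.target) (h2 : p.2 ∈ e.target)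
    (h : e.symm p.1 * e.symm p.2 ∈ e.source) :
    ContDiffAt ℝ ∞ (fun q : E × E => chartMul e (e.symm q.1) q.2) p := by
  rw [← contMDiffAt_iff_contDiffAt]
  have hfst : ContMDiffAt 𝓘(ℝ, E × E) 𝓘(ℝ, E) ∞ (fun q : E × E => e.symm q.1) p :=
    (contMDiffAt_symm_of_mem_maximalAtlas he h1).comp p contDiff_fst.contMDiff.contMDiffAt
  have hsnd : ContMDiffAt 𝓘(ℝ, E × E) 𝓘(ℝ, E) ∞ (fun q : E × E => e.symm q.2) p :=
    (contMDiffAt_symm_of_mem_maximalAtlas he h2).comp p contDiff_snd.contMDiff.contMDiffAt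
  exact ContMDiffAt.comp p (contMDiffAt_of_mem_maximalAtlas he h) (hfst.mul hsnd)

lemma contDiffAt_chartMul {g : 𝒢} {z : E} (hz : z ∈ e.target) (h : g * e.symm z ∈ e.source) :
    ContDiffAt ℝ ∞ (chartMul e g) z := by
  rw [← contMDiffAt_iff_contDiffAt]
  exact ContMDiffAt.comp z (contMDiffAt_of_mem_maximalAtlas he h)
    (contMDiffAt_const.mul (contMDiffAt_symm_of_mem_maximalAtlas he hz))

lemma eventually_mul_symm_mem {g : 𝒢} {z : E} (hz : z ∈ e.target) (h : g * e.symm z ∈ e.source) :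
    ∀ᶠ w in 𝓝 z, w ∈ e.target ∧ g * e.symm w ∈ e.source := by
  have hmul : ContMDiffAt 𝓘(ℝ, E) 𝓘(ℝ, E) ∞ (fun w => g * e.symm w) z :=
    contMDiffAt_const.mul (contMDiffAt_symm_of_mem_maximalAtlas he hz)
  exact Filter.Eventually.and (e.open_target.mem_nhds hz)
    (hmul.continuousAt.preimage_mem_nhds (e.open_source.mem_nhds h))

variable (h1 : (1 : 𝒢) ∈ e.source)
include h1

lemma fderiv_chartMul_comp_invFrame {g : 𝒢} {z : E} (hz : z ∈ e.target)
    (h : g * e.symm z ∈ e.source) :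
    (fderiv ℝ (chartMul e g) z).comp (invFrame e z) = invFrame e (chartMul e g z) := by
  have hz1 := symm_mul_symm_one_mem_source h1 hz
  have hd1 : DifferentiableAt ℝ (chartMul e (e.symm z)) (e 1) :=
    (contDiffAt_chartMul he (e.map_source h1) hz1).differentiableAt (by simp)
  have hd : DifferentiableAt ℝ (chartMul e g) (chartMul e (e.symm z) (e 1)) := by
    rw [chartMul_symm_one h1 hz]
    exact (contDiffAt_chartMul he hz h).differentiableAt (by simp)
  have hchain := fderiv_comp (e 1) hd hd1
  rw [chartMul_symm_one h1 hz] at hchain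
  rw [invFrame, ← hchain, invFrame]
  refine Filter.EventuallyEq.fderiv_eq ?_
  filter_upwards [eventually_mul_symm_mem he (e.map_source h1) hz1] with w hw
  simp only [Function.comp_apply, chartMul]
  rw [e.left_inv hw.2, e.left_inv h, mul_assoc]

lemma contDiffAt_invFrame {z : E} (hz : z ∈ e.target) : ContDiffAt ℝ ∞ (invFrame e) z := by
  have hmul {w : E} (hw : w ∈ e.target) :
      ContDiffAt ℝ ∞ (fun q : E × E => chartMul e (e.symm q.1) q.2) (w, e 1) :=
    contDiffAt_chartMul_symm he hw (e.map_source h1) (symm_mul_symm_one_mem_source h1 hw)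
  have hsnd : ContDiffAt ℝ ∞ (fun w => (fderiv ℝ (fun q : E × E => chartMul e (e.symm q.1) q.2)
      (w, e 1)).comp (.inr ℝ E E)) z :=
    (ContDiffAt.comp z ((hmul hz).fderiv_right (m := ∞) le_rfl)
      (contDiffAt_id.prodMk contDiffAt_const)).clm_comp contDiffAt_const
  refine hsnd.congr_of_eventuallyEq ?_
  filter_upwards [e.open_target.mem_nhds hz] with w hw
  exact (((hmul hw).differentiableAt (by simp)).hasFDerivAt.comp (e 1)
    (hasFDerivAt_prodMk_right w (e 1))).fderiv

/-- The double translation `(w, w') ↦ z w w'` is symmetric, and its mixed second derivative at the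
identity is the derivative of the frame along itself. -/
lemma fderiv_invFrame_comm {z : E} (hz : z ∈ e.target) (u v : E) :
    fderiv ℝ (invFrame e) z (invFrame e z u) v = fderiv ℝ (invFrame e) z (invFrame e z v) u := by
  have hz1 := symm_mul_symm_one_mem_source h1 hz
  have hzv := chartMul_symm_one h1 hz
  have ht1 : e 1 ∈ e.target := e.map_source h1
  set K : E → E → E := fun w => chartMul e (e.symm (chartMul e (e.symm z) w)) with hKdef
  have hK : ContDiffAt ℝ ∞ (Function.uncurry K) (e 1, e 1) := by
    have hmul : ContDiffAt ℝ ∞ (fun q : E × E => chartMul e (e.symm q.1) q.2)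
        (chartMul e (e.symm z) (e 1), e 1) := by
      rw [hzv]
      exact contDiffAt_chartMul_symm he hz ht1 hz1
    exact ContDiffAt.comp (e 1, e 1) (f := fun q : E × E => (chartMul e (e.symm z) q.1, q.2)) hmul
      ((ContDiffAt.comp (e 1, e 1) (contDiffAt_chartMul he ht1 hz1) contDiffAt_fst).prodMk
        contDiffAt_snd)
  have hnear := eventually_mul_symm_mem he ht1 hz1
  have hsymm : ∀ᶠ p in 𝓝 (e 1, e 1), K p.2 p.1 = K p.1 p.2 := by
    filter_upwards [hnear.prod_nhds hnear] with p hp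
    simp only [hKdef, chartMul]
    rw [e.left_inv hp.1.2, e.left_inv hp.2.2, mul_right_comm]
  have hframe : HasFDerivAt (fun w => fderiv ℝ (K w) (e 1))
      ((fderiv ℝ (invFrame e) z).comp (invFrame e z)) (e 1) := by
    refine HasFDerivAt.comp (e 1) (g := invFrame e) ?_
      ((contDiffAt_chartMul he ht1 hz1).differentiableAt (by simp)).hasFDerivAt
    rw [hzv]
    exact ((contDiffAt_invFrame he h1 hz).differentiableAt (by simp)).hasFDerivAt
  have hcomm := fderiv_fderiv_comm_of_symm (hK.of_le (by norm_cast)) hsymm u v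
  rwa [hframe.fderiv] at hcomm

lemma eventually_isUnit_invFrame [CompleteSpace E] : ∀ᶠ z in 𝓝 (e 1), IsUnit (invFrame e z) := by
  refine (contDiffAt_invFrame he h1 (e.map_source h1)).continuousAt.eventually
    (Units.isOpen.mem_nhds ?_)
  rw [invFrame_one h1]
  exact isUnit_one

variable {z : E} (hz : z ∈ e.target) (hu : IsUnit (invFrame e z))
include hz hu

lemma contDiffAt_inverse_invFrame [CompleteSpace E] :
    ContDiffAt ℝ ∞ (fun w => Ring.inverse (invFrame e w)) z := by
  obtain ⟨L, hL⟩ := hu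
  exact ContDiffAt.comp z (g := Ring.inverse) (hL ▸ contDiffAt_ringInverse ℝ L)
    (contDiffAt_invFrame he h1 hz)

lemma fderiv_inverse_invFrame_comm [CompleteSpace E] (x y : E) :
    fderiv ℝ (fun w => Ring.inverse (invFrame e w)) z x y =
      fderiv ℝ (fun w => Ring.inverse (invFrame e w)) z y x := by
  obtain ⟨L, hL⟩ := hu
  have hframe : HasFDerivAt (invFrame e) (fderiv ℝ (invFrame e) z) z :=
    ((contDiffAt_invFrame he h1 hz).differentiableAt (by simp)).hasFDerivAt
  have hinv : HasFDerivAt Ring.inverse _ (invFrame e z) := hL ▸ hasFDerivAt_ringInverse (𝕜 := ℝ) L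
  have hcoframe (a b : E) : fderiv ℝ (fun w => Ring.inverse (invFrame e w)) z a b =
      -((↑L⁻¹ : E →L[ℝ] E) (fderiv ℝ (invFrame e) z a ((↑L⁻¹ : E →L[ℝ] E) b))) :=
    congrArg (fun T : E →L[ℝ] E →L[ℝ] E => T a b) (hinv.comp z hframe).fderiv
  have hright (a : E) : invFrame e z ((↑L⁻¹ : E →L[ℝ] E) a) = a :=
    hL ▸ congrArg (fun T : E →L[ℝ] E => T a) L.mul_inv
  have hcomm := fderiv_invFrame_comm he h1 hz ((↑L⁻¹ : E →L[ℝ] E) x) ((↑L⁻¹ : E →L[ℝ] E) y)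
  rw [hright, hright] at hcomm
  rw [hcoframe, hcoframe, hcomm]

end InvariantFrame

section LogChart

lemma exists_equiv_coe_eq_inverse {E : Type*} [NormedAddCommGroup E] [NormedSpace ℝ E]
    {A : E →L[ℝ] E} (hA : IsUnit A) :
    ∃ L : E ≃L[ℝ] E, (L : E →L[ℝ] E) = Ring.inverse A ∧ (L.symm : E →L[ℝ] E) = A := by
  obtain ⟨u, rfl⟩ := hA
  exact ⟨ContinuousLinearEquiv.unitsEquiv ℝ E u⁻¹, (Ring.inverse_unit u).symm, rfl⟩

variable {E 𝒢 : Type*} [NormedAddCommGroup E] [NormedSpace ℝ E] [CommGroup 𝒢] [TopologicalSpace 𝒢]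
  {e : OpenPartialHomeomorph 𝒢 E}

/-- A change of coordinates `φ` which turns the invariant frame of the chart `e` into the constant
frame. -/
structure IsStraightening (e : OpenPartialHomeomorph 𝒢 E) (φ : OpenPartialHomeomorph E E) :
    Prop where
  one_mem : e 1 ∈ φ.source
  source_subset : φ.source ⊆ e.target
  map_one : φ (e 1) = 0
  contDiffAt : ∀ z ∈ φ.source, ContDiffAt ℝ ∞ φ z
  isUnit_invFrame : ∀ z ∈ φ.source, IsUnit (invFrame e z)
  hasFDerivAt : ∀ z ∈ φ.source, HasFDerivAt φ (Ring.inverse (invFrame e z)) z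

namespace IsStraightening

variable {φ : OpenPartialHomeomorph E E} (hφ : IsStraightening e φ) {w : E}
include hφ

lemma hasFDerivAt_symm (hw : w ∈ φ.target) :
    HasFDerivAt φ.symm (invFrame e (φ.symm w)) w := by
  have hz := φ.map_target hw
  obtain ⟨L, hL, hL'⟩ := exists_equiv_coe_eq_inverse (hφ.isUnit_invFrame _ hz)
  rw [← hL']
  exact φ.hasFDerivAt_symm hw (hL ▸ hφ.hasFDerivAt _ hz)

lemma contDiffAt_symm [CompleteSpace E] (hw : w ∈ φ.target) : ContDiffAt ℝ ∞ φ.symm w := by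
  have hz := φ.map_target hw
  obtain ⟨L, hL, -⟩ := exists_equiv_coe_eq_inverse (hφ.isUnit_invFrame _ hz)
  exact φ.contDiffAt_symm hw (hL ▸ hφ.hasFDerivAt _ hz) (hφ.contDiffAt _ hz)

variable [ChartedSpace E 𝒢] [LieGroup 𝓘(ℝ, E) ∞ 𝒢]
  (he : e ∈ IsManifold.maximalAtlas 𝓘(ℝ, E) ∞ 𝒢)
include he

lemma trans_mem_maximalAtlas [CompleteSpace E] :
    e.trans φ ∈ IsManifold.maximalAtlas 𝓘(ℝ, E) ∞ 𝒢 := by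
  refine OpenPartialHomeomorph.mem_maximalAtlas_of_contMDiffOn _ (fun x hx => ?_) fun w hw => ?_
  · rw [OpenPartialHomeomorph.trans_source] at hx
    exact (ContMDiffAt.comp x (hφ.contDiffAt _ hx.2).contMDiffAt
      (contMDiffAt_of_mem_maximalAtlas he hx.1)).contMDiffWithinAt
  · have hw' := hw.1
    exact (ContMDiffAt.comp w (contMDiffAt_symm_of_mem_maximalAtlas he
      (hφ.source_subset (φ.map_target hw'))) (hφ.contDiffAt_symm hw').contMDiffAt).contMDiffWithinAt

lemma hasFDerivAt_chartMul_trans (h1 : (1 : 𝒢) ∈ e.source) {g : 𝒢}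
    (hw : w ∈ (e.trans φ).target)
    (h : g * (e.trans φ).symm w ∈ (e.trans φ).source) :
    HasFDerivAt (chartMul (e.trans φ) g) (ContinuousLinearMap.id ℝ E) w := by
  have hw' := hw.1
  have hz : φ.symm w ∈ e.target := hφ.source_subset (φ.map_target hw')
  rw [OpenPartialHomeomorph.trans_source] at h
  have hmul : HasFDerivAt (chartMul e g) (fderiv ℝ (chartMul e g) (φ.symm w)) (φ.symm w) :=
    ((contDiffAt_chartMul he hz h.1).differentiableAt (by simp)).hasFDerivAt
  have hcomp := (hφ.hasFDerivAt (chartMul e g (φ.symm w)) h.2).comp w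
    (hmul.comp w (hφ.hasFDerivAt_symm hw'))
  rw [fderiv_chartMul_comp_invFrame he h1 hz h.1] at hcomp
  exact hcomp.congr_fderiv (Ring.inverse_mul_cancel _ (hφ.isUnit_invFrame _ h.2))

end IsStraightening

variable [ChartedSpace E 𝒢]

/-- A chart at the identity of the abelian Lie group `𝒢` that is locally a homomorphism to the Lie
algebra, i.e. a local inverse of the exponential map. -/
structure IsLogChart (ψ : OpenPartialHomeomorph 𝒢 E) : Prop where
  mem_maximalAtlas : ψ ∈ IsManifold.maximalAtlas 𝓘(ℝ, E) ∞ 𝒢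
  zero_mem_target : (0 : E) ∈ ψ.target
  symm_zero : ψ.symm 0 = 1
  hasMFDerivAt_symm : HasMFDerivAt 𝓘(ℝ, E) 𝓘(ℝ, E) ψ.symm 0 (ContinuousLinearMap.id ℝ E)
  symm_sub : ∀ w ∈ ψ.target, ∀ᶠ w' in 𝓝 w, ψ.symm w' = ψ.symm w * ψ.symm (w' - w)

variable [LieGroup 𝓘(ℝ, E) ∞ 𝒢]

lemma symm_eq_mul_symm_sub {ψ : OpenPartialHomeomorph 𝒢 E} (h1 : (1 : 𝒢) ∈ ψ.source) (hψ1 : ψ 1 = 0)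
    (hderiv : ∀ (g : 𝒢), ∀ w ∈ ψ.target, g * ψ.symm w ∈ ψ.source →
      HasFDerivAt (chartMul ψ g) (ContinuousLinearMap.id ℝ E) w)
    {w : E} (hw : w ∈ ψ.target) :
    ∀ᶠ w' in 𝓝 w, ψ.symm w' = ψ.symm w * ψ.symm (w' - w) := by
  have hnear : ∀ᶠ w' in 𝓝 w, w' ∈ ψ.target ∧ (ψ.symm w)⁻¹ * ψ.symm w' ∈ ψ.source := by
    have : ContinuousMul 𝒢 := continuousMul_of_contMDiffMul 𝓘(ℝ, E) ∞
    refine Filter.Eventually.and (ψ.open_target.mem_nhds hw)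
      ((continuousAt_const.mul (ψ.continuousAt_symm hw)).preimage_mem_nhds
        (ψ.open_source.mem_nhds ?_))
    simpa [inv_mul_cancel] using h1
  obtain ⟨r, hr, hball⟩ := Metric.eventually_nhds_iff_ball.1 hnear
  have hzero : ∀ w' ∈ Metric.ball w r,
      HasFDerivAt (fun v => chartMul ψ (ψ.symm w)⁻¹ v - v) (0 : E →L[ℝ] E) w' := fun w' hw' =>
    ((hderiv _ w' (hball w' hw').1 (hball w' hw').2).sub (hasFDerivAt_id w')).congr_fderiv
      (sub_self _)
  filter_upwards [Metric.ball_mem_nhds w hr] with w' hw'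
  have hconst : chartMul ψ (ψ.symm w)⁻¹ w' - w' = chartMul ψ (ψ.symm w)⁻¹ w - w :=
    Metric.isOpen_ball.is_const_of_fderiv_eq_zero (𝕜 := ℝ) (convex_ball w r).isPreconnected
      (fun v hv => (hzero v hv).differentiableAt.differentiableWithinAt)
      (fun v hv => (hzero v hv).fderiv) hw' (Metric.mem_ball_self hr)
  have htrans : ψ ((ψ.symm w)⁻¹ * ψ.symm w') = w' - w := by
    simp only [chartMul, inv_mul_cancel, hψ1, zero_sub] at hconst
    rw [sub_eq_iff_eq_add.1 hconst, neg_add_eq_sub]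
  rw [← htrans, ψ.left_inv (hball w' hw').2, mul_inv_cancel_left]

variable [CompleteSpace E]

lemma exists_primitive_inverse_invFrame (he : e ∈ IsManifold.maximalAtlas 𝓘(ℝ, E) ∞ 𝒢)
    (h1 : (1 : 𝒢) ∈ e.source) :
    ∃ (s : Set E) (f : E → E), IsOpen s ∧ e 1 ∈ s ∧ s ⊆ e.target ∧ f (e 1) = 0 ∧
      (∀ z ∈ s, IsUnit (invFrame e z)) ∧ ContDiffOn ℝ ∞ f s ∧
      ∀ z ∈ s, HasFDerivAt f (Ring.inverse (invFrame e z)) z := by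
  obtain ⟨r, hr, hball⟩ := Metric.eventually_nhds_iff_ball.1 (Filter.Eventually.and
    (e.open_target.mem_nhds (e.map_source h1)) (eventually_isUnit_invFrame he h1))
  have hcoframe : ContDiffOn ℝ ∞ (fun z => Ring.inverse (invFrame e z)) (Metric.ball (e 1) r) :=
    fun z hz => (contDiffAt_inverse_invFrame he h1 (hball z hz).1 (hball z hz).2).contDiffWithinAt
  obtain ⟨f, hf⟩ := (convex_ball (e 1) r).exists_forall_hasFDerivAt_of_fderiv_symmetric
    Metric.isOpen_ball (hcoframe.differentiableOn (by simp)) fun z hz x y =>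
      fderiv_inverse_invFrame_comm he h1 (hball z hz).1 (hball z hz).2 x y
  have hf' : ∀ z ∈ Metric.ball (e 1) r, HasFDerivAt (fun w => f w - f (e 1))
      (Ring.inverse (invFrame e z)) z := fun z hz => (hf z hz).sub_const _
  refine ⟨Metric.ball (e 1) r, fun w => f w - f (e 1), Metric.isOpen_ball,
    Metric.mem_ball_self hr, fun z hz => (hball z hz).1, sub_self _,
    fun z hz => (hball z hz).2, ?_, hf'⟩
  rw [contDiffOn_infty_iff_fderiv_of_isOpen Metric.isOpen_ball]
  exact ⟨fun z hz => (hf' z hz).differentiableAt.differentiableWithinAt,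
    hcoframe.congr fun z hz => (hf' z hz).fderiv⟩

lemma exists_isStraightening (he : e ∈ IsManifold.maximalAtlas 𝓘(ℝ, E) ∞ 𝒢)
    (h1 : (1 : 𝒢) ∈ e.source) : ∃ φ : OpenPartialHomeomorph E E, IsStraightening e φ := by
  obtain ⟨s, f, hs, h1s, hst, hf1, hu, hfs, hf⟩ := exists_primitive_inverse_invFrame he h1
  have hsmooth (z : E) (hz : z ∈ s) : ContDiffAt ℝ ∞ f z := hfs.contDiffAt (hs.mem_nhds hz)
  obtain ⟨L, hL, -⟩ := exists_equiv_coe_eq_inverse (hu _ h1s)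
  have hf1' : HasFDerivAt f (L : E →L[ℝ] E) (e 1) := hL ▸ hf _ h1s
  set φ : OpenPartialHomeomorph E E :=
    ((hsmooth _ h1s).toOpenPartialHomeomorph f hf1' (by simp)).restrOpen s hs with hφ
  have hφs : φ.source ⊆ s := fun z hz => by
    rw [hφ, OpenPartialHomeomorph.restrOpen_source] at hz
    exact hz.2
  refine ⟨φ, ?_, hφs.trans hst, hf1, fun z hz => hsmooth z (hφs hz), fun z hz => hu z (hφs hz),
    fun z hz => hf z (hφs hz)⟩
  rw [hφ, OpenPartialHomeomorph.restrOpen_source]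
  exact ⟨ContDiffAt.mem_toOpenPartialHomeomorph_source _ _ _, h1s⟩

variable (E 𝒢) in
theorem exists_isLogChart : ∃ ψ : OpenPartialHomeomorph 𝒢 E, IsLogChart ψ := by
  set e : OpenPartialHomeomorph 𝒢 E := chartAt E (1 : 𝒢)
  have he : e ∈ IsManifold.maximalAtlas 𝓘(ℝ, E) ∞ 𝒢 := IsManifold.chart_mem_maximalAtlas 1
  have h1 : (1 : 𝒢) ∈ e.source := mem_chart_source E 1
  obtain ⟨φ, hφ⟩ := exists_isStraightening he h1
  have hψ1 : (1 : 𝒢) ∈ (e.trans φ).source := ⟨h1, hφ.one_mem⟩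
  have hone : (e.trans φ) 1 = 0 := hφ.map_one
  have h0 : (0 : E) ∈ (e.trans φ).target := hone ▸ (e.trans φ).map_source hψ1
  have hsymm : (e.trans φ).symm 0 = 1 := by rw [← hone, (e.trans φ).left_inv hψ1]
  have hφ0 : φ.symm 0 = e 1 := by rw [← hφ.map_one, φ.left_inv hφ.one_mem]
  refine ⟨e.trans φ, hφ.trans_mem_maximalAtlas he, h0, hsymm, 
    ⟨(e.trans φ).continuousAt_symm h0, ?_⟩, fun w hw => symm_eq_mul_symm_sub hψ1 hone
      (fun g w hw h => hφ.hasFDerivAt_chartMul_trans he h1 hw h) hw⟩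
  have hderiv := hφ.hasFDerivAt_symm (h0.1)
  rw [hφ0, invFrame_one h1] at hderiv
  rw [writtenInExtChartAt, hsymm]
  refine (hderiv.congr_of_eventuallyEq ?_).hasFDerivWithinAt
  filter_upwards [(e.trans φ).open_target.mem_nhds h0] with w hw
  exact e.right_inv (hφ.source_subset (φ.map_target (hw.1)))

end LogChart

section PullbackForm

variable {ι : Type} [Fintype ι]
variable {X : Type*} [TopologicalSpace X] [ChartedSpace (Coord ι) X]
variable {F : Type*} [NormedAddCommGroup F] [NormedSpace ℝ F]
variable {Y : Type*} [TopologicalSpace Y] [ChartedSpace F Y]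
variable {F' : Type*} [NormedAddCommGroup F'] [NormedSpace ℝ F']
variable {Z : Type*} [TopologicalSpace Z] [ChartedSpace F' Z]

variable (ι F) in
/-- The differential of a map between manifolds, with the tangent spaces, which depend on the
point, identified with the model spaces, which do not. -/
def derivCoord (f : Y → X) (p : Y) : F →L[ℝ] Coord ι := mfderiv 𝓘(ℝ, F) 𝓘(ℝ, Coord ι) f p

lemma derivCoord_congr {f f' : Y → X} {p : Y} (h : f =ᶠ[𝓝 p] f') :
    derivCoord ι F f p = derivCoord ι F f' p := h.mfderiv_eq

lemma derivCoord_comp {f : Y → X} {k : Z → Y} {p : Z} {D : F' →L[ℝ] F}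
    (hf : MDifferentiableAt 𝓘(ℝ, F) 𝓘(ℝ, Coord ι) f (k p))
    (hk : HasMFDerivAt 𝓘(ℝ, F') 𝓘(ℝ, F) k p D) :
    derivCoord ι F' (f ∘ k) p = (derivCoord ι F f (k p)).comp D :=
  (hf.hasMFDerivAt.comp p hk).mfderiv

lemma mdifferentiable_of_mem_charts {φ : OpenPartialHomeomorph X (Coord ι)}
    (hφ : φ ∈ charts ι X) : φ.MDifferentiable 𝓘(ℝ, Coord ι) 𝓘(ℝ, Coord ι) :=
  ⟨(contMDiffOn_of_mem_maximalAtlas hφ).mdifferentiableOn (by simp),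
    (contMDiffOn_symm_of_mem_maximalAtlas hφ).mdifferentiableOn (by simp)⟩

variable [IsManifold 𝓘(ℝ, Coord ι) ∞ X]

/-- The inner product on a tangent space, with the latter identified with the model space. -/
def innerCoord (g : Metric ι X) (p : X) : Coord ι →L[ℝ] Coord ι →L[ℝ] ℝ := g.inner p

variable (F) in
/-- The pullback `f^* g` of a Riemannian metric at the point `p`, as a bilinear form on the model
space. -/
def pullForm (g : Metric ι X) (f : Y → X) (p : Y) : LinearMap.BilinForm ℝ F :=
  (innerCoord g (f p)).toBilinForm.comp (derivCoord ι F f p).toLinearMap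
    (derivCoord ι F f p).toLinearMap

lemma pullForm_apply (g : Metric ι X) (f : Y → X) (p : Y) (u w : F) :
    pullForm F g f p u w = innerCoord g (f p) (derivCoord ι F f p u) (derivCoord ι F f p w) := rfl

lemma isSymm_pullForm (g : Metric ι X) (f : Y → X) (p : Y) : (pullForm F g f p).IsSymm :=
  ⟨fun _ _ => g.symm _ _ _⟩

lemma pullForm_congr (g : Metric ι X) {f f' : Y → X} {p : Y} (h : f =ᶠ[𝓝 p] f') :
    pullForm F g f p = pullForm F g f' p := by
  rw [pullForm, pullForm, derivCoord_congr h, h.self_of_nhds]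

lemma pullForm_comp (g : Metric ι X) {f : Y → X} {k : Z → Y} {p : Z} {D : F' →L[ℝ] F}
    (hf : MDifferentiableAt 𝓘(ℝ, F) 𝓘(ℝ, Coord ι) f (k p))
    (hk : HasMFDerivAt 𝓘(ℝ, F') 𝓘(ℝ, F) k p D) :
    pullForm F' g (f ∘ k) p = (pullForm F g f (k p)).comp D.toLinearMap D.toLinearMap := by
  rw [pullForm, derivCoord_comp hf hk]
  rfl

lemma posDef_pullForm (g : Metric ι X) {f : Y → X} {p : Y}
    (hf : Function.Injective (derivCoord ι F f p)) : (pullForm F g f p).toQuadraticMap.PosDef :=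
  fun _ hu => g.pos _ _ fun h => hu (hf (h.trans (map_zero _).symm))

lemma contMDiffAt_coordVec [DecidableEq ι] {φ : OpenPartialHomeomorph X (Coord ι)}
    (hφ : φ ∈ charts ι X) {y : Coord ι} (hy : y ∈ φ.target) (i : ι) :
    ContMDiffAt 𝓘(ℝ, Coord ι) 𝓘(ℝ, Coord ι).tangent ∞
      (fun z => (TotalSpace.mk' (Coord ι) (φ.symm z) (coordVec φ z i) :
        TangentBundle 𝓘(ℝ, Coord ι) X)) y := by
  have htangent := (contMDiffOn_symm_of_mem_maximalAtlas hφ).contMDiffOn_tangentMapWithin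
    (m := ∞) le_rfl φ.open_target.uniqueMDiffOn
  have hconst : ContMDiffAt 𝓘(ℝ, Coord ι) 𝓘(ℝ, Coord ι).tangent ∞
      (fun z : Coord ι => (TotalSpace.mk' (Coord ι) z (EuclideanSpace.single i (1 : ℝ)) :
        TangentBundle 𝓘(ℝ, Coord ι) (Coord ι))) y :=
    contMDiffAt_vectorSpace_iff_contDiffAt.2 contDiffAt_const
  have hcomp := ((htangent ⟨y, EuclideanSpace.single i (1 : ℝ)⟩ hy).contMDiffAt
    ((φ.open_target.preimage (FiberBundle.continuous_proj (Coord ι) _)).mem_nhds hy)).comp y hconst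
  refine hcomp.congr_of_eventuallyEq ?_
  filter_upwards [φ.open_target.mem_nhds hy] with z hz
  simp only [Function.comp_apply, tangentMapWithin, coordVec]
  rw [mfderivWithin_of_isOpen φ.open_target hz]

lemma smoothMatAt_metricCoeff [DecidableEq ι] (g : Metric ι X)
    {φ : OpenPartialHomeomorph X (Coord ι)} (hφ : φ ∈ charts ι X) {y : Coord ι}
    (hy : y ∈ φ.target) : SmoothMatAt (metricCoeff g φ) y := by
  intro i j
  have hsection : ContMDiffAt 𝓘(ℝ, Coord ι) (𝓘(ℝ, Coord ι).prod 𝓘(ℝ)) ∞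
      (fun z => TotalSpace.mk' ℝ (E := Bundle.Trivial X ℝ) (φ.symm z)
        (g.inner (φ.symm z) (coordVec φ z i) (coordVec φ z j))) y :=
    ContMDiffAt.clm_bundle_apply₂ (F₁ := Coord ι) (F₂ := Coord ι)
      (ContMDiffAt.comp y g.contMDiff.contMDiffAt (contMDiffAt_symm_of_mem_maximalAtlas hφ hy))
      (contMDiffAt_coordVec hφ hy i) (contMDiffAt_coordVec hφ hy j)
  simp only [contMDiffAt_totalSpace] at hsection
  exact contMDiffAt_iff_contDiffAt.1 hsection.2

lemma isSymm_metricCoeff [DecidableEq ι] (g : Metric ι X)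
    (φ : OpenPartialHomeomorph X (Coord ι)) (y : Coord ι) : (metricCoeff g φ y).IsSymm :=
  Matrix.IsSymm.ext fun _ _ => g.symm _ _ _

lemma posDef_metricCoeff [DecidableEq ι] (g : Metric ι X)
    {φ : OpenPartialHomeomorph X (Coord ι)} (hφ : φ ∈ charts ι X) {y : Coord ι}
    (hy : y ∈ φ.target) : (metricCoeff g φ y).PosDef := by
  have hmatrix : metricCoeff g φ y = LinearMap.BilinForm.toMatrix
      (EuclideanSpace.basisFun ι ℝ).toBasis (pullForm (Coord ι) g φ.symm y) := by
    ext i j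
    simp only [LinearMap.BilinForm.toMatrix_apply, OrthonormalBasis.coe_toBasis,
      EuclideanSpace.basisFun_apply]
    rfl
  rw [hmatrix, ← LinearMap.BilinForm.posDef_toQuadraticMap_iff_matrix _ _ (isSymm_pullForm _ _ _)]
  exact posDef_pullForm g ((mdifferentiable_of_mem_charts hφ).symm.mfderiv_injective hy)

end PullbackForm

section ShearCoordinates

variable {ι κ : Type} [Fintype ι] [Fintype κ]

/-- The linear coordinates on `Coord ι × Coord κ` which are the given ones on the first factor, and
the coordinates with respect to the basis `v`, sheared by the matrix `a`, on the second one. -/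
def shearEquiv (v : Module.Basis κ ℝ (Coord κ)) (a : Matrix κ ι ℝ) :
    (Coord ι × Coord κ) ≃L[ℝ] Coord (ι ⊕ κ) :=
  LinearEquiv.toContinuousLinearEquiv
    { toFun := fun p => WithLp.toLp 2 (Sum.elim (fun α => p.1 α)
        fun I => v.repr p.2 I + ∑ α, a I α * p.1 α)
      map_add' := fun p q => by
        ext k; cases k
        · simp
        · simp [mul_add, Finset.sum_add_distrib]; ring
      map_smul' := fun c p => by
        ext k; cases k
        · simp
        · simp [mul_add, Finset.mul_sum, mul_left_comm]
      invFun := fun z => (baseProj ι κ z,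
        ∑ I, (z (Sum.inr I) - ∑ α, a I α * z (Sum.inl α)) • v I)
      left_inv := fun p => by
        ext α
        · simp
        · simp [v.sum_repr]
      right_inv := fun z => by
        classical
        ext k; cases k
        · simp
        · simp [Finsupp.single_apply] }

variable (v : Module.Basis κ ℝ (Coord κ)) (a : Matrix κ ι ℝ)

@[simp] lemma baseProj_shearEquiv (p : Coord ι × Coord κ) :
    baseProj ι κ (shearEquiv v a p) = p.1 := rfl

lemma contDiff_shearEquiv_prodMk (w : Coord κ) :
    ContDiff ℝ ∞ fun y : Coord ι => shearEquiv v a (y, w) :=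
  (shearEquiv v a).contDiff.comp (contDiff_prodMk_left w)

variable [DecidableEq ι] [DecidableEq κ]

lemma shearEquiv_symm_single_inr (I : κ) :
    (shearEquiv v a).symm (EuclideanSpace.single (Sum.inr I) 1) = (0, v I) := by
  rw [ContinuousLinearEquiv.symm_apply_eq]
  ext k
  cases k with
  | inl α => simp [shearEquiv]
  | inr J => simp [shearEquiv, Finsupp.single_apply, eq_comm]

lemma shearEquiv_symm_single_inl (α : ι) :
    (shearEquiv v a).symm (EuclideanSpace.single (Sum.inl α) 1) =
      (EuclideanSpace.single α 1, -∑ I, a I α • v I) := by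
  rw [ContinuousLinearEquiv.symm_apply_eq]
  ext k
  cases k with
  | inl β => simp [shearEquiv]
  | inr J => simp [shearEquiv, Finsupp.single_apply]

end ShearCoordinates

section LocalTrivialization

variable {n N : ℕ}
variable {B : Type*} [TopologicalSpace B]
variable {M : Type*} [TopologicalSpace M]
variable {𝒢 : Type*} [TopologicalSpace 𝒢]
variable {proj : M → B}

/-- The identification of `𝒢` with the fiber over `b` given by a local trivialization. -/
def fiberIncl (e : Trivialization 𝒢 proj) (b : B) (x : 𝒢) : M :=
  e.toOpenPartialHomeomorph.symm (b, x)

variable {e : Trivialization 𝒢 proj} {b : B}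

lemma apply_fiberIncl (hb : b ∈ e.baseSet) (x : 𝒢) : e (fiberIncl e b x) = (b, x) :=
  e.apply_symm_apply (e.mem_target.2 hb)

lemma proj_fiberIncl (hb : b ∈ e.baseSet) (x : 𝒢) : proj (fiberIncl e b x) = b :=
  e.proj_symm_apply (e.mem_target.2 hb)

lemma fiberIncl_mem_source (hb : b ∈ e.baseSet) (x : 𝒢) : fiberIncl e b x ∈ e.source :=
  e.toOpenPartialHomeomorph.map_target (e.mem_target.2 hb)

variable [CommGroup 𝒢]

lemma localAct_fiberIncl (hb : b ∈ e.baseSet) (h x : 𝒢) :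
    localAct e h (fiberIncl e b x) = fiberIncl e b (h * x) := by
  rw [localAct, proj_fiberIncl hb, apply_fiberIncl hb]
  rfl

variable [ChartedSpace (Coord (Fin n)) B] [ChartedSpace (Coord (Fin n ⊕ Fin N)) M]
  [ChartedSpace (Coord (Fin N)) 𝒢]

namespace TwistedPrincipalBundle

variable (P : TwistedPrincipalBundle (n := n) (N := N) 𝒢 proj)

include P

lemma contMDiffAt (he : e ∈ P.atlas) {p : M} (hp : p ∈ e.source) :
    ContMDiffAt 𝓘(ℝ, Coord (Fin n ⊕ Fin N))
      (𝓘(ℝ, Coord (Fin n)).prod 𝓘(ℝ, Coord (Fin N))) ∞ e p :=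
  (P.contMDiffOn e he).contMDiffAt (e.open_source.mem_nhds hp)

lemma contMDiffAt_proj (he : e ∈ P.atlas) {p : M} (hp : p ∈ e.source) :
    ContMDiffAt 𝓘(ℝ, Coord (Fin n ⊕ Fin N)) 𝓘(ℝ, Coord (Fin n)) ∞ proj p := by
  refine (P.contMDiffAt he hp).fst.congr_of_eventuallyEq ?_
  filter_upwards [e.open_source.mem_nhds hp] with q hq using (e.coe_fst hq).symm

lemma contMDiffAt_symm (he : e ∈ P.atlas) (hb : b ∈ e.baseSet) (x : 𝒢) :
    ContMDiffAt (𝓘(ℝ, Coord (Fin n)).prod 𝓘(ℝ, Coord (Fin N))) 𝓘(ℝ, Coord (Fin n ⊕ Fin N)) ∞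
      e.toOpenPartialHomeomorph.symm (b, x) :=
  (P.contMDiffOn_symm e he).contMDiffAt (e.open_target.mem_nhds (e.mem_target.2 hb))

lemma contMDiffAt_fiberIncl (he : e ∈ P.atlas) (hb : b ∈ e.baseSet) (x : 𝒢) :
    ContMDiffAt 𝓘(ℝ, Coord (Fin N)) 𝓘(ℝ, Coord (Fin n ⊕ Fin N)) ∞ (fiberIncl e b) x :=
  ContMDiffAt.comp x (g := e.toOpenPartialHomeomorph.symm) (f := fun x : 𝒢 => (b, x))
    (P.contMDiffAt_symm he hb x) (contMDiffAt_const.prodMk contMDiffAt_id)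

lemma contMDiffAt_localSection (he : e ∈ P.atlas) (hb : b ∈ e.baseSet) :
    ContMDiffAt 𝓘(ℝ, Coord (Fin n)) 𝓘(ℝ, Coord (Fin n ⊕ Fin N)) ∞ (localSection e) b :=
  ContMDiffAt.comp b (g := e.toOpenPartialHomeomorph.symm) (f := fun b : B => (b, (1 : 𝒢)))
    (P.contMDiffAt_symm he hb 1) (contMDiffAt_id.prodMk contMDiffAt_const)

lemma contMDiffAt_localAct [LieGroup 𝓘(ℝ, Coord (Fin N)) ∞ 𝒢] (he : e ∈ P.atlas) (h : 𝒢) {p : M}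
    (hp : p ∈ e.source) :
    ContMDiffAt 𝓘(ℝ, Coord (Fin n ⊕ Fin N)) 𝓘(ℝ, Coord (Fin n ⊕ Fin N)) ∞ (localAct e h) p :=
  ContMDiffAt.comp p (g := e.toOpenPartialHomeomorph.symm) (f := fun q => (proj q, h * (e q).2))
    (P.contMDiffAt_symm he (e.mem_source.1 hp) _)
    ((P.contMDiffAt_proj he hp).prodMk (contMDiffAt_const.mul (P.contMDiffAt he hp).snd))

lemma injective_derivCoord_fiberIncl (he : e ∈ P.atlas) (hb : b ∈ e.baseSet) :
    Function.Injective
      (derivCoord (Fin n ⊕ Fin N) (Coord (Fin N)) (fiberIncl e b) (1 : 𝒢)) := by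
  have hleft : (fun p => (e p).2) ∘ fiberIncl e b = (id : 𝒢 → 𝒢) := by
    funext x
    exact congrArg Prod.snd (apply_fiberIncl hb x)
  have hcomp := derivCoord_comp (ι := Fin N) (f := fun p => (e p).2) (k := fiberIncl e b)
    ((P.contMDiffAt he (fiberIncl_mem_source hb 1)).snd.mdifferentiableAt (by simp))
    ((P.contMDiffAt_fiberIncl he hb 1).mdifferentiableAt (by simp)).hasMFDerivAt
  have hid : derivCoord (Fin N) (Coord (Fin N)) (id : 𝒢 → 𝒢) 1 =
      ContinuousLinearMap.id ℝ _ := mfderiv_id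
  rw [hleft, hid] at hcomp
  exact Function.LeftInverse.injective fun w => (DFunLike.congr_fun hcomp w).symm

omit P in
lemma pullForm_localAct [LieGroup 𝓘(ℝ, Coord (Fin N)) ∞ 𝒢]
    [IsManifold 𝓘(ℝ, Coord (Fin n ⊕ Fin N)) ∞ M]
    {P : TwistedPrincipalBundle (n := n) (N := N) 𝒢 proj} {gM : Metric (Fin n ⊕ Fin N) M}
    (hinv : P.IsInvariantMetric gM) (he : e ∈ P.atlas) (h : 𝒢)
    {F : Type*} [NormedAddCommGroup F] [NormedSpace ℝ F] {Y : Type*} [TopologicalSpace Y]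
    [ChartedSpace F Y] {f : Y → M} {p : Y}
    (hf : MDifferentiableAt 𝓘(ℝ, F) 𝓘(ℝ, Coord (Fin n ⊕ Fin N)) f p) (hp : f p ∈ e.source) :
    pullForm F gM (localAct e h ∘ f) p = pullForm F gM f p := by
  have hact := (P.contMDiffAt_localAct he h hp).mdifferentiableAt (by simp)
  rw [pullForm_comp gM hact hf.hasMFDerivAt]
  ext u w
  exact hinv e he h (f p) hp _ _

end TwistedPrincipalBundle

end LocalTrivialization

section TrivializedChart

variable {n N : ℕ}
variable {B : Type*} [TopologicalSpace B] {M : Type*} [TopologicalSpace M]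
variable {𝒢 : Type*} [TopologicalSpace 𝒢]
variable {proj : M → B}

/-- The product coordinates on `M` given by a local trivialization and by charts of the base and of
the fiber. -/
def trivChart (e : Trivialization 𝒢 proj) (φ : OpenPartialHomeomorph B (Coord (Fin n)))
    (ψ : OpenPartialHomeomorph 𝒢 (Coord (Fin N))) :
    OpenPartialHomeomorph M (Coord (Fin n) × Coord (Fin N)) :=
  e.toOpenPartialHomeomorph.trans (φ.prod ψ)

variable {e : Trivialization 𝒢 proj} {φ : OpenPartialHomeomorph B (Coord (Fin n))}
  {ψ : OpenPartialHomeomorph 𝒢 (Coord (Fin N))}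

lemma trivChart_symm_apply (p : Coord (Fin n) × Coord (Fin N)) :
    (trivChart e φ ψ).symm p = fiberIncl e (φ.symm p.1) (ψ.symm p.2) := rfl

lemma mem_trivChart_target {p : Coord (Fin n) × Coord (Fin N)} :
    p ∈ (trivChart e φ ψ).target ↔
      p.1 ∈ φ.target ∧ φ.symm p.1 ∈ e.baseSet ∧ p.2 ∈ ψ.target := by
  have hbase : (φ.symm p.1, ψ.symm p.2) ∈ e.target ↔ φ.symm p.1 ∈ e.baseSet := e.mem_target
  simp only [trivChart, OpenPartialHomeomorph.trans_target, OpenPartialHomeomorph.prod_target,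
    mem_inter_iff, mem_prod, mem_preimage, OpenPartialHomeomorph.prod_symm_apply, hbase]
  tauto

variable [ChartedSpace (Coord (Fin n)) B] [ChartedSpace (Coord (Fin n ⊕ Fin N)) M]
  [CommGroup 𝒢] [ChartedSpace (Coord (Fin N)) 𝒢]
variable (P : TwistedPrincipalBundle (n := n) (N := N) 𝒢 proj) (he : e ∈ P.atlas)
  (hφ : φ ∈ charts (Fin n) B)

include P he hφ

lemma contMDiffOn_trivChart (hψ : ψ ∈ charts (Fin N) 𝒢) :
    ContMDiffOn 𝓘(ℝ, Coord (Fin n ⊕ Fin N)) 𝓘(ℝ, Coord (Fin n) × Coord (Fin N)) ∞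
      (trivChart e φ ψ) (trivChart e φ ψ).source := by
  rintro p ⟨hp, hp₁, hp₂⟩
  have hbase := ContMDiffAt.comp p (g := φ) (f := fun q => (e q).1)
    (contMDiffAt_of_mem_maximalAtlas hφ hp₁) (P.contMDiffAt he hp).fst
  have hfiber := ContMDiffAt.comp p (g := ψ) (f := fun q => (e q).2)
    (contMDiffAt_of_mem_maximalAtlas hψ hp₂) (P.contMDiffAt he hp).snd
  exact (hbase.prodMk_space hfiber).contMDiffWithinAt

lemma contMDiffOn_trivChart_symm (hψ : ψ ∈ charts (Fin N) 𝒢) :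
    ContMDiffOn 𝓘(ℝ, Coord (Fin n) × Coord (Fin N)) 𝓘(ℝ, Coord (Fin n ⊕ Fin N)) ∞
      (trivChart e φ ψ).symm (trivChart e φ ψ).target := by
  intro p hp
  obtain ⟨hp₁, hb, hp₂⟩ := mem_trivChart_target.1 hp
  have hbase := ContMDiffAt.comp p (contMDiffAt_symm_of_mem_maximalAtlas hφ hp₁)
    contDiff_fst.contMDiff.contMDiffAt
  have hfiber := ContMDiffAt.comp p (contMDiffAt_symm_of_mem_maximalAtlas hψ hp₂)
    contDiff_snd.contMDiff.contMDiffAt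
  exact (ContMDiffAt.comp p (g := e.toOpenPartialHomeomorph.symm)
    (P.contMDiffAt_symm he hb _) (hbase.prodMk hfiber)).contMDiffWithinAt

lemma mdifferentiable_trivChart (hψ : ψ ∈ charts (Fin N) 𝒢) : (trivChart e φ ψ).MDifferentiable
    𝓘(ℝ, Coord (Fin n ⊕ Fin N)) 𝓘(ℝ, Coord (Fin n) × Coord (Fin N)) :=
  ⟨(contMDiffOn_trivChart P he hφ hψ).mdifferentiableOn (by simp),
    (contMDiffOn_trivChart_symm P he hφ hψ).mdifferentiableOn (by simp)⟩

lemma mdifferentiableAt_trivChart_symm (hψ : ψ ∈ charts (Fin N) 𝒢)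
    {p : Coord (Fin n) × Coord (Fin N)} (hp : p ∈ (trivChart e φ ψ).target) :
    MDifferentiableAt 𝓘(ℝ, Coord (Fin n) × Coord (Fin N)) 𝓘(ℝ, Coord (Fin n ⊕ Fin N))
      (trivChart e φ ψ).symm p :=
  (mdifferentiable_trivChart P he hφ hψ).symm.mdifferentiableAt hp

end TrivializedChart

section MetricInTrivializedChart

variable {n N : ℕ}
variable {B : Type*} [TopologicalSpace B] [ChartedSpace (Coord (Fin n)) B]
variable {M : Type*} [TopologicalSpace M] [ChartedSpace (Coord (Fin n ⊕ Fin N)) M]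
variable {𝒢 : Type*} [CommGroup 𝒢] [TopologicalSpace 𝒢] [ChartedSpace (Coord (Fin N)) 𝒢]
variable {proj : M → B}
variable {e : Trivialization 𝒢 proj} {φ : OpenPartialHomeomorph B (Coord (Fin n))}
  {ψ : OpenPartialHomeomorph 𝒢 (Coord (Fin N))}

section

variable (P : TwistedPrincipalBundle (n := n) (N := N) 𝒢 proj) (he : e ∈ P.atlas)
  (hφ : φ ∈ charts (Fin n) B)

include P he hφ

lemma derivCoord_proj_trivChart_symm (hψ : ψ ∈ charts (Fin N) 𝒢)
    {p : Coord (Fin n) × Coord (Fin N)} (hp : p ∈ (trivChart e φ ψ).target)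
    (u : Coord (Fin n) × Coord (Fin N)) :
    derivCoord (Fin n) (Coord (Fin n ⊕ Fin N)) proj ((trivChart e φ ψ).symm p)
        (derivCoord (Fin n ⊕ Fin N) (Coord (Fin n) × Coord (Fin N))
          (trivChart e φ ψ).symm p u) =
      derivCoord (Fin n) (Coord (Fin n)) φ.symm p.1 u.1 := by
  obtain ⟨hp₁, hb, -⟩ := mem_trivChart_target.1 hp
  have hproj : proj ∘ (trivChart e φ ψ).symm =ᶠ[𝓝 p] φ.symm ∘ Prod.fst := by
    filter_upwards [(trivChart e φ ψ).open_target.mem_nhds hp] with q hq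
    exact proj_fiberIncl (mem_trivChart_target.1 hq).2.1 _
  have hleft := derivCoord_comp (f := proj) (k := (trivChart e φ ψ).symm)
    ((P.contMDiffAt_proj he (fiberIncl_mem_source hb (ψ.symm p.2))).mdifferentiableAt (by simp))
    (mdifferentiableAt_trivChart_symm P he hφ hψ hp).hasMFDerivAt
  have hright := derivCoord_comp
    ((mdifferentiable_of_mem_charts hφ).mdifferentiableAt_symm hp₁)
    (k := Prod.fst) (hasFDerivAt_fst (𝕜 := ℝ) (p := p)).hasMFDerivAt
  exact DFunLike.congr_fun (hleft.symm.trans ((derivCoord_congr hproj).trans hright)) u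

variable (hψ : IsLogChart ψ) {y : Coord (Fin n)} (hy : y ∈ φ.target) (hb : φ.symm y ∈ e.baseSet)

include hψ hy hb

lemma derivCoord_trivChart_symm_fiber (w : Coord (Fin N)) :
    derivCoord (Fin n ⊕ Fin N) (Coord (Fin n) × Coord (Fin N)) (trivChart e φ ψ).symm (y, 0)
        (0, w) =
      derivCoord (Fin n ⊕ Fin N) (Coord (Fin N)) (fiberIncl e (φ.symm y)) 1 w := by
  have hleft := derivCoord_comp (k := fun w => (y, w)) (p := (0 : Coord (Fin N)))
    (mdifferentiableAt_trivChart_symm P he hφ hψ.mem_maximalAtlas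
      (mem_trivChart_target.2 ⟨hy, hb, hψ.zero_mem_target⟩))
    (hasFDerivAt_prodMk_right y 0).hasMFDerivAt
  have hright := derivCoord_comp (ι := Fin n ⊕ Fin N) (f := fiberIncl e (φ.symm y))
    ((P.contMDiffAt_fiberIncl he hb _).mdifferentiableAt (by simp)) hψ.hasMFDerivAt_symm
  rw [hψ.symm_zero] at hright
  exact DFunLike.congr_fun (hleft.symm.trans hright) w

lemma derivCoord_trivChart_symm_base (u : Coord (Fin n)) :
    derivCoord (Fin n ⊕ Fin N) (Coord (Fin n) × Coord (Fin N)) (trivChart e φ ψ).symm (y, 0)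
        (u, 0) =
      derivCoord (Fin n ⊕ Fin N) (Coord (Fin n)) (localSection e) (φ.symm y)
        (derivCoord (Fin n) (Coord (Fin n)) φ.symm y u) := by
  have hsection : (trivChart e φ ψ).symm ∘ (fun z => (z, 0)) = localSection e ∘ φ.symm := by
    funext z
    exact congrArg (fiberIncl e (φ.symm z)) hψ.symm_zero
  have hleft := derivCoord_comp (k := fun z => (z, (0 : Coord (Fin N))))
    (mdifferentiableAt_trivChart_symm P he hφ hψ.mem_maximalAtlas
      (mem_trivChart_target.2 ⟨hy, hb, hψ.zero_mem_target⟩))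
    (hasFDerivAt_prodMk_left y 0).hasMFDerivAt
  have hright := derivCoord_comp
    ((P.contMDiffAt_localSection he hb).mdifferentiableAt (by simp))
    ((mdifferentiable_of_mem_charts hφ).mdifferentiableAt_symm hy).hasMFDerivAt
  rw [hsection] at hleft
  exact DFunLike.congr_fun (hleft.symm.trans hright) u

end

variable [LieGroup 𝓘(ℝ, Coord (Fin N)) ∞ 𝒢] [IsManifold 𝓘(ℝ, Coord (Fin n ⊕ Fin N)) ∞ M]
variable {P : TwistedPrincipalBundle (n := n) (N := N) 𝒢 proj} (he : e ∈ P.atlas)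
  (hφ : φ ∈ charts (Fin n) B) (hψ : IsLogChart ψ) {gM : Metric (Fin n ⊕ Fin N) M}

include he hφ hψ

/-- In a log chart, the action of `ψ.symm w` is the translation by `w`, so invariance removes the
dependence on the fiber coordinates. -/
lemma pullForm_trivChart_symm (hinv : P.IsInvariantMetric gM) {y : Coord (Fin n)}
    {w : Coord (Fin N)} (hp : (y, w) ∈ (trivChart e φ ψ).target) :
    pullForm (Coord (Fin n) × Coord (Fin N)) gM (trivChart e φ ψ).symm (y, w) =
      pullForm (Coord (Fin n) × Coord (Fin N)) gM (trivChart e φ ψ).symm (y, 0) := by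
  obtain ⟨hy, hb, hw⟩ := mem_trivChart_target.1 hp
  have htranslate : localAct e (ψ.symm w)⁻¹ ∘ (trivChart e φ ψ).symm =ᶠ[𝓝 (y, w)]
      (trivChart e φ ψ).symm ∘ fun q => q - (0, w) := by
    filter_upwards [(trivChart e φ ψ).open_target.mem_nhds hp,
      continuousAt_snd.eventually (hψ.symm_sub w hw)] with q hq hqw
    rw [Function.comp_apply, Function.comp_apply, trivChart_symm_apply, trivChart_symm_apply,
      localAct_fiberIncl (mem_trivChart_target.1 hq).2.1, hqw, inv_mul_cancel_left, Prod.fst_sub,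
      Prod.snd_sub, sub_zero]
  have hsub : (y, w) - (0, w) = (y, 0) := by simp
  have hshift : HasMFDerivAt 𝓘(ℝ, Coord (Fin n) × Coord (Fin N))
      𝓘(ℝ, Coord (Fin n) × Coord (Fin N)) (fun q => q - (0, w)) (y, w)
      (ContinuousLinearMap.id ℝ _) := ((hasFDerivAt_id _).sub_const _).hasMFDerivAt
  have hdiff := fun {p} =>
    mdifferentiableAt_trivChart_symm (p := p) P he hφ hψ.mem_maximalAtlas
  rw [← TwistedPrincipalBundle.pullForm_localAct hinv he (ψ.symm w)⁻¹ (hdiff hp)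
      (fiberIncl_mem_source hb _), pullForm_congr gM htranslate, pullForm_comp gM
      (hdiff (hsub ▸ mem_trivChart_target.2 ⟨hy, hb, hψ.zero_mem_target⟩)) hshift, hsub]
  rfl

end MetricInTrivializedChart

section AdaptedChart

lemma gram_eq_blockMetric {ι κ : Type} [Fintype κ] {V : Type*} [AddCommGroup V] [Module ℝ V]
    {Q : LinearMap.BilinForm ℝ V} (hQ : Q.IsSymm) {h : ι → V} {v : κ → V}
    (horth : ∀ α J, Q (h α) (v J) = 0) {g : Matrix ι ι ℝ} (hg : ∀ α β, Q (h α) (h β) = g α β)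
    {G : Matrix κ κ ℝ} (hG : ∀ I J, Q (v I) (v J) = G I J) (A : Matrix κ ι ℝ) :
    (Matrix.of fun k l => Q (Sum.elim (fun α => h α + ∑ I, A I α • v I) v k)
      (Sum.elim (fun α => h α + ∑ I, A I α • v I) v l)) = blockMetric g G A := by
  have horth' : ∀ J α, Q (v J) (h α) = 0 := fun J α => (hQ.eq _ _).symm.trans (horth α J)
  ext (α | I) (β | J)
  · simp only [Matrix.of_apply, Sum.elim_inl, map_add, map_sum, map_smul, LinearMap.add_apply,
      LinearMap.coe_sum, LinearMap.coe_smul, Finset.sum_apply, Pi.smul_apply, smul_eq_mul, hg, hG,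
      horth, horth', mul_zero, Finset.sum_const_zero, add_zero, zero_add, Finset.mul_sum,
      blockMetric, Matrix.fromBlocks_apply₁₁, Matrix.add_apply, Matrix.mul_apply,
      Matrix.transpose_apply, Finset.sum_mul, mul_assoc, add_right_inj]
    exact Finset.sum_congr rfl fun I _ => Finset.sum_congr rfl fun J _ => by ring
  · simp [blockMetric, horth, hG, Matrix.mul_apply]
  · simp [blockMetric, horth', hG, Matrix.mul_apply, mul_comm]
  · simp [blockMetric, hG]

variable {n N : ℕ}
variable {B : Type*} [TopologicalSpace B] {M : Type*} [TopologicalSpace M]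
variable {𝒢 : Type*} [TopologicalSpace 𝒢]
variable {proj : M → B}

/-- The coordinates on `M` obtained from product coordinates by passing to the basis `v` in the
fibers and shearing by the matrix `a`. Shearing by the value of the connection at a point makes the
connection vanish at that point. -/
def adaptedChart (e : Trivialization 𝒢 proj) (φ : OpenPartialHomeomorph B (Coord (Fin n)))
    (ψ : OpenPartialHomeomorph 𝒢 (Coord (Fin N))) (v : Module.Basis (Fin N) ℝ (Coord (Fin N)))
    (a : Matrix (Fin N) (Fin n) ℝ) : OpenPartialHomeomorph M (Coord (Fin n ⊕ Fin N)) :=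
  (trivChart e φ ψ).transHomeomorph (shearEquiv v a).toHomeomorph

variable {e : Trivialization 𝒢 proj} {φ : OpenPartialHomeomorph B (Coord (Fin n))}
  {ψ : OpenPartialHomeomorph 𝒢 (Coord (Fin N))} (v : Module.Basis (Fin N) ℝ (Coord (Fin N)))
  (a : Matrix (Fin N) (Fin n) ℝ)

lemma shearEquiv_mem_adaptedChart_target {p : Coord (Fin n) × Coord (Fin N)} :
    shearEquiv v a p ∈ (adaptedChart e φ ψ v a).target ↔ p ∈ (trivChart e φ ψ).target := by
  change (shearEquiv v a).symm (shearEquiv v a p) ∈ (trivChart e φ ψ).target ↔ _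
  rw [ContinuousLinearEquiv.symm_apply_apply]

variable [ChartedSpace (Coord (Fin n)) B] [ChartedSpace (Coord (Fin n ⊕ Fin N)) M]
  [CommGroup 𝒢] [ChartedSpace (Coord (Fin N)) 𝒢]
variable {P : TwistedPrincipalBundle (n := n) (N := N) 𝒢 proj} (he : e ∈ P.atlas)
  (hφ : φ ∈ charts (Fin n) B)

include he hφ

lemma adaptedChart_mem_charts [IsManifold 𝓘(ℝ, Coord (Fin n ⊕ Fin N)) ∞ M]
    (hψ : ψ ∈ charts (Fin N) 𝒢) : adaptedChart e φ ψ v a ∈ charts (Fin n ⊕ Fin N) M := by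
  refine OpenPartialHomeomorph.mem_maximalAtlas_of_contMDiffOn _ ?_ ?_
  · exact (shearEquiv v a).contDiff.contMDiff.comp_contMDiffOn
      (contMDiffOn_trivChart P he hφ hψ)
  · exact (contMDiffOn_trivChart_symm P he hφ hψ).comp
      (shearEquiv v a).symm.contDiff.contMDiff.contMDiffOn fun _ hz => hz

variable [IsManifold 𝓘(ℝ, Coord (Fin n ⊕ Fin N)) ∞ M] (gM : Metric (Fin n ⊕ Fin N) M)

lemma metricCoeff_adaptedChart_apply (hψ : ψ ∈ charts (Fin N) 𝒢)
    {p : Coord (Fin n) × Coord (Fin N)} (hp : p ∈ (trivChart e φ ψ).target)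
    (k l : Fin n ⊕ Fin N) :
    metricCoeff gM (adaptedChart e φ ψ v a) (shearEquiv v a p) k l =
      pullForm (Coord (Fin n) × Coord (Fin N)) gM (trivChart e φ ψ).symm p
        ((shearEquiv v a).symm (EuclideanSpace.single k 1))
        ((shearEquiv v a).symm (EuclideanSpace.single l 1)) := by
  have hsymm := (shearEquiv v a).symm_apply_apply p
  have hcomp := pullForm_comp gM (k := (shearEquiv v a).symm) (p := shearEquiv v a p)
    (by rw [hsymm]; exact mdifferentiableAt_trivChart_symm P he hφ hψ hp)
    (shearEquiv v a).symm.hasFDerivAt.hasMFDerivAt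
  rw [hsymm] at hcomp
  exact LinearMap.congr_fun₂ hcomp _ _

end AdaptedChart

section AdaptedMetric

variable {n N : ℕ}
variable {B : Type*} [TopologicalSpace B]
variable {M : Type*} [TopologicalSpace M] [ChartedSpace (Coord (Fin n ⊕ Fin N)) M]
  [IsManifold 𝓘(ℝ, Coord (Fin n ⊕ Fin N)) ∞ M]
variable {𝒢 : Type*} [CommGroup 𝒢] [TopologicalSpace 𝒢] [ChartedSpace (Coord (Fin N)) 𝒢]
variable {proj : M → B}
variable (gM : Metric (Fin n ⊕ Fin N) M) (e : Trivialization 𝒢 proj)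
  (v : Module.Basis (Fin N) ℝ (Coord (Fin N))) (φ : OpenPartialHomeomorph B (Coord (Fin n)))

/-- The fiberwise inner product `G` on the Lie algebra of `𝒢`, as a bilinear form. -/
def fiberForm (b : B) : LinearMap.BilinForm ℝ (Coord (Fin N)) :=
  pullForm (Coord (Fin N)) gM (fiberIncl e b) 1

lemma isSymm_matG (y : Coord (Fin n)) : (matG gM e v φ y).IsSymm :=
  Matrix.IsSymm.ext fun _ _ => gM.symm _ _ _

lemma matG_eq_toMatrix (y : Coord (Fin n)) :
    matG gM e v φ y = LinearMap.BilinForm.toMatrix v (fiberForm gM e (φ.symm y)) := by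
  ext I J
  rw [LinearMap.BilinForm.toMatrix_apply]
  rfl

variable [ChartedSpace (Coord (Fin n)) B]

/-- The matrix `(A^I_α)` of the connection. -/
def connMat (y : Coord (Fin n)) : Matrix (Fin N) (Fin n) ℝ :=
  Matrix.of fun I α => connA gM e v φ I α y

/-- The matrix of the inner products of the vertical vectors `∂_J` with the coordinate vectors
`∂_α` along the local section. -/
def mixedMat (y : Coord (Fin n)) : Matrix (Fin N) (Fin n) ℝ :=
  Matrix.of fun J α => gM.inner (localSection e (φ.symm y))
    (mfderiv 𝓘(ℝ, Coord (Fin n)) 𝓘(ℝ, Coord (Fin n ⊕ Fin N)) (localSection e) (φ.symm y)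
      (coordVec φ y α))
    (vertVec e (φ.symm y) (v J))

lemma connMat_eq_inv_mul (y : Coord (Fin n)) :
    connMat gM e v φ y = (matG gM e v φ y)⁻¹ * mixedMat gM e v φ y := rfl

/-- The metric of `M` in product coordinates, along the local section. -/
def productForm (ψ : OpenPartialHomeomorph 𝒢 (Coord (Fin N))) (y : Coord (Fin n)) :
    LinearMap.BilinForm ℝ (Coord (Fin n) × Coord (Fin N)) :=
  pullForm (Coord (Fin n) × Coord (Fin N)) gM (trivChart e φ ψ).symm (y, 0)

/-- The horizontal lift `∂_α - A^I_α ∂_I` of the coordinate vector `∂_α`, in product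
coordinates. -/
def horizLift (y : Coord (Fin n)) (α : Fin n) : Coord (Fin n) × Coord (Fin N) :=
  (EuclideanSpace.single α 1, -∑ I, connMat gM e v φ y I α • v I)

variable {e φ}
variable {P : TwistedPrincipalBundle (n := n) (N := N) 𝒢 proj} (he : e ∈ P.atlas)

include he

lemma posDef_matG {y : Coord (Fin n)} (hb : φ.symm y ∈ e.baseSet) :
    (matG gM e v φ y).PosDef := by
  rw [matG_eq_toMatrix, fiberForm,
    ← LinearMap.BilinForm.posDef_toQuadraticMap_iff_matrix _ _ (isSymm_pullForm _ _ _)]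
  exact posDef_pullForm gM (P.injective_derivCoord_fiberIncl he hb)

lemma matG_mul_connMat {y : Coord (Fin n)} (hb : φ.symm y ∈ e.baseSet) :
    matG gM e v φ y * connMat gM e v φ y = mixedMat gM e v φ y := by
  have hdet : IsUnit (matG gM e v φ y).det := (posDef_matG gM v he hb).det_pos.ne'.isUnit
  rw [connMat_eq_inv_mul, Matrix.mul_nonsing_inv_cancel_left _ _ hdet]

variable {ψ : OpenPartialHomeomorph 𝒢 (Coord (Fin N))} (hφ : φ ∈ charts (Fin n) B)
  (hψ : IsLogChart ψ) {y : Coord (Fin n)} (hy : y ∈ φ.target) (hb : φ.symm y ∈ e.baseSet)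

include hφ hψ hy hb

lemma productForm_inr_inr (I J : Fin N) :
    productForm gM e φ ψ y (0, v I) (0, v J) = matG gM e v φ y I J := by
  rw [productForm, pullForm_apply, derivCoord_trivChart_symm_fiber P he hφ hψ hy hb,
    derivCoord_trivChart_symm_fiber P he hφ hψ hy hb]
  exact congrArg (fun p => innerCoord gM p _ _) (congrArg (fiberIncl e _) hψ.symm_zero)

lemma productForm_inl_inr (α : Fin n) (J : Fin N) :
    productForm gM e φ ψ y (EuclideanSpace.single α 1, 0) (0, v J) =
      mixedMat gM e v φ y J α := by
  rw [productForm, pullForm_apply, derivCoord_trivChart_symm_base P he hφ hψ hy hb,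
    derivCoord_trivChart_symm_fiber P he hφ hψ hy hb]
  exact congrArg (fun p => innerCoord gM p _ _) (congrArg (fiberIncl e _) hψ.symm_zero)

lemma productForm_horizLift_inr (α : Fin n) (w : Coord (Fin N)) :
    productForm gM e φ ψ y (horizLift gM e v φ y α) (0, w) = 0 := by
  have hbasis (J : Fin N) : productForm gM e φ ψ y (horizLift gM e v φ y α) (0, v J) = 0 := by
    have hlift : horizLift gM e v φ y α = (EuclideanSpace.single α 1, 0) -
        ∑ I, connMat gM e v φ y I α • ((0, v I) : Coord (Fin n) × Coord (Fin N)) := by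
      ext <;> simp [horizLift, Prod.fst_sum, Prod.snd_sum]
    rw [hlift, map_sub, LinearMap.sub_apply, productForm_inl_inr gM v he hφ hψ hy hb,
      ← matG_mul_connMat gM v he hb, Matrix.mul_apply, sub_eq_zero]
    simp only [map_sum, LinearMap.sum_apply, map_smul, LinearMap.smul_apply, smul_eq_mul,
      productForm_inr_inr gM v he hφ hψ hy hb, (isSymm_matG gM e v φ y).apply J, mul_comm]
  have hzero : (productForm gM e φ ψ y (horizLift gM e v φ y α)).comp
      (LinearMap.inr ℝ (Coord (Fin n)) (Coord (Fin N))) = 0 := v.ext hbasis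
  exact LinearMap.congr_fun hzero w

lemma productForm_horizLift_horizLift [IsManifold 𝓘(ℝ, Coord (Fin n)) ∞ B]
    {gB : Metric (Fin n) B} (hsub : IsRiemannianSubmersion proj gM gB) (α β : Fin n) :
    productForm gM e φ ψ y (horizLift gM e v φ y α) (horizLift gM e v φ y β) =
      metricCoeff gB φ y α β := by
  have hp : (y, (0 : Coord (Fin N))) ∈ (trivChart e φ ψ).target :=
    mem_trivChart_target.2 ⟨hy, hb, hψ.zero_mem_target⟩
  have hproj := derivCoord_proj_trivChart_symm P he hφ hψ.mem_maximalAtlas hp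
  have hvert (z : Coord (Fin n ⊕ Fin N)) (hz : derivCoord (Fin n) (Coord (Fin n ⊕ Fin N)) proj
      ((trivChart e φ ψ).symm (y, 0)) z = 0) : ∃ w, derivCoord (Fin n ⊕ Fin N)
        (Coord (Fin n) × Coord (Fin N)) (trivChart e φ ψ).symm (y, 0) (0, w) = z := by
    obtain ⟨⟨u, w⟩, rfl⟩ := (mdifferentiable_trivChart P he hφ
      hψ.mem_maximalAtlas).symm.mfderiv_surjective hp z
    have hu : u = 0 := (mdifferentiable_of_mem_charts hφ).symm.mfderiv_injective hy
      (((hproj (u, w)).symm.trans hz).trans (map_zero _).symm)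
    exact ⟨w, by rw [hu]; rfl⟩
  have horth (γ : Fin n) (z) (hz : derivCoord (Fin n) (Coord (Fin n ⊕ Fin N)) proj
      ((trivChart e φ ψ).symm (y, 0)) z = 0) : innerCoord gM ((trivChart e φ ψ).symm (y, 0))
        (derivCoord (Fin n ⊕ Fin N) (Coord (Fin n) × Coord (Fin N)) (trivChart e φ ψ).symm (y, 0)
          (horizLift gM e v φ y γ)) z = 0 := by
    obtain ⟨w, rfl⟩ := hvert z hz
    exact productForm_horizLift_inr gM v he hφ hψ hy hb γ w
  have hbase : proj ((trivChart e φ ψ).symm (y, 0)) = φ.symm y := proj_fiberIncl hb _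
  refine (hsub _ _ _ fun z hz => ⟨horth α z hz, horth β z hz⟩).trans ?_
  change innerCoord gB _ (derivCoord (Fin n) (Coord (Fin n ⊕ Fin N)) proj _ (derivCoord _ _ _ _ _))
    (derivCoord (Fin n) (Coord (Fin n ⊕ Fin N)) proj _ (derivCoord _ _ _ _ _)) = _
  rw [hproj, hproj, hbase]
  rfl

end AdaptedMetric

section VerticalRicci

variable {n N : ℕ}
variable {B : Type*} [TopologicalSpace B] [ChartedSpace (Coord (Fin n)) B]
variable {M : Type*} [TopologicalSpace M] [ChartedSpace (Coord (Fin n ⊕ Fin N)) M]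
  [IsManifold 𝓘(ℝ, Coord (Fin n ⊕ Fin N)) ∞ M]
variable {𝒢 : Type*} [CommGroup 𝒢] [TopologicalSpace 𝒢] [ChartedSpace (Coord (Fin N)) 𝒢]
variable {proj : M → B} {P : TwistedPrincipalBundle (n := n) (N := N) 𝒢 proj}
variable {e : Trivialization 𝒢 proj} {φ : OpenPartialHomeomorph B (Coord (Fin n))}
  (gM : Metric (Fin n ⊕ Fin N) M) (v : Module.Basis (Fin N) ℝ (Coord (Fin N)))
variable (he : e ∈ P.atlas) (hφ : φ ∈ charts (Fin n) B) {y : Coord (Fin n)} (hy : y ∈ φ.target)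
  (hb : φ.symm y ∈ e.baseSet)

section Smoothness

include hy hb in
omit [ChartedSpace (Coord (Fin n)) B] [CommGroup 𝒢] in
lemma eventually_mem_target_baseSet : ∀ᶠ z in 𝓝 y, z ∈ φ.target ∧ φ.symm z ∈ e.baseSet :=
  (φ.open_target.eventually_mem hy).and
    ((φ.continuousAt_symm hy).eventually (e.open_baseSet.mem_nhds hb))

include he hφ hy hb

lemma contDiffAt_productForm {ψ : OpenPartialHomeomorph 𝒢 (Coord (Fin N))} (hψ : IsLogChart ψ)
    (k l : Fin n ⊕ Fin N) :
    ContDiffAt ℝ ∞ (fun z => productForm gM e φ ψ z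
      ((shearEquiv v 0).symm (EuclideanSpace.single k 1))
      ((shearEquiv v 0).symm (EuclideanSpace.single l 1))) y := by
  have htarget (z : Coord (Fin n)) (hz : z ∈ φ.target ∧ φ.symm z ∈ e.baseSet) :
      (z, (0 : Coord (Fin N))) ∈ (trivChart e φ ψ).target :=
    mem_trivChart_target.2 ⟨hz.1, hz.2, hψ.zero_mem_target⟩
  have hcoeff : ContDiffAt ℝ ∞ (fun p => metricCoeff gM (adaptedChart e φ ψ v 0) p k l)
      (shearEquiv v 0 (y, 0)) :=
    smoothMatAt_metricCoeff gM (adaptedChart_mem_charts v 0 he hφ hψ.mem_maximalAtlas)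
      ((shearEquiv_mem_adaptedChart_target v 0).2 (htarget y ⟨hy, hb⟩)) k l
  refine (hcoeff.comp y (contDiff_shearEquiv_prodMk v 0 0).contDiffAt).congr_of_eventuallyEq ?_
  filter_upwards [eventually_mem_target_baseSet hy hb] with z hz
  exact (metricCoeff_adaptedChart_apply v 0 he hφ gM hψ.mem_maximalAtlas (htarget z hz) k l).symm

variable [LieGroup 𝓘(ℝ, Coord (Fin N)) ∞ 𝒢]

lemma smoothMatAt_matG : SmoothMatAt (matG gM e v φ) y := by
  obtain ⟨ψ, hψ⟩ := exists_isLogChart (Coord (Fin N)) 𝒢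
  intro I J
  refine (contDiffAt_productForm gM v he hφ hy hb hψ (Sum.inr I) (Sum.inr J)).congr_of_eventuallyEq
    ?_
  filter_upwards [eventually_mem_target_baseSet hy hb] with z hz
  rw [shearEquiv_symm_single_inr, shearEquiv_symm_single_inr,
    productForm_inr_inr gM v he hφ hψ hz.1 hz.2]

lemma smoothMatAt_mixedMat : SmoothMatAt (mixedMat gM e v φ) y := by
  obtain ⟨ψ, hψ⟩ := exists_isLogChart (Coord (Fin N)) 𝒢
  intro J α
  refine (contDiffAt_productForm gM v he hφ hy hb hψ (Sum.inl α) (Sum.inr J)).congr_of_eventuallyEq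
    ?_
  filter_upwards [eventually_mem_target_baseSet hy hb] with z hz
  have hzero : (-∑ I, (0 : Matrix (Fin N) (Fin n) ℝ) I α • v I) = 0 := by simp
  rw [shearEquiv_symm_single_inl, shearEquiv_symm_single_inr, hzero,
    productForm_inl_inr gM v he hφ hψ hz.1 hz.2]

lemma smoothMatAt_connMat : SmoothMatAt (connMat gM e v φ) y :=
  ((smoothMatAt_matG gM v he hφ hy hb).inv (posDef_matG gM v he hb).det_pos.ne').mul
    (smoothMatAt_mixedMat gM v he hφ hy hb)

end Smoothness

variable [IsManifold 𝓘(ℝ, Coord (Fin n)) ∞ B] [LieGroup 𝓘(ℝ, Coord (Fin N)) ∞ 𝒢]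
variable {gM} {gB : Metric (Fin n) B} (hinv : P.IsInvariantMetric gM)
  (hsub : IsRiemannianSubmersion proj gM gB)

include he hφ hinv hsub

lemma metricCoeff_adaptedChart (a : Matrix (Fin N) (Fin n) ℝ)
    {ψ : OpenPartialHomeomorph 𝒢 (Coord (Fin N))} (hψ : IsLogChart ψ)
    {z : Coord (Fin n ⊕ Fin N)} (hz : z ∈ (adaptedChart e φ ψ v a).target) :
    metricCoeff gM (adaptedChart e φ ψ v a) z =
      blockMetric (metricCoeff gB φ (baseProj _ _ z)) (matG gM e v φ (baseProj _ _ z))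
        (connMat gM e v φ (baseProj _ _ z) - a) := by
  obtain ⟨⟨y, w⟩, rfl⟩ := (shearEquiv v a).surjective z
  have hp := (shearEquiv_mem_adaptedChart_target v a).1 hz
  obtain ⟨hy, hb, -⟩ := mem_trivChart_target.1 hp
  have hframe (k : Fin n ⊕ Fin N) : (shearEquiv v a).symm (EuclideanSpace.single k 1) =
      Sum.elim (fun α => horizLift gM e v φ y α + ∑ I, (connMat gM e v φ y - a) I α • (0, v I))
        (fun I => (0, v I)) k := by
    rcases k with α | I
    · rw [shearEquiv_symm_single_inl]
      ext
      · simp [horizLift, Prod.fst_sum]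
      · simp [horizLift, Prod.snd_sum, sub_mul]; ring
    · rw [shearEquiv_symm_single_inr, Sum.elim_inr]
  rw [baseProj_shearEquiv, ← gram_eq_blockMetric (isSymm_pullForm gM _ _)
    (fun α J => productForm_horizLift_inr gM v he hφ hψ hy hb α (v J))
    (productForm_horizLift_horizLift gM v he hφ hψ hy hb hsub)
    (productForm_inr_inr gM v he hφ hψ hy hb)]
  ext k l
  rw [metricCoeff_adaptedChart_apply v a he hφ gM hψ.mem_maximalAtlas hp,
    pullForm_trivChart_symm he hφ hψ hinv hp, Matrix.of_apply, hframe, hframe]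

include hy hb

theorem fiberRicci_eq_smul_of_isEinstein {lam : ℝ} (hE : IsEinstein gM lam) :
    fiberRicci (metricCoeff gB φ) (matG gM e v φ) (fun α β I => curvF gM e v φ I α β y) y =
      lam • matG gM e v φ y := by
  obtain ⟨ψ, hψ⟩ := exists_isLogChart (Coord (Fin N)) 𝒢
  set a := connMat gM e v φ y
  have hz : shearEquiv v a (y, 0) ∈ (adaptedChart e φ ψ v a).target :=
    (shearEquiv_mem_adaptedChart_target v a).2
      (mem_trivChart_target.2 ⟨hy, hb, hψ.zero_mem_target⟩)
  have hmetric := fun {z} => metricCoeff_adaptedChart v he hφ hinv hsub a hψ (z := z)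
  have hadapted : IsAdaptedAt (metricCoeff gB φ) (matG gM e v φ)
      (fun z => connMat gM e v φ z - a) y :=
    { smooth_base := smoothMatAt_metricCoeff gB hφ hy
      smooth_fiber := smoothMatAt_matG gM v he hφ hy hb
      smooth_conn := fun I α =>
        (smoothMatAt_connMat gM v he hφ hy hb I α).sub contDiffAt_const
      symm_base := Eventually.of_forall (isSymm_metricCoeff gB φ)
      symm_fiber := Eventually.of_forall (isSymm_matG gM e v φ)
      det_base_ne_zero := (posDef_metricCoeff gB hφ hy).det_pos.ne'
      det_fiber_ne_zero := (posDef_matG gM v he hb).det_pos.ne'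
      conn_eq_zero := sub_self a }
  have hcurv : (fun α β => curvature (fun z => connMat gM e v φ z - a) α β y) =
      fun α β I => curvF gM e v φ I α β y := by
    funext α β I
    simp only [curvature, pdMat, Matrix.of_apply, Matrix.sub_apply, pd, fderiv_sub_const]
    rfl
  ext I J
  have hricci := hadapted.ricci_inr_inr (baseProj_shearEquiv v a (y, 0))
    ((adaptedChart e φ ψ v a).open_target.eventually_mem hz |>.mono fun _ => hmetric) I J
  rw [hE _ (adaptedChart_mem_charts v a he hφ hψ.mem_maximalAtlas) _ hz, hmetric hz, blockMetric,
    Matrix.fromBlocks_apply₂₂, baseProj_shearEquiv, hcurv] at hricci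
  exact hricci.symm

end VerticalRicci

section Transport

variable {n N : ℕ}
variable {B : Type*} [TopologicalSpace B] {M : Type*} [TopologicalSpace M]
variable {𝒢 : Type*} [TopologicalSpace 𝒢]
variable {proj : M → B} {e e' e'' : Trivialization 𝒢 proj} {b b' b'' : B}

lemma fiberIncl_transition (hb : b ∈ e.baseSet) (hb' : b ∈ e'.baseSet) (x : 𝒢) :
    fiberIncl e' b (transition e e' b x) = fiberIncl e b x := by
  have hsource : fiberIncl e b x ∈ e'.source := by rwa [e'.mem_source, proj_fiberIncl hb]
  have hpair : e' (fiberIncl e b x) = (b, transition e e' b x) :=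
    Prod.ext ((e'.coe_fst hsource).trans (proj_fiberIncl hb x)) rfl
  rw [fiberIncl, ← hpair]
  exact e'.toOpenPartialHomeomorph.left_inv hsource

variable [ChartedSpace (Coord (Fin n)) B] [ChartedSpace (Coord (Fin n ⊕ Fin N)) M]
  [CommGroup 𝒢] [ChartedSpace (Coord (Fin N)) 𝒢]
variable {P : TwistedPrincipalBundle (n := n) (N := N) 𝒢 proj}

namespace TwistedPrincipalBundle

variable {L L' : Coord (Fin N) →L[ℝ] Coord (Fin N)}

lemma Transport.source_mem (h : P.Transport e b e' b' L) : e ∈ P.atlas ∧ b ∈ e.baseSet := by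
  induction h with
  | refl he hb => exact ⟨he, hb⟩
  | move _ _ ih | change _ _ _ ih => exact ih

lemma Transport.target_mem (h : P.Transport e b e' b' L) : e' ∈ P.atlas ∧ b' ∈ e'.baseSet := by
  induction h with
  | refl he hb => exact ⟨he, hb⟩
  | move _ hb ih => exact ⟨ih.1, hb.target_mem⟩
  | change _ he hb _ => exact ⟨he, hb⟩

lemma Transport.trans (h : P.Transport e b e' b' L) (h' : P.Transport e' b' e'' b'' L') :
    P.Transport e b e'' b'' (L'.comp L) := by
  induction h' with
  | refl _ _ => exact h
  | move _ hb ih => exact ih.move hb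
  | change _ he hb ih => exact ih.change he hb

lemma exists_transport [ConnectedSpace B] (he : e ∈ P.atlas) (hb : b ∈ e.baseSet)
    (he' : e' ∈ P.atlas) (hb' : b' ∈ e'.baseSet) : ∃ L, P.Transport e b e' b' L := by
  have : LocallyPathConnectedSpace B := ChartedSpace.locallyPathConnectedSpace (Coord (Fin n)) B
  let Connected (b b' : B) : Prop := ∀ e ∈ P.atlas, b ∈ e.baseSet → ∀ e' ∈ P.atlas,
    b' ∈ e'.baseSet → ∃ L, P.Transport e b e' b' L
  have hjoined {e₁ b₁ b₂} (he₁ : e₁ ∈ P.atlas) (h : JoinedIn e₁.baseSet b₁ b₂) :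
      Connected b₁ b₂ := fun e he hb e' he' hb' =>
    ⟨_, (((Transport.refl he hb).change he₁ h.source_mem).move h).change he' hb'⟩
  refine PreconnectedSpace.induction₂' Connected (fun b₁ => ?_) ⟨fun b₁ b₂ b₃ h₁₂ h₂₃ => ?_⟩ b b'
    e he hb e' he' hb'
  · obtain ⟨e₁, he₁, hb₁⟩ := P.exists_mem_baseSet b₁
    filter_upwards [pathComponentIn_mem_nhds (e₁.open_baseSet.mem_nhds hb₁)] with b₂ h
    exact ⟨hjoined he₁ h, hjoined he₁ h.symm⟩
  · intro e he hb e' he' hb'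
    obtain ⟨e₂, he₂, hb₂⟩ := P.exists_mem_baseSet b₂
    obtain ⟨_, hL⟩ := h₁₂ e he hb e₂ he₂ hb₂
    obtain ⟨_, hL'⟩ := h₂₃ e₂ he₂ hb₂ e' he' hb'
    exact ⟨_, hL.trans hL'⟩

lemma HolonomyDetPmOne.exists_mul_abs_det_eq_one [ConnectedSpace B] (hol : P.HolonomyDetPmOne)
    (he : e ∈ P.atlas) (hb : b ∈ e.baseSet) (he' : e' ∈ P.atlas) (hb' : b' ∈ e'.baseSet) :
    ∃ c : ℝ, ∀ L, P.Transport e b e' b' L → c * |LinearMap.det L.toLinearMap| = 1 := by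
  obtain ⟨K, hK⟩ := P.exists_transport he' hb' he hb
  refine ⟨|LinearMap.det K.toLinearMap|, fun L hL => ?_⟩
  rw [← abs_mul, ← LinearMap.det_comp]
  exact hol e b _ (hL.trans hK)

lemma HolonomyDetPmOne.abs_det_eq [ConnectedSpace B] (hol : P.HolonomyDetPmOne)
    (h : P.Transport e b e' b' L) (h' : P.Transport e b e' b' L') :
    |LinearMap.det L.toLinearMap| = |LinearMap.det L'.toLinearMap| := by
  obtain ⟨c, hc⟩ := hol.exists_mul_abs_det_eq_one h.source_mem.1 h.source_mem.2 h.target_mem.1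
    h.target_mem.2
  exact mul_left_cancel₀ (left_ne_zero_of_mul_eq_one (hc L h)) ((hc L h).trans (hc L' h').symm)

lemma HolonomyDetPmOne.det_ne_zero [ConnectedSpace B] (hol : P.HolonomyDetPmOne)
    (h : P.Transport e b e' b' L) : LinearMap.det L.toLinearMap ≠ 0 := by
  obtain ⟨c, hc⟩ := hol.exists_mul_abs_det_eq_one h.source_mem.1 h.source_mem.2 h.target_mem.1
    h.target_mem.2
  exact abs_ne_zero.1 (right_ne_zero_of_mul_eq_one (hc L h))

lemma contMDiffAt_transition (P : TwistedPrincipalBundle (n := n) (N := N) 𝒢 proj)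
    (he : e ∈ P.atlas) (he' : e' ∈ P.atlas) (hb : b ∈ e.baseSet) (hb' : b ∈ e'.baseSet) (x : 𝒢) :
    ContMDiffAt 𝓘(ℝ, Coord (Fin N)) 𝓘(ℝ, Coord (Fin N)) ∞ (transition e e' b) x := by
  have hsource : fiberIncl e b x ∈ e'.source := by rwa [e'.mem_source, proj_fiberIncl hb]
  exact (ContMDiffAt.comp x (g := e') (P.contMDiffAt he' hsource)
    (P.contMDiffAt_fiberIncl he hb x)).snd

end TwistedPrincipalBundle

end Transport

section DetG

lemma det_toMatrix_comp_self {V ι : Type*} [AddCommGroup V] [Module ℝ V] [Fintype ι]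
    [DecidableEq ι] (v : Module.Basis ι ℝ V) (Q : LinearMap.BilinForm ℝ V) (L : V →ₗ[ℝ] V) :
    (LinearMap.BilinForm.toMatrix v (Q.comp L L)).det =
      |LinearMap.det L| ^ 2 * (LinearMap.BilinForm.toMatrix v Q).det := by
  rw [LinearMap.BilinForm.toMatrix_comp v v, Matrix.det_mul, Matrix.det_mul,
    Matrix.det_transpose, LinearMap.det_toMatrix, sq_abs]
  ring

variable {n N : ℕ}
variable {B : Type*} [TopologicalSpace B] [ChartedSpace (Coord (Fin n)) B]
variable {M : Type*} [TopologicalSpace M] [ChartedSpace (Coord (Fin n ⊕ Fin N)) M]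
  [IsManifold 𝓘(ℝ, Coord (Fin n ⊕ Fin N)) ∞ M]
variable {𝒢 : Type*} [CommGroup 𝒢] [TopologicalSpace 𝒢] [ChartedSpace (Coord (Fin N)) 𝒢]
  [LieGroup 𝓘(ℝ, Coord (Fin N)) ∞ 𝒢]
variable {proj : M → B} {P : TwistedPrincipalBundle (n := n) (N := N) 𝒢 proj}
variable {e e' e₀ : Trivialization 𝒢 proj} {b b₀ : B} {gM : Metric (Fin n ⊕ Fin N) M}

lemma fiberForm_comp_transitionDeriv (hinv : P.IsInvariantMetric gM) (he : e ∈ P.atlas)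
    (he' : e' ∈ P.atlas) (hb : b ∈ e.baseSet) (hb' : b ∈ e'.baseSet) :
    (fiberForm gM e' b).comp (transitionDeriv e e' b).toLinearMap
      (transitionDeriv e e' b).toLinearMap = fiberForm gM e b := by
  set c := transition e e' b 1
  let k (x : 𝒢) : 𝒢 := c⁻¹ * transition e e' b x
  have hk_one : k 1 = 1 := inv_mul_cancel c
  have hk : HasMFDerivAt 𝓘(ℝ, Coord (Fin N)) 𝓘(ℝ, Coord (Fin N)) k 1 (transitionDeriv e e' b) :=
    ((contMDiffAt_const.mul (P.contMDiffAt_transition he he' hb hb' 1)).mdifferentiableAt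
      (by simp)).hasMFDerivAt
  have hincl : MDifferentiableAt 𝓘(ℝ, Coord (Fin N)) 𝓘(ℝ, Coord (Fin n ⊕ Fin N))
      (fiberIncl e' b) (k 1) :=
    (P.contMDiffAt_fiberIncl he' hb' _).mdifferentiableAt (by simp)
  have hfactor : fiberIncl e b = localAct e' c ∘ fiberIncl e' b ∘ k := by
    funext x
    rw [Function.comp_apply, Function.comp_apply, localAct_fiberIncl hb', mul_inv_cancel_left,
      fiberIncl_transition hb hb']
  rw [fiberForm, fiberForm, hfactor, TwistedPrincipalBundle.pullForm_localAct hinv he' c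
    (hincl.comp 1 hk.mdifferentiableAt) (fiberIncl_mem_source hb' _), pullForm_comp gM hincl hk,
    hk_one]

lemma detG_eq [ConnectedSpace B] (hol : P.HolonomyDetPmOne) (hinv : P.IsInvariantMetric gM)
    (v : Module.Basis (Fin N) ℝ (Coord (Fin N))) {L : Coord (Fin N) →L[ℝ] Coord (Fin N)}
    (h : P.Transport e₀ b₀ e b L) :
    P.detG gM v e₀ b₀ b = |LinearMap.det L.toLinearMap| ^ 2 *
      (LinearMap.BilinForm.toMatrix v (fiberForm gM e b)).det := by
  have hspec : ∃ (e : Trivialization 𝒢 proj) (L : Coord (Fin N) →L[ℝ] Coord (Fin N)),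
      P.Transport e₀ b₀ e b L ∧ P.detG gM v e₀ b₀ b =
        Matrix.det (Matrix.of fun I J => fiberInner gM e b (L (v I)) (L (v J))) :=
    Classical.epsilon_spec (p := fun d : ℝ => ∃ e L, P.Transport e₀ b₀ e b L ∧
      d = Matrix.det (Matrix.of fun I J => fiberInner gM e b (L (v I)) (L (v J)))) ⟨_, e, L, h, rfl⟩
  obtain ⟨e', L', h', hdet⟩ := hspec
  have hmatrix : (Matrix.of fun I J => fiberInner gM e' b (L' (v I)) (L' (v J))) =
      LinearMap.BilinForm.toMatrix v
        ((fiberForm gM e' b).comp L'.toLinearMap L'.toLinearMap) := by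
    ext I J
    rw [LinearMap.BilinForm.toMatrix_apply]
    rfl
  have hpull := fiberForm_comp_transitionDeriv hinv h'.target_mem.1 h.target_mem.1
    h'.target_mem.2 h.target_mem.2
  rw [hdet, hmatrix, ← hpull, LinearMap.BilinForm.comp_comp, det_toMatrix_comp_self,
    hol.abs_det_eq h (h'.change h.target_mem.1 h.target_mem.2)]
  rfl

lemma exists_detG_eventuallyEq [ConnectedSpace B] (hol : P.HolonomyDetPmOne)
    (hinv : P.IsInvariantMetric gM) (v : Module.Basis (Fin N) ℝ (Coord (Fin N)))
    (he₀ : e₀ ∈ P.atlas) (hb₀ : b₀ ∈ e₀.baseSet) (he : e ∈ P.atlas)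
    {φ : OpenPartialHomeomorph B (Coord (Fin n))} {y : Coord (Fin n)} (hy : y ∈ φ.target)
    (hb : φ.symm y ∈ e.baseSet) :
    ∃ c : ℝ, 0 < c ∧
      (fun z => P.detG gM v e₀ b₀ (φ.symm z)) =ᶠ[𝓝 y] fun z => c * (matG gM e v φ z).det := by
  have : LocallyPathConnectedSpace B := ChartedSpace.locallyPathConnectedSpace (Coord (Fin n)) B
  obtain ⟨L, hL⟩ := P.exists_transport he₀ hb₀ he hb
  refine ⟨|LinearMap.det L.toLinearMap| ^ 2, pow_pos (abs_pos.2 (hol.det_ne_zero hL)) 2, ?_⟩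
  have hjoined : ∀ᶠ b in 𝓝 (φ.symm y), JoinedIn e.baseSet (φ.symm y) b :=
    pathComponentIn_mem_nhds (e.open_baseSet.mem_nhds hb)
  filter_upwards [(φ.continuousAt_symm hy).eventually hjoined] with z hz
  rw [detG_eq hol hinv v (hL.move hz), matG_eq_toMatrix]

variable [ConnectedSpace B] {v : Module.Basis (Fin N) ℝ (Coord (Fin N))}
  (hol : P.HolonomyDetPmOne) (hinv : P.IsInvariantMetric gM) (he₀ : e₀ ∈ P.atlas)
  (hb₀ : b₀ ∈ e₀.baseSet)

include hol hinv he₀ hb₀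

lemma detG_pos (b : B) : 0 < P.detG gM v e₀ b₀ b := by
  obtain ⟨e, he, hb⟩ := P.exists_mem_baseSet b
  have hsymm : (chartAt (Coord (Fin n)) b).symm (chartAt (Coord (Fin n)) b b) = b :=
    (chartAt (Coord (Fin n)) b).left_inv (mem_chart_source _ b)
  rw [← hsymm] at hb ⊢
  obtain ⟨c, hc, hdet⟩ := exists_detG_eventuallyEq hol hinv v he₀ hb₀ he
    (mem_chart_target (Coord (Fin n)) b) hb
  rw [show P.detG gM v e₀ b₀ _ = _ from hdet.self_of_nhds]
  exact mul_pos hc (posDef_matG gM v he hb).det_pos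

lemma contMDiff_sqrt_detG [IsManifold 𝓘(ℝ, Coord (Fin n)) ∞ B] :
    ContMDiff 𝓘(ℝ, Coord (Fin n)) 𝓘(ℝ, ℝ) ∞ fun b => √(P.detG gM v e₀ b₀ b) := by
  intro b
  obtain ⟨e, he, hb⟩ := P.exists_mem_baseSet b
  set φ := chartAt (Coord (Fin n)) b
  have hφ : φ ∈ charts (Fin n) B := IsManifold.chart_mem_maximalAtlas b
  have hsource : b ∈ φ.source := mem_chart_source _ b
  have hsymm : φ.symm (φ b) = b := φ.left_inv hsource
  rw [← hsymm] at hb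
  obtain ⟨c, -, hdet⟩ := exists_detG_eventuallyEq hol hinv v he₀ hb₀ he (φ.map_source hsource) hb
  have hsmooth : ContDiffAt ℝ ∞ (fun z => √(P.detG gM v e₀ b₀ (φ.symm z))) (φ b) :=
    ((contDiffAt_const.mul (smoothMatAt_matG gM v he hφ (φ.map_source hsource) hb).det
      ).congr_of_eventuallyEq hdet).sqrt (detG_pos hol hinv he₀ hb₀ _).ne'
  have hcomp := ContMDiffAt.comp b hsmooth.contMDiffAt
    (contMDiffAt_of_mem_maximalAtlas hφ hsource)
  refine hcomp.congr_of_eventuallyEq ?_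
  filter_upwards [φ.open_source.mem_nhds hsource] with b' hb'
  rw [Function.comp_apply, φ.left_inv hb']

lemma trace_inv_mul_pdMat_matG_eq_zero (he : e ∈ P.atlas)
    {φ : OpenPartialHomeomorph B (Coord (Fin n))} (hφ : φ ∈ charts (Fin n) B)
    {y : Coord (Fin n)} (hy : y ∈ φ.target) (hb : φ.symm y ∈ e.baseSet) {C : ℝ}
    (hconst : ∀ b, P.detG gM v e₀ b₀ b = C) (α : Fin n) :
    ((matG gM e v φ y)⁻¹ * pdMat α (matG gM e v φ) y).trace = 0 := by
  obtain ⟨c, hc, hdet⟩ := exists_detG_eventuallyEq hol hinv v he₀ hb₀ he hy hb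
  have hpos : 0 < (matG gM e v φ y).det := (posDef_matG gM v he hb).det_pos
  have hdet_const : (fun z => (matG gM e v φ z).det) =ᶠ[𝓝 y] fun _ => C / c := by
    filter_upwards [hdet] with z hz
    rw [eq_div_iff hc.ne', mul_comm, ← hz, hconst]
  have hpd := pd_det (i := α) (smoothMatAt_matG gM v he hφ hy hb) hpos.ne'
  rw [pd_congr hdet_const, pd_const] at hpd
  exact (mul_eq_zero.1 hpd.symm).resolve_left hpos.ne'

end DetG

section EinsteinBundle

variable {n N : ℕ}
variable {B : Type*} [TopologicalSpace B] [ChartedSpace (Coord (Fin n)) B]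
  [IsManifold 𝓘(ℝ, Coord (Fin n)) ∞ B]
variable {M : Type*} [TopologicalSpace M] [ChartedSpace (Coord (Fin n ⊕ Fin N)) M]
  [IsManifold 𝓘(ℝ, Coord (Fin n ⊕ Fin N)) ∞ M]
variable {𝒢 : Type*} [CommGroup 𝒢] [TopologicalSpace 𝒢] [ChartedSpace (Coord (Fin N)) 𝒢]
variable {proj : M → B} {P : TwistedPrincipalBundle (n := n) (N := N) 𝒢 proj}
variable {gM : Metric (Fin n ⊕ Fin N) M} {gB : Metric (Fin n) B}
  {v : Module.Basis (Fin N) ℝ (Coord (Fin N))}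
variable {e e₀ : Trivialization 𝒢 proj} {b₀ : B}
variable {φ : OpenPartialHomeomorph B (Coord (Fin n))} {y : Coord (Fin n)}

lemma normSqF_eq_formNormSq : normSqF gM gB e v φ y =
    formNormSq (metricCoeff gB φ y) (matG gM e v φ y) fun α β I => curvF gM e v φ I α β y := by
  simp only [normSqF, formNormSq, dotProduct, Matrix.mulVec, Finset.mul_sum]
  refine Finset.sum_congr rfl fun α _ => Finset.sum_congr rfl fun β _ =>
    Finset.sum_congr rfl fun γ _ => Finset.sum_congr rfl fun δ _ =>
    Finset.sum_congr rfl fun I _ => Finset.sum_congr rfl fun J _ => ?_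
  ring

variable (he : e ∈ P.atlas) (hφ : φ ∈ charts (Fin n) B) (hy : y ∈ φ.target)
  (hb : φ.symm y ∈ e.baseSet)

include he hφ hy hb

lemma normSqF_nonneg : 0 ≤ normSqF gM gB e v φ y := by
  rw [normSqF_eq_formNormSq]
  exact formNormSq_nonneg (posDef_metricCoeff gB hφ hy) (posDef_matG gM v he hb) _

lemma curvF_eq_zero_of_normSqF_eq_zero (hF : normSqF gM gB e v φ y = 0) (I : Fin N)
    (α β : Fin n) : curvF gM e v φ I α β y = 0 := by
  rw [normSqF_eq_formNormSq] at hF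
  exact congrFun (congrFun₂ (eq_zero_of_formNormSq_eq_zero (posDef_metricCoeff gB hφ hy)
    (posDef_matG gM v he hb) hF) α β) I

variable [LieGroup 𝓘(ℝ, Coord (Fin N)) ∞ 𝒢] [ConnectedSpace B] (hol : P.HolonomyDetPmOne)
  (hinv : P.IsInvariantMetric gM) (he₀ : e₀ ∈ P.atlas) (hb₀ : b₀ ∈ e₀.baseSet)
  (hsub : IsRiemannianSubmersion proj gM gB)

include hol hinv he₀ hb₀ hsub

lemma harmonicG_eq_zero (hE : IsEinstein gM 0) {C : ℝ} (hconst : ∀ b, P.detG gM v e₀ b₀ b = C)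
    (hF : ∀ I α β, curvF gM e v φ I α β y = 0) (I J : Fin N) :
    harmonicG gM gB e v φ I J y = 0 := by
  have hcurv : (fun α β I => curvF gM e v φ I α β y) = 0 :=
    funext fun α => funext fun β => funext fun I => hF I α β
  have hricci := fiberRicci_eq_smul_of_isEinstein v he hφ hy hb hinv hsub hE
  rw [hcurv, zero_smul] at hricci
  exact harmonic_of_fiberRicci_eq_zero _ hricci
    (trace_inv_mul_pdMat_matG_eq_zero hol hinv he₀ hb₀ he hφ hy hb hconst) I J

variable {lam : ℝ} (hE : IsEinstein gM lam)

include hE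

theorem coordLaplacian_sqrt_detG :
    coordLaplacian (metricCoeff gB φ) (fun z => √(P.detG gM v e₀ b₀ (φ.symm z))) y =
      ((1 / 4) * normSqF gM gB e v φ y - lam * N) * √(P.detG gM v e₀ b₀ (φ.symm y)) := by
  obtain ⟨c, hc, hdet⟩ := exists_detG_eventuallyEq hol hinv v he₀ hb₀ he hy hb
  have hsqrt : (fun z => √(P.detG gM v e₀ b₀ (φ.symm z))) =ᶠ[𝓝 y]
      fun z => √c * √(matG gM e v φ z).det :=
    hdet.mono fun z hz => (congrArg Real.sqrt hz).trans (Real.sqrt_mul hc.le _)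
  have hsmooth : ∀ᶠ z in 𝓝 y, SmoothMatAt (matG gM e v φ) z :=
    (eventually_mem_target_baseSet hy hb).mono fun z hz => smoothMatAt_matG gM v he hφ hz.1 hz.2
  rw [show √(P.detG gM v e₀ b₀ (φ.symm y)) = _ from hsqrt.self_of_nhds,
    coordLaplacian_congr _ hsqrt, coordLaplacian_const_mul,
    coordLaplacian_sqrt_det_of_fiberRicci_eq_smul _ hsmooth (posDef_matG gM v he hb).det_pos
      (fiberRicci_eq_smul_of_isEinstein v he hφ hy hb hinv hsub hE),
    normSqF_eq_formNormSq, Fintype.card_fin]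
  ring

lemma normSqF_eq_zero_and_lam_eq_zero (hN : 1 ≤ N) (hlam : lam ≤ 0) {C : ℝ}
    (hconst : ∀ b, P.detG gM v e₀ b₀ b = C) : normSqF gM gB e v φ y = 0 ∧ lam = 0 := by
  have hlap := coordLaplacian_sqrt_detG he hφ hy hb hol hinv he₀ hb₀ hsub hE (v := v)
  have hsqrt : √C ≠ 0 := by
    rw [← hconst b₀]
    exact (Real.sqrt_pos.2 (detG_pos hol hinv he₀ hb₀ b₀)).ne'
  simp only [hconst, coordLaplacian_const] at hlap
  have hcoeff := (mul_eq_zero.1 hlap.symm).resolve_right hsqrt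
  have hF : 0 ≤ normSqF gM gB e v φ y := normSqF_nonneg he hφ hy hb
  have hlamN : lam * N ≤ 0 := mul_nonpos_of_nonpos_of_nonneg hlam N.cast_nonneg
  refine ⟨by linarith, (mul_eq_zero.1 (by linarith : lam * N = 0)).resolve_right ?_⟩
  exact Nat.cast_ne_zero.2 (Nat.one_le_iff_ne_zero.1 hN)

omit he hφ hy hb in
lemma isSubharmonic_sqrt_detG (hlam : lam ≤ 0) :
    IsSubharmonic gB fun b => √(P.detG gM v e₀ b₀ b) := by
  intro φ hφ y hy
  obtain ⟨e, he, hb⟩ := P.exists_mem_baseSet (φ.symm y)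
  rw [coordLaplacian_sqrt_detG he hφ hy hb hol hinv he₀ hb₀ hsub hE]
  have hF : 0 ≤ normSqF gM gB e v φ y := normSqF_nonneg he hφ hy hb
  have hlamN : lam * N ≤ 0 := mul_nonpos_of_nonpos_of_nonneg hlam N.cast_nonneg
  exact mul_nonneg (by linarith) (Real.sqrt_nonneg _)

omit he hφ hy hb in
lemma exists_detG_eq_const (hpar : IsParabolic gB) (hlam : lam ≤ 0)
    (hbdd : BddAbove (range (P.detG gM v e₀ b₀))) : ∃ C, ∀ b, P.detG gM v e₀ b₀ b = C := by
  have hbdd_sqrt : BddAbove (range fun b => √(P.detG gM v e₀ b₀ b)) := by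
    obtain ⟨K, hK⟩ := hbdd
    exact ⟨√K, forall_mem_range.2 fun b => Real.sqrt_le_sqrt (hK ⟨b, rfl⟩)⟩
  obtain ⟨C, hC⟩ := hpar _
    ((contMDiff_sqrt_detG hol hinv he₀ hb₀).of_le (by norm_cast))
    (fun _ => Real.sqrt_nonneg _) hbdd_sqrt (isSubharmonic_sqrt_detG hol hinv he₀ hb₀ hsub hE hlam)
  exact ⟨C ^ 2, fun b => by rw [← hC b, Real.sq_sqrt (detG_pos hol hinv he₀ hb₀ b).le]⟩

end EinsteinBundle

end TwistedBundle

end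

theorem proposition2p10_general {n N : ℕ} (hN : 1 ≤ N)
    {B : Type*} [TopologicalSpace B] [ConnectedSpace B]
    [ChartedSpace (Coord (Fin n)) B] [IsManifold 𝓘(ℝ, Coord (Fin n)) ∞ B]
    {M : Type*} [TopologicalSpace M]
    [ChartedSpace (Coord (Fin n ⊕ Fin N)) M] [IsManifold 𝓘(ℝ, Coord (Fin n ⊕ Fin N)) ∞ M]
    {𝒢 : Type*} [CommGroup 𝒢] [TopologicalSpace 𝒢]
    [ChartedSpace (Coord (Fin N)) 𝒢] [LieGroup 𝓘(ℝ, Coord (Fin N)) ∞ 𝒢]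
    (proj : M → B) (P : TwistedPrincipalBundle (n := n) (N := N) 𝒢 proj)
    (hol : P.HolonomyDetPmOne)
    (gM : Metric (Fin n ⊕ Fin N) M) (hinv : P.IsInvariantMetric gM)
    (gB : Metric (Fin n) B) (hsub : IsRiemannianSubmersion proj gM gB)
    (lam : ℝ) (hE : IsEinstein gM lam)
    (v : Module.Basis (Fin N) ℝ (Coord (Fin N)))
    (e₀ : Trivialization 𝒢 proj) (he₀ : e₀ ∈ P.atlas) (b₀ : B) (hb₀ : b₀ ∈ e₀.baseSet) :
    (∀ φ ∈ charts (Fin n) B, ∀ e ∈ P.atlas, ∀ y ∈ φ.target, φ.symm y ∈ e.baseSet →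
      coordLaplacian (metricCoeff gB φ) (fun z => √(P.detG gM v e₀ b₀ (φ.symm z))) y =
        ((1 / 4) * normSqF gM gB e v φ y - lam * N) * √(P.detG gM v e₀ b₀ (φ.symm y))) ∧
    (IsParabolic gB → lam ≤ 0 → BddAbove (range (P.detG gM v e₀ b₀)) →
      (∃ c : ℝ, ∀ b, P.detG gM v e₀ b₀ b = c) ∧
      (∀ φ ∈ charts (Fin n) B, ∀ e ∈ P.atlas, ∀ y ∈ φ.target, φ.symm y ∈ e.baseSet →
        ∀ I α β, curvF gM e v φ I α β y = 0) ∧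
      lam = 0 ∧
      (∀ φ ∈ charts (Fin n) B, ∀ e ∈ P.atlas, ∀ y ∈ φ.target, φ.symm y ∈ e.baseSet →
        ∀ I J, harmonicG gM gB e v φ I J y = 0)) := by
  refine ⟨fun φ hφ e he y hy hb =>
    coordLaplacian_sqrt_detG he hφ hy hb hol hinv he₀ hb₀ hsub hE, fun hpar hlam hbdd => ?_⟩
  obtain ⟨C, hC⟩ := exists_detG_eq_const hol hinv he₀ hb₀ hsub hE hpar hlam hbdd
  have hF : ∀ φ ∈ charts (Fin n) B, ∀ e ∈ P.atlas, ∀ y ∈ φ.target, φ.symm y ∈ e.baseSet →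
      ∀ I α β, curvF gM e v φ I α β y = 0 := fun φ hφ e he y hy hb =>
    curvF_eq_zero_of_normSqF_eq_zero he hφ hy hb
      (normSqF_eq_zero_and_lam_eq_zero he hφ hy hb hol hinv he₀ hb₀ hsub hE hN hlam hC).1
  have hlam_zero : lam = 0 :=
    (normSqF_eq_zero_and_lam_eq_zero he₀ (IsManifold.chart_mem_maximalAtlas b₀)
      (mem_chart_target (Coord (Fin n)) b₀)
      (by rwa [OpenPartialHomeomorph.left_inv _ (mem_chart_source _ b₀)])
      hol hinv he₀ hb₀ hsub hE hN hlam hC).2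
  refine ⟨⟨C, hC⟩, hF, hlam_zero, fun φ hφ e he y hy hb => ?_⟩
  exact harmonicG_eq_zero he hφ hy hb hol hinv he₀ hb₀ hsub (hlam_zero ▸ hE) hC
    (hF φ hφ e he y hy hb)

theorem proposition2p10 {n N : ℕ} (hN : 1 ≤ N)
    {B : Type*} [TopologicalSpace B] [T2Space B] [SecondCountableTopology B] [ConnectedSpace B]
    [ChartedSpace (Coord (Fin n)) B] [IsManifold 𝓘(ℝ, Coord (Fin n)) ∞ B]
    {M : Type*} [TopologicalSpace M] [T2Space M] [SecondCountableTopology M]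
    [ChartedSpace (Coord (Fin n ⊕ Fin N)) M] [IsManifold 𝓘(ℝ, Coord (Fin n ⊕ Fin N)) ∞ M]
    {𝒢 : Type*} [CommGroup 𝒢] [TopologicalSpace 𝒢] [T2Space 𝒢] [SecondCountableTopology 𝒢]
    [ConnectedSpace 𝒢] [ChartedSpace (Coord (Fin N)) 𝒢] [LieGroup 𝓘(ℝ, Coord (Fin N)) ∞ 𝒢]
    (proj : M → B) (P : TwistedPrincipalBundle (n := n) (N := N) 𝒢 proj)
    (hol : P.HolonomyDetPmOne)
    (gM : Metric (Fin n ⊕ Fin N) M) (hinv : P.IsInvariantMetric gM)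
    (gB : Metric (Fin n) B) (hsub : IsRiemannianSubmersion proj gM gB)
    (lam : ℝ) (hE : IsEinstein gM lam)
    (v : Module.Basis (Fin N) ℝ (Coord (Fin N)))
    (e₀ : Trivialization 𝒢 proj) (he₀ : e₀ ∈ P.atlas) (b₀ : B) (hb₀ : b₀ ∈ e₀.baseSet) :
    (∀ φ ∈ charts (Fin n) B, ∀ e ∈ P.atlas, ∀ y ∈ φ.target, φ.symm y ∈ e.baseSet →
      coordLaplacian (metricCoeff gB φ) (fun z => √(P.detG gM v e₀ b₀ (φ.symm z))) y =
        ((1 / 4) * normSqF gM gB e v φ y - lam * N) * √(P.detG gM v e₀ b₀ (φ.symm y))) ∧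
    (IsParabolic gB → lam ≤ 0 → BddAbove (range (P.detG gM v e₀ b₀)) →
      (∃ c : ℝ, ∀ b, P.detG gM v e₀ b₀ b = c) ∧
      (∀ φ ∈ charts (Fin n) B, ∀ e ∈ P.atlas, ∀ y ∈ φ.target, φ.symm y ∈ e.baseSet →
        ∀ I α β, curvF gM e v φ I α β y = 0) ∧
      lam = 0 ∧
      (∀ φ ∈ charts (Fin n) B, ∀ e ∈ P.atlas, ∀ y ∈ φ.target, φ.symm y ∈ e.baseSet →
        ∀ I J, harmonicG gM gB e v φ I J y = 0)) :=
  proposition2p10_general hN proj P hol gM hinv gB hsub lam hE v e₀ he₀ b₀ hb₀
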